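/- Let $\mathcal X,\mathcal Y$ be finite nonempty alphabets and let $p(y|x)$ be a discrete memoryless channel (DMC) from $\mathcal X$ to $\mathcal Y$. All entropies and mutual informations are in bits. Protocols. Alice holds two strings $S_0,S_1$, Bob holds a bit $K$; $(S_0,S_1,K)$ is uniform on $\{0,1\}^m\times\{0,1\}^m\times\{0,1\}$. Alice and Bob have private random variables (on arbitrary probability spaces), independent of each other, of $(S_0,S_1,K)$ and of the channel noise. They use the DMC exactly $n$ times, with inputs $X^n$ chosen by Alice and outputs $Y^n$ received by Bob. Before each use and after the last one they exchange messages (finite bit strings) over a noiseless discussion channel; whose turn it is, and whether the current discussion is over, is determined by the messages exchanged so far and the number of channel uses so far. Every message and every channel input is a function of what its sender knows at that time. The number of messages is not bounded, but it is finite with probability one; $F$ is the transcript of all messages. At the end Bob outputs a string $\widehat{S_K}$. Both users follow the protocol (they are honest but curious). The protocol is $(n,m,\epsilon)$ secure if $$P(\widehat{S_K}=S_K)\ge 1-\epsilon,\qquad I(F,X^n;K\mid S_0,S_1)\le\epsilon,\qquad I(F,Y^n;S_{\bar K}\mid K)\le n\epsilon,$$ where $\bar K=1-K$. A rate $R\ge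 0$ is achievable if there are $(n,\lfloor nR\rfloor,\epsilon_n)$ secure protocols, for all $n$, with $\epsilon_n\to0$. The string oblivious transfer capacity $C$ of the DMC is the supremum of the achievable rates. Theorem. One has $$C\;\le\;\max_{p(x)}\ \min_{Q-X-Y}\ \bigl[\,I(X;Q|Y)+I(X;Y|Q)\,\bigr],$$ where the maximum is over all probability distributions on $\mathcal X$, $(X,Y)$ has law $p(x)p(y|x)$, and the minimum is over all random variables $Q$ jointly distributed with $(X,Y)$ such that $Q-X-Y$ is a Markov chain and $Q$ takes at most $|\mathcal X||\mathcal Y|+2$ values; the minima and the maximum are attained. Moreover, for every $p(x)$ the numbers $I(X;Y)$ and $H(X|Y)$ are among the values of $I(X;Q|Y)+I(X;Y|Q)$ that are minimized (they arise from a constant $Q$ and from $Q=X$), and hence $$\max_{p(x)}\ \min_{Q-X-Y}\ \bigl[\,I(X;Q|Y)+I(X;Y|Q)\,\bigr]\;\le\;\max_{p(x)}\ \min\bigl(I(X;Y),\,H(X|Y)\bigr),$$ so that the bound implies the Ahlswede–Csiszár bound $C\le\max_{p(x)}\min(I(X;Y),H(X|Y))$. -/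

import Mathlib

open Set Filter Topology MeasureTheory

universe u v w

/-! ### Entropy and mutual information (in bits) -/

/-- `H(B | A)` in bits, for a finitely valued `B` and a countably valued `A`:
the average over `a` of the entropy of the conditional law of `B` given `A = a`. -/
noncomputable def condEntropy {Ω α β : Type*} {mΩ : MeasurableSpace Ω} [Countable α] [Fintype β]
    (μ : Measure Ω) (B : Ω → β) (A : Ω → α) : ℝ :=
  ∑' a : α, μ.real {ω | A ω = a} *
    ∑ b : β, Real.negMulLog (μ.real {ω | A ω = a ∧ B ω = b} / μ.real {ω | A ω = a}) / Real.log 2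

/-- `I(A ; B | C) = H(B | C) - H(B | A, C)` in bits, for a finitely valued `B` and countably valued
`A`, `C`; all the entropies in it are finite. -/
noncomputable def condMutualInfo {Ω α β γ : Type*} {mΩ : MeasurableSpace Ω}
    [Countable α] [Fintype β] [Countable γ]
    (μ : Measure Ω) (A : Ω → α) (B : Ω → β) (C : Ω → γ) : ℝ :=
  condEntropy μ B C - condEntropy μ B (fun ω => (A ω, C ω))

/-- `I(A ; B)` in bits. -/
noncomputable def mutualInfo {Ω α β : Type*} {mΩ : MeasurableSpace Ω} [Countable α] [Fintype β]
    (μ : Measure Ω) (A : Ω → α) (B : Ω → β) : ℝ :=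
  condMutualInfo μ A B (fun _ => ())

/-- The measure of a discrete law, all sets being measurable. -/
noncomputable def discreteLaw {α : Type*} (r : PMF α) : @Measure α ⊤ :=
  @PMF.toMeasure α ⊤ r

/-! ### The single-letter expression

A discrete memoryless channel `p(y|x)` with finite alphabets is a map `W : 𝒳 → PMF 𝒴`. -/

section SingleLetter

variable {𝒳 : Type u} {𝒴 : Type v}

/-- The joint law `p(x) p(y|x)` of input and output. -/
noncomputable def inputOutput (W : 𝒳 → PMF 𝒴) (p : PMF 𝒳) : PMF (𝒳 × 𝒴) :=
  p.bind fun x => (W x).map fun y => (x, y)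

/-- Under the joint law `r` of `(X, Y, Q)`, `Q - X - Y` is a Markov chain:
`p(x,y,q) p(x) = p(x,y) p(x,q)`. -/
def IsMarkovQXY {𝒬 : Type*} (r : PMF (𝒳 × 𝒴 × 𝒬)) : Prop :=
  ∀ x y q, r (x, y, q) * (r.map fun t => t.1) x =
    (r.map fun t => (t.1, t.2.1)) (x, y) * (r.map fun t => (t.1, t.2.2)) (x, q)

/-- `I(X;Q|Y) + I(X;Y|Q)` under the joint law `r` of `(X, Y, Q)`. -/
noncomputable def tensionSum [Fintype 𝒳] [Fintype 𝒴] {𝒬 : Type*} [Fintype 𝒬]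
    (r : PMF (𝒳 × 𝒴 × 𝒬)) : ℝ :=
  condMutualInfo (discreteLaw r) (fun t => t.1) (fun t => t.2.2) (fun t => t.2.1) +
    condMutualInfo (discreteLaw r) (fun t => t.1) (fun t => t.2.1) (fun t => t.2.2)

/-- All values of `I(X;Q|Y) + I(X;Y|Q)`, where `(X, Y)` has law `p(x) p(y|x)` and `Q` is jointly
distributed with it, `Q - X - Y` is a Markov chain and `Q` takes at most `|𝒳| |𝒴| + 2` values. -/
def tensionValues [Fintype 𝒳] [Fintype 𝒴] (W : 𝒳 → PMF 𝒴) (p : PMF 𝒳) : Set ℝ :=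
  {t | ∃ k : ℕ, k ≤ Fintype.card 𝒳 * Fintype.card 𝒴 + 2 ∧ ∃ r : PMF (𝒳 × 𝒴 × Fin k),
    (r.map fun t => (t.1, t.2.1)) = inputOutput W p ∧ IsMarkovQXY r ∧ t = tensionSum r}

/-- `I(X;Y)` for input law `p`. -/
noncomputable def inputOutputInfo [Fintype 𝒳] [Fintype 𝒴] (W : 𝒳 → PMF 𝒴) (p : PMF 𝒳) : ℝ :=
  mutualInfo (discreteLaw (inputOutput W p)) (fun t => t.1) (fun t => t.2)

/-- `H(X|Y)` for input law `p`. -/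
noncomputable def inputEquivocation [Fintype 𝒳] [Fintype 𝒴] (W : 𝒳 → PMF 𝒴) (p : PMF 𝒳) : ℝ :=
  condEntropy (discreteLaw (inputOutput W p)) (fun t => t.1) (fun t => t.2)

end SingleLetter

/-! ### The noise of a memoryless channel -/

/-- A realisation of the noise in `n` uses of a channel: `z.out i x` is the output of the `i`-th
use if its input is `x`. -/
@[ext] structure ChannelNoise (𝒳 : Type u) (𝒴 : Type v) (n : ℕ) : Type (max u v) where
  out : Fin n → 𝒳 → 𝒴

instance (𝒳 : Type u) (𝒴 : Type v) (n : ℕ) : MeasurableSpace (ChannelNoise 𝒳 𝒴 n) := ⊤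

/-- A realisation of the noise is a family of maps `𝒳 → 𝒴`. -/
def channelNoiseEquiv (𝒳 : Type u) (𝒴 : Type v) (n : ℕ) :
    (Fin n → 𝒳 → 𝒴) ≃ ChannelNoise 𝒳 𝒴 n where
  toFun g := ⟨g⟩
  invFun z := z.out
  left_inv _ := rfl
  right_inv _ := rfl

open Classical in
noncomputable instance (𝒳 : Type u) (𝒴 : Type v) [Fintype 𝒳] [Fintype 𝒴] (n : ℕ) :
    Fintype (ChannelNoise 𝒳 𝒴 n) :=
  Fintype.ofEquiv _ (channelNoiseEquiv 𝒳 𝒴 n)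

theorem sum_channelNoise {𝒳 : Type u} {𝒴 : Type v} [Fintype 𝒳] [Fintype 𝒴]
    (W : 𝒳 → PMF 𝒴) (n : ℕ) :
    ∑ z : ChannelNoise 𝒳 𝒴 n, ∏ i : Fin n, ∏ x : 𝒳, W x (z.out i x) = 1 := by
  classical
  have h1 : ∀ x, ∑ y, W x y = 1 := fun x => by
    rw [← tsum_fintype (L := .unconditional _)]; exact (W x).tsum_coe
  have h2 : ∑ g : 𝒳 → 𝒴, ∏ x : 𝒳, W x (g x) = 1 := by
    rw [← Fintype.prod_sum]; simp [h1]
  have h3 : ∑ z : Fin n → 𝒳 → 𝒴, ∏ i : Fin n, ∏ x : 𝒳, W x (z i x) = 1 := by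
    rw [← Fintype.prod_sum (fun (_ : Fin n) (g : 𝒳 → 𝒴) => ∏ x : 𝒳, W x (g x))]; simp [h2]
  rw [← h3]
  exact (Fintype.sum_equiv (channelNoiseEquiv 𝒳 𝒴 n) _ _ fun _ => rfl).symm

/-- The law of the noise of the memoryless channel `W`: the `z.out i x` are independent, and
`z.out i x` has law `W x`. -/
noncomputable def channelNoise {𝒳 : Type u} {𝒴 : Type v} [Fintype 𝒳] [Fintype 𝒴]
    (W : 𝒳 → PMF 𝒴) (n : ℕ) : PMF (ChannelNoise 𝒳 𝒴 n) :=
  PMF.ofFintype (fun z => ∏ i : Fin n, ∏ x : 𝒳, W x (z.out i x)) (sum_channelNoise W n)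

/-! ### Oblivious transfer protocols -/

/-- Strings of `m` bits. -/
abbrev BitString (m : ℕ) : Type := Fin m → Bool

/-- A message on the noiseless discussion channel: any finite bit string. -/
abbrev Msg : Type := List Bool

/-- What happens next: Alice sends a message, or Bob sends a message, or the current discussion
is over. -/
inductive Turn where
  | alice
  | bob
  | channel

/-- The state of an execution: the messages exchanged, the channel inputs and the channel outputs
so far, each in chronological order. -/
structure OTState (𝒳 : Type u) (𝒴 : Type v) where
  msgs : List Msg
  xs : List 𝒳
  ys : List 𝒴

/-- A protocol with `n` channel uses for oblivious transfer of strings of length `m`.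
Alice acts on her strings, her private randomness, her channel inputs so far and the messages so
far; Bob acts on his bit, his private randomness, his channel outputs so far and the messages so
far. Whose turn it is depends on what both of them know: the number of channel uses and the
messages so far. -/
structure OTProtocol (𝒳 : Type u) (𝒴 : Type v) (n m : ℕ) where
  /-- Alice's private randomness -/
  RA : Type w
  [measurableA : MeasurableSpace RA]
  lawA : Measure RA
  [probA : IsProbabilityMeasure lawA]
  /-- Bob's private randomness -/
  RB : Type w
  [measurableB : MeasurableSpace RB]
  lawB : Measure RB
  [probB : IsProbabilityMeasure lawB]
  turn : ℕ → List Msg → Turn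
  msgA : BitString m → BitString m → RA → List 𝒳 → List Msg → Msg
  input : BitString m → BitString m → RA → List 𝒳 → List Msg → 𝒳
  msgB : Bool → RB → List 𝒴 → List Msg → Msg
  output : Bool → RB → List 𝒴 → List Msg → BitString m
  measurable_msgA : ∀ s₀ s₁ xs f a, MeasurableSet {r | msgA s₀ s₁ r xs f = a}
  measurable_input : ∀ s₀ s₁ xs f x, MeasurableSet {r | input s₀ s₁ r xs f = x}
  measurable_msgB : ∀ k ys f b, MeasurableSet {r | msgB k r ys f = b}
  measurable_output : ∀ k ys f s, MeasurableSet {r | output k r ys f = s}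

attribute [instance] OTProtocol.measurableA OTProtocol.probA
  OTProtocol.measurableB OTProtocol.probB

namespace OTProtocol

variable {𝒳 : Type u} {𝒴 : Type v} {n m : ℕ} (P : OTProtocol.{u, v, w} 𝒳 𝒴 n m)

/-- The sample space: `((S₀, S₁, K), (Alice's randomness, Bob's randomness), channel noise)`. -/
abbrev Sample : Type (max u v w) :=
  (BitString m × BitString m × Bool) × (P.RA × P.RB) × ChannelNoise 𝒳 𝒴 n

/-- `S₀, S₁, K` are uniform, and independent of the private randomness of Alice, of that of Bob,
and of the channel noise, which are independent of each other. -/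
noncomputable def law [Fintype 𝒳] [Fintype 𝒴] (W : 𝒳 → PMF 𝒴) : Measure P.Sample :=
  (PMF.uniformOfFintype (BitString m × BitString m × Bool)).toMeasure.prod
    ((P.lawA.prod P.lawB).prod (channelNoise W n).toMeasure)

def S₀ (ω : P.Sample) : BitString m := ω.1.1
def S₁ (ω : P.Sample) : BitString m := ω.1.2.1
def K (ω : P.Sample) : Bool := ω.1.2.2
/-- The string `S_K` that Bob chose. -/
def chosen (ω : P.Sample) : BitString m := if P.K ω then P.S₁ ω else P.S₀ ω
/-- The string that Bob did not choose. -/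
def unchosen (ω : P.Sample) : BitString m := if P.K ω then P.S₀ ω else P.S₁ ω

/-- One step of the execution. When a discussion is over the channel is used, unless all its `n`
uses have been made, in which case the execution has ended and the state does not change. -/
def step (ω : P.Sample) (st : OTState 𝒳 𝒴) : OTState 𝒳 𝒴 :=
  match P.turn st.xs.length st.msgs with
  | .alice =>
    { st with msgs := st.msgs ++ [P.msgA (P.S₀ ω) (P.S₁ ω) ω.2.1.1 st.xs st.msgs] }
  | .bob =>
    { st with msgs := st.msgs ++ [P.msgB (P.K ω) ω.2.1.2 st.ys st.msgs] }
  | .channel =>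
    if h : st.xs.length < n then
      let x := P.input (P.S₀ ω) (P.S₁ ω) ω.2.1.1 st.xs st.msgs
      { st with xs := st.xs ++ [x], ys := st.ys ++ [ω.2.2.out ⟨st.xs.length, h⟩ x] }
    else st

/-- The state after `t` steps. -/
def stateAt (ω : P.Sample) (t : ℕ) : OTState 𝒳 𝒴 := (P.step ω)^[t] ⟨[], [], []⟩

/-- The `n` channel uses have been made and the last discussion is over. -/
def Ended (st : OTState 𝒳 𝒴) : Prop :=
  n ≤ st.xs.length ∧ P.turn st.xs.length st.msgs = .channel

/-- The state at the end of the execution. (If there is no end, this is the initial state.) -/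
noncomputable def final (ω : P.Sample) : OTState 𝒳 𝒴 :=
  P.stateAt ω (sInf {t | P.Ended (P.stateAt ω t)})

/-- The transcript `F` of the discussion, the channel inputs `Xⁿ`, the channel outputs `Yⁿ`, and
the string that Bob outputs. -/
noncomputable def F (ω : P.Sample) : List Msg := (P.final ω).msgs
noncomputable def Xn (ω : P.Sample) : List 𝒳 := (P.final ω).xs
noncomputable def Yn (ω : P.Sample) : List 𝒴 := (P.final ω).ys
noncomputable def bobOutput (ω : P.Sample) : BitString m :=
  P.output (P.K ω) ω.2.1.2 (P.Yn ω) (P.F ω)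

/-- `P` is an `(n, m, ε)` secure protocol over the channel `W` for honest-but-curious users. -/
structure IsSecure [Fintype 𝒳] [Fintype 𝒴] (W : 𝒳 → PMF 𝒴) (ε : ℝ) : Prop where
  /-- the number of messages is finite with probability one -/
  ends : ∀ᵐ ω ∂P.law W, ∃ t, P.Ended (P.stateAt ω t)
  correct : 1 - ε ≤ (P.law W).real {ω | P.bobOutput ω = P.chosen ω}
  /-- privacy for Bob: `I(F, Xⁿ ; K | S₀, S₁) ≤ ε` -/
  privacy_bob : condMutualInfo (P.law W) (fun ω => (P.F ω, P.Xn ω)) P.K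
    (fun ω => (P.S₀ ω, P.S₁ ω)) ≤ ε
  /-- privacy for Alice: `I(F, Yⁿ ; S_{1-K} | K) ≤ n ε` -/
  privacy_alice : condMutualInfo (P.law W) (fun ω => (P.F ω, P.Yn ω)) P.unchosen P.K ≤ n * ε

end OTProtocol

/-- The rate `R` is achievable: there are `(n, ⌊nR⌋, ε_n)` secure protocols with `ε_n → 0`. -/
def OTAchievable {𝒳 : Type u} {𝒴 : Type v} [Fintype 𝒳] [Fintype 𝒴] (W : 𝒳 → PMF 𝒴) (R : ℝ) :
    Prop :=
  0 ≤ R ∧ ∃ ε : ℕ → ℝ, Tendsto ε atTop (𝓝 0) ∧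
    ∀ n : ℕ, ∃ P : OTProtocol.{u, v, w} 𝒳 𝒴 n ⌊n * R⌋₊, P.IsSecure W (ε n)

/-- The string oblivious transfer capacity, in bits per channel use: the supremum of the achievable
rates, taken in the extended reals. -/
noncomputable def otCapacity {𝒳 : Type u} {𝒴 : Type v} [Fintype 𝒳] [Fintype 𝒴] (W : 𝒳 → PMF 𝒴) :
    EReal :=
  sSup ((fun R : ℝ => (R : EReal)) '' {R | OTAchievable.{u, v, w} W R})

/-! Let U be Alice's view, V Bob's view, and Q an auxiliary variable with Q - U - V. The quantity
T(Q) = I(U;Q|V) + I(U;V|Q), averaged over the transcript so far, is a potential that grows slowly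
but has to be large at the end.

Slow growth. Initially the views are independent and a constant Q gives T = 0. For a fixed kernel
from U to Q, a public message of either user does not increase the average of T
(`sum_tension_left_step`, `sum_tension_right_step`). At a channel use with input X and output Y,
extend Q to (Q, R) with R drawn from X; then T grows by at most I(X;R|Y) + I(X;Y|R)
(`tension_channel_step`). Choosing for R a minimiser at the current input law bounds the growth by
the single-letter maximum B, so n uses give T ≤ nB.

Large at the end. With U = (S₀, S₁, Xⁿ) and V = (K, Yⁿ), every Q satisfies T ≥ H(S_K̄|V) - 2
H(S_K|V) + H(S_K|K,Q) - H(S_K̄|K,Q) (`transferBound_le_tension`). The first term is nearly m by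
privacy for Alice, and the second is small by Fano's inequality. The last difference is small
because privacy for Bob makes K almost independent of U, hence of (U, Q), so that flipping K
exchanges the two strings at little cost. Hence m - o(n) ≤ nB (`OTProtocol.IsSecure.length_le`), and
division by n gives the bound on the rate.

Since the number of messages is unbounded, averages are sums over a countable tree of transcripts.
Entropies are therefore those of unnormalised weights (`massEntropy`): they are homogeneous of
degree one and superadditive, and conditioning on a message means splitting a weight. Each node of
the tree is a product event in the two private randomnesses, so its weight factors. The growth bound
is an induction on the depth, `tsum_terminalBound_le_of_length_le`.

No support lemma is needed for Q: any kernel serves in the converse. The bound on the number of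
values gives compactness, and with it the attained minima and maximum. -/

/-! ### Entropy of unnormalised weights -/

/-- The entropy, in nats, of the normalised weight `v`, times the total mass of `v`. -/
noncomputable def massEntropy {β : Type*} [Fintype β] (v : β → ℝ) : ℝ :=
  ∑ b, Real.negMulLog (v b) - Real.negMulLog (∑ b, v b)

section MassEntropy

variable {ι β γ : Type*} [Fintype β] [Fintype γ]

theorem massEntropy_smul (c : ℝ) (v : β → ℝ) :
    massEntropy (fun b => c * v b) = c * massEntropy v := by
  simp only [massEntropy, Real.negMulLog_mul, Finset.sum_add_distrib, ← Finset.mul_sum,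
    ← Finset.sum_mul]
  ring

theorem massEntropy_mul_right (v : β → ℝ) (c : ℝ) :
    massEntropy (fun b => v b * c) = massEntropy v * c := by
  simp only [mul_comm _ c, massEntropy_smul]

theorem massEntropy_zero : massEntropy (fun _ : β => (0 : ℝ)) = 0 := by
  simp [massEntropy]

theorem massEntropy_eq_sum (v : β → ℝ) :
    massEntropy v = ∑ b, v b * (Real.log (∑ b, v b) - Real.log (v b)) := by
  simp only [massEntropy, Real.negMulLog, mul_sub, Finset.sum_sub_distrib, ← Finset.sum_mul,
    neg_mul, Finset.sum_neg_distrib]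
  ring

theorem massEntropy_nonneg {v : β → ℝ} (hv : ∀ b, 0 ≤ v b) : 0 ≤ massEntropy v := by
  rw [massEntropy_eq_sum]
  refine Finset.sum_nonneg fun b _ => ?_
  rcases (hv b).eq_or_lt with h | h
  · simp [← h]
  · refine mul_nonneg h.le (sub_nonneg.2 (Real.log_le_log h ?_))
    exact Finset.single_le_sum (fun b _ => hv b) (Finset.mem_univ b)

/-- The two-term log-sum inequality. Each term uses `log t ≤ t - 1` at `t = s (x + x') / (x (s +
s'))`, and the two resulting right-hand sides cancel. The bound `x ≤ s` keeps `s` positive where `x`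
is. -/
theorem mul_log_sub_log_add_le {x s x' s' : ℝ} (hx : 0 ≤ x) (hs : x ≤ s) (hx' : 0 ≤ x')
    (hs' : x' ≤ s') :
    x * (Real.log s - Real.log x) + x' * (Real.log s' - Real.log x') ≤
      (x + x') * (Real.log (s + s') - Real.log (x + x')) := by
  have key : ∀ {x s x' s' : ℝ}, 0 ≤ x → x ≤ s → 0 ≤ x' → x' ≤ s' →
      x * (Real.log s - Real.log x) - x * (Real.log (s + s') - Real.log (x + x')) ≤
        s * (x + x') / (s + s') - x := by
    intro x s x' s' hx hs hx' hs'
    rcases hx.eq_or_lt with h | h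
    · subst h
      have : 0 ≤ s * (0 + x') / (s + s') := by
        apply div_nonneg <;> nlinarith
      simpa using this
    · have hs0 : 0 < s := h.trans_le hs
      have h1 : 0 < x + x' := by linarith
      have h2 : 0 < s + s' := by linarith
      have h3 := Real.log_le_sub_one_of_pos (x := s * (x + x') / (x * (s + s'))) (by positivity)
      rw [Real.log_div (by positivity) (by positivity), Real.log_mul hs0.ne' h1.ne',
        Real.log_mul h.ne' h2.ne'] at h3
      have h4 := mul_le_mul_of_nonneg_left h3 h.le
      have h5 : x * (s * (x + x') / (x * (s + s')) - 1) = s * (x + x') / (s + s') - x := by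
        field_simp
      rw [h5] at h4
      linarith
  have h1 := key hx hs hx' hs'
  have h2 := key hx' hs' hx hs
  rw [add_comm s' s, add_comm x' x] at h2
  have h3 : s * (x + x') / (s + s') + s' * (x + x') / (s + s') = x + x' := by
    rcases (show 0 ≤ s + s' by linarith).eq_or_lt with h | h
    · have : x + x' = 0 := by linarith
      simp [this]
    · field_simp
  linarith

/-- Conditioning lowers entropy: the left side is the entropy given the label of the summand. Entry
by entry this is the log-sum inequality. -/
theorem massEntropy_add_le {v v' : β → ℝ} (hv : ∀ b, 0 ≤ v b) (hv' : ∀ b, 0 ≤ v' b) :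
    massEntropy v + massEntropy v' ≤ massEntropy (fun b => v b + v' b) := by
  simp only [massEntropy_eq_sum, ← Finset.sum_add_distrib]
  refine Finset.sum_le_sum fun b _ => ?_
  rw [Finset.sum_add_distrib]
  exact mul_log_sub_log_add_le (hv b) (Finset.single_le_sum (fun b _ => hv b) (Finset.mem_univ b))
    (hv' b) (Finset.single_le_sum (fun b _ => hv' b) (Finset.mem_univ b))

theorem sum_massEntropy_le (s : Finset ι) {v : ι → β → ℝ} (hv : ∀ i b, 0 ≤ v i b) :
    ∑ i ∈ s, massEntropy (v i) ≤ massEntropy (fun b => ∑ i ∈ s, v i b) := by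
  classical
  induction s using Finset.induction_on with
  | empty => simp [massEntropy_zero]
  | insert i s hi ih =>
    simp only [Finset.sum_insert hi]
    have := massEntropy_add_le (hv i) (fun b => Finset.sum_nonneg fun j (_ : j ∈ s) => hv j b)
    linarith

/-- Comparison with the uniform weight through `log t ≤ t - 1`; the correction terms `s / |β| - v b`
sum to zero. -/
theorem massEntropy_le_log_card {v : β → ℝ} (hv : ∀ b, 0 ≤ v b) :
    massEntropy v ≤ (∑ b, v b) * Real.log (Fintype.card β) := by
  rw [massEntropy_eq_sum]
  set s := ∑ b, v b with hs
  have hs0 : 0 ≤ s := Finset.sum_nonneg fun b _ => hv b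
  have key : ∀ b, v b * (Real.log s - Real.log (v b)) ≤
      v b * Real.log (Fintype.card β) + (s / Fintype.card β - v b) := by
    intro b
    have hN : 0 < (Fintype.card β : ℝ) := by
      exact_mod_cast Fintype.card_pos_iff.2 ⟨b⟩
    rcases (hv b).eq_or_lt with h | h
    · rw [← h]; simp; positivity
    · have hs1 : 0 < s := h.trans_le (Finset.single_le_sum (fun b _ => hv b) (Finset.mem_univ b))
      have h3 := Real.log_le_sub_one_of_pos (x := s / (v b * Fintype.card β)) (by positivity)
      rw [Real.log_div (by positivity) (by positivity), Real.log_mul h.ne' hN.ne'] at h3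
      have h4 := mul_le_mul_of_nonneg_left h3 h.le
      have h5 : v b * (s / (v b * Fintype.card β) - 1) = s / Fintype.card β - v b := by
        field_simp
      rw [h5] at h4
      linarith
  refine (Finset.sum_le_sum fun b _ => key b).trans ?_
  rw [Finset.sum_add_distrib, Finset.sum_sub_distrib, ← Finset.sum_mul, ← hs]
  simp only [Finset.sum_const, Finset.card_univ, nsmul_eq_mul]
  rcases isEmpty_or_nonempty β with h | h
  · simp [hs]
  · have hN : (Fintype.card β : ℝ) ≠ 0 := by exact_mod_cast Fintype.card_ne_zero
    rw [mul_div_cancel₀ _ hN]; simp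

theorem negMulLog_add_le {x y : ℝ} (hx : 0 ≤ x) (hy : 0 ≤ y) :
    Real.negMulLog (x + y) ≤ Real.negMulLog x + Real.negMulLog y := by
  have := massEntropy_nonneg (v := fun b : Bool => if b then x else y) (by intro b; cases b <;> simpa)
  simp [massEntropy] at this
  linarith

theorem negMulLog_add_negMulLog_le {x y : ℝ} (hx : 0 ≤ x) (hy : 0 ≤ y) :
    Real.negMulLog x + Real.negMulLog y ≤ Real.negMulLog (x + y) + (x + y) * Real.log 2 := by
  have := massEntropy_le_log_card (v := fun b : Bool => if b then x else y)
    (by intro b; cases b <;> simpa)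
  simp [massEntropy] at this
  linarith

/-- The converse of `massEntropy_add_le` up to one bit per unit of mass, the entropy of the label of
the summand. In the end this slack costs a constant, negligible against `n`. -/
theorem massEntropy_add_le_add {v v' : β → ℝ} (hv : ∀ b, 0 ≤ v b) (hv' : ∀ b, 0 ≤ v' b) :
    massEntropy (fun b => v b + v' b) ≤
      massEntropy v + massEntropy v' + (∑ b, v b + ∑ b, v' b) * Real.log 2 := by
  have h1 : ∑ b, Real.negMulLog (v b + v' b) ≤
      ∑ b, Real.negMulLog (v b) + ∑ b, Real.negMulLog (v' b) := by
    rw [← Finset.sum_add_distrib]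
    exact Finset.sum_le_sum fun b _ => negMulLog_add_le (hv b) (hv' b)
  have h2 := negMulLog_add_negMulLog_le (Finset.sum_nonneg fun b (_ : b ∈ Finset.univ) => hv b)
    (Finset.sum_nonneg fun b (_ : b ∈ Finset.univ) => hv' b)
  simp only [massEntropy, Finset.sum_add_distrib]
  linarith

theorem massEntropy_of_unique [Unique γ] (v : γ → ℝ) : massEntropy v = 0 := by
  simp [massEntropy]

theorem massEntropy_prod (G : β × γ → ℝ) :
    massEntropy G = massEntropy (fun b => ∑ c, G (b, c)) +
      ∑ b, massEntropy (fun c => G (b, c)) := by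
  simp only [massEntropy, Fintype.sum_prod_type, Finset.sum_sub_distrib]
  ring

theorem massEntropy_prod_le {G : β × γ → ℝ} (hG : ∀ z, 0 ≤ G z) :
    massEntropy G ≤ massEntropy (fun b => ∑ c, G (b, c)) +
      massEntropy (fun c => ∑ b, G (b, c)) := by
  rw [massEntropy_prod]
  gcongr
  exact sum_massEntropy_le _ fun _ _ => hG _

theorem massEntropy_mul (a : β → ℝ) (b : γ → ℝ) :
    massEntropy (fun z : β × γ => a z.1 * b z.2) =
      (∑ c, b c) * massEntropy a + (∑ c, a c) * massEntropy b := by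
  rw [massEntropy_prod]
  simp only [massEntropy_smul, ← Finset.mul_sum, ← Finset.sum_mul, massEntropy_mul_right]
  ring

/-- The chain rule for both orders of two variables. -/
theorem sum_massEntropy_add_massEntropy (g : β → γ → ℝ) :
    ∑ b, massEntropy (g b) + massEntropy (fun b => ∑ c, g b c) =
      ∑ c, massEntropy (fun b => g b c) + massEntropy (fun c => ∑ b, g b c) := by
  simp only [massEntropy, Finset.sum_sub_distrib]
  rw [Finset.sum_comm (f := fun c b => Real.negMulLog (g b c)),
    Finset.sum_comm (f := fun c b => g b c)]
  ring

theorem massEntropy_comp_equiv (e : β ≃ γ) (v : γ → ℝ) :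
    massEntropy (fun b => v (e b)) = massEntropy v := by
  unfold massEntropy
  rw [e.sum_comp v, e.sum_comp fun c => Real.negMulLog (v c)]

theorem continuous_massEntropy : Continuous (massEntropy : (β → ℝ) → ℝ) := by
  unfold massEntropy; fun_prop

end MassEntropy

/-! ### The tension functional -/

/-- `I(U;Q|V) + I(U;V|Q)` in nats for the unnormalised weight `w` of `(U, V)`, where `Q - U - V` is
a Markov chain and `Q` arises from `U` by the stochastic kernel `q`. -/
noncomputable def tension {U V Q : Type*} [Fintype U] [Fintype V] [Fintype Q]
    (w : U → V → ℝ) (q : U → Q → ℝ) : ℝ :=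
  -- This is `H(Q|V) - H(Q|U) + H(V|Q) - H(V|U)`: the Markov property has replaced `H(Q|U,V)` by
  -- `H(Q|U)` and `H(V|U,Q)` by `H(V|U)`.
  ∑ v, massEntropy (fun r => ∑ u, w u v * q u r) - ∑ u, (∑ v, w u v) * massEntropy (q u) +
    (∑ r, massEntropy (fun v => ∑ u, w u v * q u r) - ∑ u, massEntropy (w u))

section Tension

variable {ι U V Q X Y R : Type*} [Fintype U] [Fintype V] [Fintype Q] [Fintype X] [Fintype Y]
  [Fintype R]

theorem sum_kernel_mul {q : U → Q → ℝ} (hq1 : ∀ u, ∑ r, q u r = 1) (f : U → ℝ) :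
    ∑ r, ∑ u, f u * q u r = ∑ u, f u := by
  rw [Finset.sum_comm]; simp [← Finset.mul_sum, hq1]

theorem tension_nonneg {w : U → V → ℝ} {q : U → Q → ℝ} (hw : ∀ u v, 0 ≤ w u v)
    (hq : ∀ u r, 0 ≤ q u r) (hq1 : ∀ u, ∑ r, q u r = 1) : 0 ≤ tension w q := by
  have h1 : ∑ u, (∑ v, w u v) * massEntropy (q u) ≤
      ∑ v, massEntropy (fun r => ∑ u, w u v * q u r) := by
    simp only [Finset.sum_mul]
    rw [Finset.sum_comm]
    refine Finset.sum_le_sum fun v _ => ?_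
    simp only [← massEntropy_smul]
    exact sum_massEntropy_le _ fun u r => mul_nonneg (hw _ _) (hq _ _)
  have h2 : ∑ u, massEntropy (w u) ≤ ∑ r, massEntropy (fun v => ∑ u, w u v * q u r) := by
    rw [← sum_kernel_mul hq1 fun u => massEntropy (w u)]
    refine Finset.sum_le_sum fun r _ => ?_
    simp only [← massEntropy_mul_right]
    exact sum_massEntropy_le _ fun u v => mul_nonneg (hw _ _) (hq _ _)
  unfold tension
  linarith

theorem tension_smul (c : ℝ) (w : U → V → ℝ) (q : U → Q → ℝ) :
    tension (fun u v => c * w u v) q = c * tension w q := by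
  simp only [tension, mul_assoc, ← Finset.mul_sum, massEntropy_smul]
  ring

theorem tension_zero (q : U → Q → ℝ) : tension (fun (_ : U) (_ : V) => (0 : ℝ)) q = 0 := by
  simp [tension, massEntropy_zero]

/-- The last bracket of `tension` with the roles of `U` and `V` exchanged. -/
theorem tension_eq {q : U → Q → ℝ} (hq1 : ∀ u, ∑ r, q u r = 1) (w : U → V → ℝ) :
    tension w q =
      ∑ v, massEntropy (fun r => ∑ u, w u v * q u r) - ∑ u, (∑ v, w u v) * massEntropy (q u) +
      (∑ r, massEntropy (fun u => (∑ v, w u v) * q u r) -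
        ∑ r, ∑ v, massEntropy (fun u => w u v * q u r)) := by
  -- At each value of `Q`: `H(V|Q) + H(U|V,Q) = H(U|Q) + H(V|U,Q)`.
  have h : ∀ r, massEntropy (fun v => ∑ u, w u v * q u r) +
      ∑ v, massEntropy (fun u => w u v * q u r) =
      massEntropy (fun u => (∑ v, w u v) * q u r) + ∑ u, massEntropy (w u) * q u r := by
    intro r
    have := sum_massEntropy_add_massEntropy fun u v => w u v * q u r
    simp only [massEntropy_mul_right, ← Finset.sum_mul] at this
    linarith
  have h' := Finset.sum_congr rfl fun r (_ : r ∈ Finset.univ) => h r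
  simp only [Finset.sum_add_distrib] at h'
  rw [sum_kernel_mul hq1] at h'
  unfold tension
  linarith

/-- Splitting by a function of `u` rescales whole rows `w u`. The two subtracted terms are
homogeneous in the rows and so add up exactly, while the two positive terms are superadditive. -/
theorem sum_tension_le_of_left (T : Finset ι) {w : U → V → ℝ} {q : U → Q → ℝ} {c : ι → U → ℝ}
    (hw : ∀ u v, 0 ≤ w u v) (hq : ∀ u r, 0 ≤ q u r) (hc : ∀ i u, 0 ≤ c i u) :
    ∑ i ∈ T, tension (fun u v => c i u * w u v) q ≤
      tension (fun u v => (∑ i ∈ T, c i u) * w u v) q := by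
  simp only [tension, Finset.sum_add_distrib, Finset.sum_sub_distrib]
  refine add_le_add (sub_le_sub ?_ (le_of_eq ?_)) (sub_le_sub ?_ (le_of_eq ?_))
  · rw [Finset.sum_comm]
    refine Finset.sum_le_sum fun v _ => ?_
    refine (sum_massEntropy_le T fun i r => Finset.sum_nonneg fun u _ =>
      mul_nonneg (mul_nonneg (hc _ _) (hw _ _)) (hq _ _)).trans (le_of_eq ?_)
    congr 1; ext r; rw [Finset.sum_comm]; simp only [Finset.sum_mul]
  · rw [Finset.sum_comm]
    refine Finset.sum_congr rfl fun u _ => ?_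
    simp only [Finset.sum_mul]
    rw [Finset.sum_comm]
  · rw [Finset.sum_comm]
    refine Finset.sum_le_sum fun v _ => ?_
    refine (sum_massEntropy_le T fun i r => Finset.sum_nonneg fun u _ =>
      mul_nonneg (mul_nonneg (hc _ _) (hw _ _)) (hq _ _)).trans (le_of_eq ?_)
    congr 1; ext r; rw [Finset.sum_comm]; simp only [Finset.sum_mul]
  · rw [Finset.sum_comm]
    refine Finset.sum_congr rfl fun u _ => ?_
    simp only [massEntropy_smul]
    rw [Finset.sum_mul]

/-- In the form `tension_eq`, splitting by a function of `v` leaves every term additive except the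
sum of the `H(U|Q)` parts, which is superadditive and has a positive sign. -/
theorem sum_tension_le_of_right (T : Finset ι) {w : U → V → ℝ} {q : U → Q → ℝ} {c : ι → V → ℝ}
    (hw : ∀ u v, 0 ≤ w u v) (hq : ∀ u r, 0 ≤ q u r) (hq1 : ∀ u, ∑ r, q u r = 1)
    (hc : ∀ i v, 0 ≤ c i v) :
    ∑ i ∈ T, tension (fun u v => c i v * w u v) q ≤
      tension (fun u v => (∑ i ∈ T, c i v) * w u v) q := by
  simp only [tension_eq hq1, Finset.sum_add_distrib, Finset.sum_sub_distrib]
  refine add_le_add (sub_le_sub (le_of_eq ?_) (le_of_eq ?_)) (sub_le_sub ?_ (le_of_eq ?_))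
  · rw [Finset.sum_comm]
    refine Finset.sum_congr rfl fun v _ => ?_
    simp only [mul_assoc, ← Finset.mul_sum, massEntropy_smul]
    rw [Finset.sum_mul]
  · rw [Finset.sum_comm]
    refine Finset.sum_congr rfl fun u _ => ?_
    simp only [Finset.sum_mul]
    rw [Finset.sum_comm]
  · rw [Finset.sum_comm]
    refine Finset.sum_le_sum fun r _ => ?_
    refine (sum_massEntropy_le T fun i u => mul_nonneg (Finset.sum_nonneg fun v _ =>
      mul_nonneg (hc _ _) (hw _ _)) (hq _ _)).trans (le_of_eq ?_)
    congr 1; ext u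
    simp only [Finset.sum_mul]
    rw [Finset.sum_comm]
  · rw [Finset.sum_comm (s := T)]
    refine Finset.sum_congr rfl fun r _ => ?_
    rw [Finset.sum_comm (s := T)]
    refine Finset.sum_congr rfl fun v _ => ?_
    simp only [mul_assoc, massEntropy_smul]
    rw [Finset.sum_mul]

/-- A finite set `T` of messages need not exhaust the probability. The missing mass becomes one
further summand, which is harmless because its tension is nonnegative. -/
theorem sum_tension_left_step (T : Finset ι) {w : U → V → ℝ} {q : U → Q → ℝ} {c : ι → U → ℝ}
    (hw : ∀ u v, 0 ≤ w u v) (hq : ∀ u r, 0 ≤ q u r) (hq1 : ∀ u, ∑ r, q u r = 1)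
    (hc : ∀ i u, 0 ≤ c i u) (hc1 : ∀ u, ∑ i ∈ T, c i u ≤ 1) :
    ∑ i ∈ T, tension (fun u v => c i u * w u v) q ≤ tension w q := by
  refine (sum_tension_le_of_left T hw hq hc).trans ?_
  have h := sum_tension_le_of_left (Finset.univ : Finset Bool) (w := w) (q := q)
    (c := fun b u => if b then ∑ i ∈ T, c i u else 1 - ∑ i ∈ T, c i u) hw hq (by
      intro b u; cases b
      · simpa using hc1 u
      · simpa using Finset.sum_nonneg fun i _ => hc i u)
  simp only [Fintype.sum_bool, if_true, Bool.false_eq_true, if_false, add_sub_cancel, one_mul] at h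
  have h0 := tension_nonneg (w := fun u v => (1 - ∑ i ∈ T, c i u) * w u v) (q := q)
    (fun u v => mul_nonneg (sub_nonneg.2 (hc1 u)) (hw u v)) hq hq1
  linarith

theorem sum_tension_right_step (T : Finset ι) {w : U → V → ℝ} {q : U → Q → ℝ} {c : ι → V → ℝ}
    (hw : ∀ u v, 0 ≤ w u v) (hq : ∀ u r, 0 ≤ q u r) (hq1 : ∀ u, ∑ r, q u r = 1)
    (hc : ∀ i v, 0 ≤ c i v) (hc1 : ∀ v, ∑ i ∈ T, c i v ≤ 1) :
    ∑ i ∈ T, tension (fun u v => c i v * w u v) q ≤ tension w q := by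
  refine (sum_tension_le_of_right T hw hq hq1 hc).trans ?_
  have h := sum_tension_le_of_right (Finset.univ : Finset Bool) (w := w) (q := q)
    (c := fun b v => if b then ∑ i ∈ T, c i v else 1 - ∑ i ∈ T, c i v) hw hq hq1 (by
      intro b v; cases b
      · simpa using hc1 v
      · simpa using Finset.sum_nonneg fun i _ => hc i v)
  simp only [Fintype.sum_bool, if_true, Bool.false_eq_true, if_false, add_sub_cancel, one_mul] at h
  have h0 := tension_nonneg (w := fun u v => (1 - ∑ i ∈ T, c i v) * w u v) (q := q)
    (fun u v => mul_nonneg (sub_nonneg.2 (hc1 v)) (hw u v)) hq hq1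
  linarith

/-- The potential at the root, where the views are independent. -/
theorem tension_const_of_product (a : U → ℝ) (b : V → ℝ) :
    tension (fun u v => a u * b v) (fun _ (_ : Unit) => 1) = 0 := by
  simp only [tension, massEntropy_of_unique, mul_one, ← Finset.sum_mul, massEntropy_smul]
  simp

/-- `H(Q,R|V,Y) ≤ H(Q|V) + H(R|Y)`: subadditivity, after which one condition is dropped from each
term. -/
theorem sum_massEntropy_prod_le {G : V → Y → Q → R → ℝ} (hG : ∀ v y r s, 0 ≤ G v y r s) :
    ∑ z : V × Y, massEntropy (fun t : Q × R => G z.1 z.2 t.1 t.2) ≤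
      ∑ v, massEntropy (fun r => ∑ y, ∑ s, G v y r s) +
        ∑ y, massEntropy (fun s => ∑ v, ∑ r, G v y r s) := by
  have h1 : ∑ z : V × Y, massEntropy (fun t : Q × R => G z.1 z.2 t.1 t.2) ≤
      ∑ z : V × Y, (massEntropy (fun r => ∑ s, G z.1 z.2 r s) +
        massEntropy (fun s => ∑ r, G z.1 z.2 r s)) :=
    Finset.sum_le_sum fun z _ => massEntropy_prod_le (G := fun t : Q × R => G z.1 z.2 t.1 t.2)
      fun t => hG _ _ _ _
  refine h1.trans ?_
  rw [Finset.sum_add_distrib, Fintype.sum_prod_type, Fintype.sum_prod_type_right]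
  refine add_le_add (Finset.sum_le_sum fun v _ => ?_) (Finset.sum_le_sum fun y _ => ?_)
  · exact sum_massEntropy_le _ fun y r => Finset.sum_nonneg fun s _ => hG _ _ _ _
  · exact sum_massEntropy_le _ fun v s => Finset.sum_nonneg fun r _ => hG _ _ _ _

/-- One use of the channel `W` with an input that depends on `U` only. -/
theorem tension_channel_step {w : U → V → ℝ} {q : U → Q → ℝ} {c : U → X → ℝ} {W : X → Y → ℝ}
    {q' : X → R → ℝ} (hw : ∀ u v, 0 ≤ w u v) (hq : ∀ u r, 0 ≤ q u r) (hq1 : ∀ u, ∑ r, q u r = 1)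
    (hc : ∀ u x, 0 ≤ c u x) (hc1 : ∀ u, ∑ x, c u x = 1)
    (hW : ∀ x y, 0 ≤ W x y) (hW1 : ∀ x, ∑ y, W x y = 1)
    (hq' : ∀ x r, 0 ≤ q' x r) (hq'1 : ∀ x, ∑ r, q' x r = 1) :
    tension (fun (a : U × X) (b : V × Y) => w a.1 b.1 * c a.1 a.2 * W a.2 b.2)
        (fun a (t : Q × R) => q a.1 t.1 * q' a.2 t.2) ≤
      tension w q + tension (fun x y => (∑ u, ∑ v, w u v * c u x) * W x y) q' := by
  -- `G` is the joint weight of `(V, Y, Q, R)` after the use; its two relevant marginals are those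
  -- of `(V, Q)` before the use and of `(Y, R)` for the single use.
  set G : V → Y → Q → R → ℝ := fun v y r s =>
    ∑ u, ∑ x, w u v * c u x * W x y * (q u r * q' x s) with hG
  have hG0 : ∀ v y r s, 0 ≤ G v y r s := fun v y r s =>
    Finset.sum_nonneg fun u _ => Finset.sum_nonneg fun x _ => mul_nonneg
      (mul_nonneg (mul_nonneg (hw _ _) (hc _ _)) (hW _ _)) (mul_nonneg (hq _ _) (hq' _ _))
  have hm1 : ∀ v r, ∑ y, ∑ s, G v y r s = ∑ u, w u v * q u r := by
    intro v r
    calc ∑ y, ∑ s, G v y r s = ∑ y, ∑ u, ∑ x, ∑ s, w u v * c u x * W x y * (q u r * q' x s) := by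
          refine Finset.sum_congr rfl fun y _ => ?_
          rw [Finset.sum_comm]; refine Finset.sum_congr rfl fun u _ => ?_
          rw [Finset.sum_comm]
      _ = ∑ u, ∑ x, ∑ y, w u v * c u x * W x y * q u r := by
          rw [Finset.sum_comm]; refine Finset.sum_congr rfl fun u _ => ?_
          rw [Finset.sum_comm]
          simp only [← Finset.mul_sum, hq'1, mul_one]
      _ = ∑ u, w u v * q u r := by
          simp only [← Finset.mul_sum, ← Finset.sum_mul, hW1, hc1, mul_one]
  have hm2 : ∀ y s, ∑ v, ∑ r, G v y r s = ∑ x, (∑ u, ∑ v, w u v * c u x) * W x y * q' x s := by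
    intro y s
    calc ∑ v, ∑ r, G v y r s = ∑ v, ∑ u, ∑ x, ∑ r, w u v * c u x * W x y * (q' x s * q u r) := by
          refine Finset.sum_congr rfl fun v _ => ?_
          rw [Finset.sum_comm]; refine Finset.sum_congr rfl fun u _ => ?_
          rw [Finset.sum_comm]
          simp only [mul_comm (q' _ _)]
      _ = ∑ v, ∑ u, ∑ x, w u v * c u x * W x y * q' x s := by
          simp only [← Finset.mul_sum, hq1, mul_one]
      _ = ∑ x, ∑ u, ∑ v, w u v * c u x * W x y * q' x s := by
          rw [Finset.sum_comm, Finset.sum_comm (s := Finset.univ (α := X))]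
          refine Finset.sum_congr rfl fun u _ => ?_
          rw [Finset.sum_comm]
      _ = _ := by simp only [Finset.sum_mul]
  have t1 := sum_massEntropy_prod_le hG0
  -- The same inequality with the pairs exchanged: `H(V,Y|Q,R) ≤ H(V|Q) + H(Y|R)`.
  have t3 := sum_massEntropy_prod_le (G := fun r s v y => G v y r s) fun r s v y => hG0 v y r s
  have hm1' : ∀ v r, ∑ s, ∑ y, G v y r s = ∑ u, w u v * q u r := fun v r => by
    rw [Finset.sum_comm, hm1]
  have hm2' : ∀ y s, ∑ r, ∑ v, G v y r s = ∑ x, (∑ u, ∑ v, w u v * c u x) * W x y * q' x s :=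
    fun y s => by rw [Finset.sum_comm, hm2]
  simp only [hm1, hm2] at t1
  simp only [hm1', hm2'] at t3
  have hmass : ∀ a : U × X, ∑ b : V × Y, w a.1 b.1 * c a.1 a.2 * W a.2 b.2 =
      (∑ v, w a.1 v) * c a.1 a.2 := by
    intro a
    simp only [Fintype.sum_prod_type, ← Finset.mul_sum, hW1, mul_one, ← Finset.sum_mul]
  -- The subtracted terms split exactly: given `(U, X)`, the variables `Q` and `R` are independent,
  -- and so are `V` and `Y`.
  have t2 : ∑ a : U × X, (∑ b : V × Y, w a.1 b.1 * c a.1 a.2 * W a.2 b.2) *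
        massEntropy (fun t : Q × R => q a.1 t.1 * q' a.2 t.2) =
      ∑ u, (∑ v, w u v) * massEntropy (q u) +
        ∑ x, (∑ y, (∑ u, ∑ v, w u v * c u x) * W x y) * massEntropy (q' x) := by
    simp only [hmass, massEntropy_mul, hq1, hq'1, one_mul, mul_add, Finset.sum_add_distrib,
      ← Finset.mul_sum, hW1, mul_one]
    congr 1
    · simp only [Fintype.sum_prod_type, ← Finset.sum_mul, ← Finset.mul_sum, hc1, mul_one]
    · simp only [Fintype.sum_prod_type_right, ← Finset.sum_mul]
  have t4 : ∑ a : U × X, massEntropy (fun b : V × Y => w a.1 b.1 * c a.1 a.2 * W a.2 b.2) =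
      ∑ u, massEntropy (w u) +
        ∑ x, massEntropy (fun y => (∑ u, ∑ v, w u v * c u x) * W x y) := by
    have : ∀ a : U × X, massEntropy (fun b : V × Y => w a.1 b.1 * c a.1 a.2 * W a.2 b.2) =
        massEntropy (w a.1) * c a.1 a.2 +
          (∑ v, w a.1 v) * c a.1 a.2 * massEntropy (W a.2) := by
      intro a
      rw [massEntropy_mul (fun v => w a.1 v * c a.1 a.2) (W a.2), hW1, one_mul,
        massEntropy_mul_right, ← Finset.sum_mul]
    simp only [this, Finset.sum_add_distrib, massEntropy_smul]
    congr 1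
    · simp only [Fintype.sum_prod_type, ← Finset.mul_sum, hc1, mul_one]
    · simp only [Fintype.sum_prod_type_right, ← Finset.sum_mul]
  unfold tension
  simp only [Fintype.sum_prod_type (f := fun a : U × X => _ * (q a.1 _ * q' a.2 _))]
  rw [t2, t4]
  change ∑ z : V × Y, massEntropy (fun t : Q × R => G z.1 z.2 t.1 t.2) - _ +
    (∑ t : Q × R, massEntropy (fun z : V × Y => G z.1 z.2 t.1 t.2) - _) ≤ _
  linarith

theorem tension_comp_equiv {U' V' : Type*} [Fintype U'] [Fintype V'] (e : U' ≃ U) (e' : V' ≃ V)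
    (w : U → V → ℝ) (q : U → Q → ℝ) :
    tension (fun u v => w (e u) (e' v)) (fun u => q (e u)) = tension w q := by
  unfold tension
  congr 2
  · rw [← e'.sum_comp]
    refine Finset.sum_congr rfl fun v _ => ?_
    congr 1; ext r; exact e.sum_comp fun u => w u (e' v) * q u r
  · rw [← e.sum_comp]
    refine Finset.sum_congr rfl fun u _ => ?_
    rw [e'.sum_comp]
  · refine Finset.sum_congr rfl fun r _ => ?_
    rw [← massEntropy_comp_equiv e']
    congr 1; ext v; exact e.sum_comp fun u => w u (e' v) * q u r
  · rw [← e.sum_comp]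
    refine Finset.sum_congr rfl fun u _ => ?_
    rw [massEntropy_comp_equiv e']

end Tension

/-! ### Joint entropies of functions on a finite weighted set -/

open Classical in
/-- The unnormalised entropy, in nats, of the function `A` under the weight `ρ`. -/
noncomputable def ent {Z α : Type*} [Fintype Z] (ρ : Z → ℝ) (A : Z → α) : ℝ :=
  ∑ z, ρ z * -Real.log (∑ z', if A z' = A z then ρ z' else 0)

open Classical in
/-- The image of the weight `ρ` under `A`. -/
noncomputable def marg {Z α : Type*} [Fintype Z] (ρ : Z → ℝ) (A : Z → α) (a : α) : ℝ :=
  ∑ z, if A z = a then ρ z else 0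

section Ent

variable {Z α β γ : Type*} [Fintype Z] [Fintype α] [Fintype β] [Fintype γ]

/-- Entropy depends only on the partition into fibres, so tuples that determine each other can be
interchanged. -/
theorem ent_congr {α β : Type*} (ρ : Z → ℝ) {A : Z → α} {B : Z → β}
    (h : ∀ z z', A z = A z' ↔ B z = B z') : ent ρ A = ent ρ B := by
  classical
  unfold ent
  refine Finset.sum_congr rfl fun z _ => ?_
  congr 3
  exact Finset.sum_congr rfl fun z' _ => by simp only [h]

theorem marg_nonneg {α : Type*} {ρ : Z → ℝ} (hρ : ∀ z, 0 ≤ ρ z) (A : Z → α) (a : α) :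
    0 ≤ marg ρ A a :=
  Finset.sum_nonneg fun z _ => by split_ifs <;> simp [hρ]

theorem sum_marg_mul (ρ : Z → ℝ) (A : Z → α) (f : α → ℝ) :
    ∑ a, marg ρ A a * f a = ∑ z, ρ z * f (A z) := by
  classical
  unfold marg
  simp only [Finset.sum_mul]
  rw [Finset.sum_comm]
  refine Finset.sum_congr rfl fun z _ => ?_
  simp

theorem ent_eq_sum (ρ : Z → ℝ) (A : Z → α) : ent ρ A = ∑ a, Real.negMulLog (marg ρ A a) := by
  have := sum_marg_mul ρ A fun a => -Real.log (marg ρ A a)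
  simp only [Real.negMulLog, neg_mul_comm]
  rw [this]
  rfl

theorem sum_marg_pair {α : Type*} (ρ : Z → ℝ) (A : Z → α) (B : Z → β) (a : α) :
    ∑ b, marg ρ (fun z => (A z, B z)) (a, b) = marg ρ A a := by
  classical
  unfold marg
  rw [Finset.sum_comm]
  refine Finset.sum_congr rfl fun z _ => ?_
  simp only [Prod.mk.injEq]
  by_cases h : A z = a <;> simp [h]

/-- Conditional entropy as an average. -/
theorem ent_pair_sub (ρ : Z → ℝ) (A : Z → α) (B : Z → β) :
    ent ρ (fun z => (A z, B z)) - ent ρ A =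
      ∑ a, massEntropy (fun b => marg ρ (fun z => (A z, B z)) (a, b)) := by
  simp only [massEntropy, Finset.sum_sub_distrib, sum_marg_pair, ent_eq_sum, Fintype.sum_prod_type]

/-- Nonnegativity of `I(A;B|C)`: subadditivity in each fibre of `C`. -/
theorem ent_submodular {ρ : Z → ℝ} (hρ : ∀ z, 0 ≤ ρ z) (A : Z → α) (B : Z → β) (C : Z → γ) :
    ent ρ (fun z => (C z, A z, B z)) + ent ρ C ≤
      ent ρ (fun z => (C z, A z)) + ent ρ (fun z => (C z, B z)) := by
  have h1 := ent_pair_sub ρ C A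
  have h2 := ent_pair_sub ρ C B
  have h3 := ent_pair_sub ρ C fun z => (A z, B z)
  have h4 : ∀ c, massEntropy (fun ab => marg ρ (fun z => (C z, (A z, B z))) (c, ab)) ≤
      massEntropy (fun a => marg ρ (fun z => (C z, A z)) (c, a)) +
        massEntropy (fun b => marg ρ (fun z => (C z, B z)) (c, b)) := by
    intro c
    refine (massEntropy_prod_le fun _ => marg_nonneg hρ _ _).trans (le_of_eq ?_)
    congr 2
    · ext a
      rw [← sum_marg_pair ρ (fun z => (C z, A z)) B]
      refine Finset.sum_congr rfl fun b _ => ?_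
      unfold marg
      refine Finset.sum_congr rfl fun z _ => ?_
      congr 1
      simp only [Prod.mk.injEq]
      exact propext (by tauto)
    · ext b
      rw [← sum_marg_pair ρ (fun z => (C z, B z)) A]
      refine Finset.sum_congr rfl fun b _ => ?_
      unfold marg
      refine Finset.sum_congr rfl fun z _ => ?_
      congr 1
      simp only [Prod.mk.injEq]
      exact propext (by tauto)
  have := Finset.sum_le_sum fun c (_ : c ∈ Finset.univ) => h4 c
  rw [Finset.sum_add_distrib] at this
  linarith

theorem ent_mono {ρ : Z → ℝ} (hρ : ∀ z, 0 ≤ ρ z) (A : Z → α) (B : Z → β) :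
    ent ρ A ≤ ent ρ (fun z => (A z, B z)) := by
  have h := ent_pair_sub ρ A B
  have h' := Finset.sum_nonneg fun a (_ : a ∈ Finset.univ) =>
    massEntropy_nonneg fun b => marg_nonneg hρ (fun z => (A z, B z)) (a, b)
  linarith

end Ent

section TensionEnt

variable {U V Q : Type*} [Fintype U] [Fintype V] [Fintype Q]

/-- `I(U;Q|V) + I(U;V|Q)` in terms of joint entropies. -/
theorem tension_eq_ent {w : U → V → ℝ} {q : U → Q → ℝ} (hq1 : ∀ u, ∑ r, q u r = 1) :
    tension w q =
      (ent (fun z : U × V × Q => w z.1 z.2.1 * q z.1 z.2.2) (fun z => (z.1, z.2.1)) +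
        ent (fun z : U × V × Q => w z.1 z.2.1 * q z.1 z.2.2) (fun z => (z.2.1, z.2.2)) -
        ent (fun z : U × V × Q => w z.1 z.2.1 * q z.1 z.2.2) (fun z => z.2.1) -
        ent (fun z : U × V × Q => w z.1 z.2.1 * q z.1 z.2.2) (fun z => z)) +
      (ent (fun z : U × V × Q => w z.1 z.2.1 * q z.1 z.2.2) (fun z => (z.1, z.2.2)) +
        ent (fun z : U × V × Q => w z.1 z.2.1 * q z.1 z.2.2) (fun z => (z.2.1, z.2.2)) -
        ent (fun z : U × V × Q => w z.1 z.2.1 * q z.1 z.2.2) (fun z => z.2.2) -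
        ent (fun z : U × V × Q => w z.1 z.2.1 * q z.1 z.2.2) (fun z => z)) := by
  classical
  have m1 : ∀ v r, marg (fun z : U × V × Q => w z.1 z.2.1 * q z.1 z.2.2)
      (fun z => (z.2.1, z.2.2)) (v, r) = ∑ u, w u v * q u r := by
    intro v r
    unfold marg
    rw [Fintype.sum_prod_type]
    refine Finset.sum_congr rfl fun u _ => ?_
    simp
  have m2 : ∀ u v, marg (fun z : U × V × Q => w z.1 z.2.1 * q z.1 z.2.2)
      (fun z => (z.1, z.2.1)) (u, v) = w u v := by
    intro u v
    unfold marg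
    simp [Fintype.sum_prod_type, ite_and, ← Finset.mul_sum, hq1]
  have m3 : ∀ u r, marg (fun z : U × V × Q => w z.1 z.2.1 * q z.1 z.2.2)
      (fun z => (z.1, z.2.2)) (u, r) = (∑ v, w u v) * q u r := by
    intro u r
    unfold marg
    simp [Fintype.sum_prod_type, ite_and, Finset.sum_mul]
  have m4 : ∀ z, marg (fun z : U × V × Q => w z.1 z.2.1 * q z.1 z.2.2)
      (fun z => z) z = w z.1 z.2.1 * q z.1 z.2.2 := by
    intro z
    unfold marg
    simp
  have m5 : ∀ v, marg (fun z : U × V × Q => w z.1 z.2.1 * q z.1 z.2.2)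
      (fun z => z.2.1) v = ∑ u, w u v := by
    intro v
    unfold marg
    simp [Fintype.sum_prod_type, ← Finset.mul_sum, hq1]
  have m6 : ∀ r, marg (fun z : U × V × Q => w z.1 z.2.1 * q z.1 z.2.2)
      (fun z => z.2.2) r = ∑ u, ∑ v, w u v * q u r := by
    intro v
    unfold marg
    simp [Fintype.sum_prod_type]
  have e2 : ent (fun z : U × V × Q => w z.1 z.2.1 * q z.1 z.2.2) (fun z => (z.2.1, z.2.2)) =
      ∑ v, ∑ r, Real.negMulLog (∑ u, w u v * q u r) := by
    rw [ent_eq_sum, Fintype.sum_prod_type]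
    simp only [m1]
  have e1 : ent (fun z : U × V × Q => w z.1 z.2.1 * q z.1 z.2.2) (fun z => (z.1, z.2.1)) =
      ∑ u, ∑ v, Real.negMulLog (w u v) := by
    rw [ent_eq_sum, Fintype.sum_prod_type]
    simp only [m2]
  have e3 : ent (fun z : U × V × Q => w z.1 z.2.1 * q z.1 z.2.2) (fun z => (z.1, z.2.2)) =
      ∑ u, ∑ r, Real.negMulLog ((∑ v, w u v) * q u r) := by
    rw [ent_eq_sum, Fintype.sum_prod_type]
    simp only [m3]
  have e4 : ent (fun z : U × V × Q => w z.1 z.2.1 * q z.1 z.2.2) (fun z => z) =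
      ∑ u, ∑ v, ∑ r, Real.negMulLog (w u v * q u r) := by
    rw [ent_eq_sum]
    simp only [m4, Fintype.sum_prod_type]
  have e5 : ent (fun z : U × V × Q => w z.1 z.2.1 * q z.1 z.2.2) (fun z => z.2.1) =
      ∑ v, Real.negMulLog (∑ u, w u v) := by
    rw [ent_eq_sum]
    simp only [m5]
  have e6 : ent (fun z : U × V × Q => w z.1 z.2.1 * q z.1 z.2.2) (fun z => z.2.2) =
      ∑ r, Real.negMulLog (∑ v, ∑ u, w u v * q u r) := by
    rw [ent_eq_sum]
    simp only [m6]
    refine Finset.sum_congr rfl fun r _ => ?_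
    rw [Finset.sum_comm]
  rw [e1, e2, e3, e4, e5, e6]
  have c2 : ∑ r, ∑ v, Real.negMulLog (∑ u, w u v * q u r) =
      ∑ v, ∑ r, Real.negMulLog (∑ u, w u v * q u r) := Finset.sum_comm
  have c5 : ∀ v, ∑ r, ∑ u, w u v * q u r = ∑ u, w u v := fun v => sum_kernel_mul hq1 _
  simp only [tension, massEntropy, Finset.sum_sub_distrib, c2, c5, Real.negMulLog_mul,
    Finset.sum_add_distrib, mul_sub, ← Finset.mul_sum, ← Finset.sum_mul, hq1, one_mul,
    Real.negMulLog_one]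
  simp only [mul_zero, sub_zero]
  ring

end TensionEnt

/-! ### The end of an oblivious transfer protocol -/

section Terminal

variable {S X Y Q : Type*} [Fintype S] [Fintype X] [Fintype Y] [Fintype Q]

/-- The string of Alice's pair that is selected by the bit `k`. -/
def pick (k : Bool) (u : S × S × X) : S := if k then u.2.1 else u.1

open Classical in
/-- The weight of `S_k = τ` and `V = v`, where `(U, V)` has weight `w` and `k` may depend on `v`. -/
noncomputable def pickWeight {V : Type*} (w : S × S × X → V → ℝ) (k : Bool) (v : V) (τ : S) : ℝ :=
  ∑ u, if pick k u = τ then w u v else 0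

/-- A lower bound for `I(U;Q|V) + I(U;V|Q)` for all `Q` with `Q - U - V`, where `U = (S₀, S₁, X)`
and `V = (K, Y)`: it is large if `S_K` is almost a function of `V`, the other string is almost
uniform given `V`, and `K` is almost uniform given `U`. -/
noncomputable def transferBound (w : S × S × X → Bool × Y → ℝ) : ℝ :=
  ∑ v, massEntropy (pickWeight w (!v.1) v) - 2 * ∑ v, massEntropy (pickWeight w v.1 v) -
    Real.log (Fintype.card S) * ∑ u, |∑ y, w u (false, y) - ∑ y, w u (true, y)| -
    (∑ u, ∑ v, w u v) * Real.log 2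

theorem pickWeight_nonneg {V : Type*} {w : S × S × X → V → ℝ} (hw : ∀ u v, 0 ≤ w u v) (k : Bool)
    (v : V) (τ : S) : 0 ≤ pickWeight w k v τ :=
  Finset.sum_nonneg fun u _ => by split_ifs <;> simp [hw]

theorem sum_pickWeight {V : Type*} (w : S × S × X → V → ℝ) (k : Bool) (v : V) :
    ∑ τ, pickWeight w k v τ = ∑ u, w u v := by
  classical
  unfold pickWeight
  rw [Finset.sum_comm]
  simp

theorem transferBound_zero : transferBound (fun (_ : S × S × X) (_ : Bool × Y) => (0 : ℝ)) = 0 := by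
  have h : ∀ k v, pickWeight (fun (_ : S × S × X) (_ : Bool × Y) => (0 : ℝ)) k v =
      fun _ => (0 : ℝ) := fun k v => by ext τ; simp [pickWeight]
  simp [transferBound, h, massEntropy_zero]

/-- Continuity of conditional entropy: exchanging two weights on `U`. -/
theorem sum_massEntropy_pickWeight_le {m m' : S × S × X → ℝ} {q : S × S × X → Q → ℝ}
    (hm : ∀ u, 0 ≤ m u) (hm' : ∀ u, 0 ≤ m' u) (hq : ∀ u r, 0 ≤ q u r)
    (hq1 : ∀ u, ∑ r, q u r = 1) (k : Bool) :
    ∑ r, massEntropy (pickWeight (fun u r => m u * q u r) k r) ≤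
      ∑ r, massEntropy (pickWeight (fun u r => m' u * q u r) k r) +
        Real.log (Fintype.card S) * ∑ u, max (m u - m' u) 0 + (∑ u, m u) * Real.log 2 := by
  classical
  have hmin : ∀ u r, 0 ≤ min (m u) (m' u) * q u r := fun u r =>
    mul_nonneg (le_min (hm u) (hm' u)) (hq u r)
  have hmax : ∀ u r, 0 ≤ max (m u - m' u) 0 * q u r := fun u r =>
    mul_nonneg (le_max_right _ _) (hq u r)
  have hmax' : ∀ u r, 0 ≤ max (m' u - m u) 0 * q u r := fun u r =>
    mul_nonneg (le_max_right _ _) (hq u r)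
  have hsplit : ∀ a b : ℝ, a = min a b + max (a - b) 0 := by
    intro a b
    rcases le_total a b with h | h
    · rw [min_eq_left h, max_eq_right (by linarith)]; ring
    · rw [min_eq_right h, max_eq_left (by linarith)]; ring
  have hadd : ∀ (f g : S × S × X → ℝ) r τ,
      pickWeight (fun u r => (f u + g u) * q u r) k r τ =
        pickWeight (fun u r => f u * q u r) k r τ + pickWeight (fun u r => g u * q u r) k r τ := by
    intro f g r τ
    simp only [pickWeight, ← Finset.sum_add_distrib]
    refine Finset.sum_congr rfl fun u _ => ?_
    split_ifs <;> ring
  have h1 : ∀ r, pickWeight (fun u r => m u * q u r) k r = fun τ =>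
      pickWeight (fun u r => min (m u) (m' u) * q u r) k r τ +
        pickWeight (fun u r => max (m u - m' u) 0 * q u r) k r τ := by
    intro r; ext τ
    rw [← hadd]
    congr 1; ext u r
    rw [← hsplit]
  have h2 : ∀ r, pickWeight (fun u r => m' u * q u r) k r = fun τ =>
      pickWeight (fun u r => min (m u) (m' u) * q u r) k r τ +
        pickWeight (fun u r => max (m' u - m u) 0 * q u r) k r τ := by
    intro r; ext τ
    rw [← hadd]
    congr 1; ext u r
    rw [min_comm, ← hsplit]
  -- Both weights contain `min m m'`. Cutting `m` into this part and its excess costs at most `log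
  -- 2` per unit of mass, the excess has at most `log |S|` per unit of mass, and removing from `m'`
  -- its own excess only lowers the entropy.
  have key : ∀ r, massEntropy (pickWeight (fun u r => m u * q u r) k r) ≤
      massEntropy (pickWeight (fun u r => m' u * q u r) k r) +
        Real.log (Fintype.card S) * (∑ u, max (m u - m' u) 0 * q u r) +
          (∑ u, m u * q u r) * Real.log 2 := by
    intro r
    have a1 := massEntropy_add_le_add (pickWeight_nonneg hmin k r) (pickWeight_nonneg hmax k r)
    have a2 := massEntropy_add_le (pickWeight_nonneg hmin k r) (pickWeight_nonneg hmax' k r)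
    have a3 := massEntropy_nonneg (pickWeight_nonneg hmax' k r)
    have a4 := massEntropy_le_log_card (pickWeight_nonneg hmax k r)
    rw [← Finset.sum_add_distrib, ← h1] at a1
    rw [← h2] at a2
    have a5 : Finset.univ.sum (pickWeight (fun u r => m u * q u r) k r) = ∑ u, m u * q u r :=
      sum_pickWeight (fun u r => m u * q u r) k r
    rw [a5] at a1
    rw [sum_pickWeight] at a4
    linarith
  refine (Finset.sum_le_sum fun r _ => key r).trans (le_of_eq ?_)
  rw [Finset.sum_add_distrib, Finset.sum_add_distrib, ← Finset.mul_sum, ← Finset.sum_mul,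
    sum_kernel_mul hq1, sum_kernel_mul hq1]

/-- Write A = (S₀, S₁), T = S_K, N = S_K̄. Discarding X leaves at least I(A;Q|V) + I(A;V|Q) = H(A|V)
+ H(A|Q) - 2 H(A|V,Q). Here H(A|V) ≥ H(N|V), H(A|Q) ≥ H(T|K,Q) + H(N|K,T,Q) and H(A|V,Q) ≤ H(T|V) +
H(N|K,T,Q). One copy of H(N|K,T,Q) remains with a minus sign and is at most H(N|K,Q). The difference
H(T|K,Q) - H(N|K,Q) is then controlled by the dependence of K on U. -/
theorem transferBound_le_tension {w : S × S × X → Bool × Y → ℝ} {q : S × S × X → Q → ℝ}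
    (hw : ∀ u v, 0 ≤ w u v) (hq : ∀ u r, 0 ≤ q u r) (hq1 : ∀ u, ∑ r, q u r = 1) :
    transferBound w ≤ tension w q := by
  classical
  set ρ : (S × S × X) × (Bool × Y) × Q → ℝ := fun z => w z.1 z.2.1 * q z.1 z.2.2 with hρdef
  have hρ : ∀ z, 0 ≤ ρ z := fun z => mul_nonneg (hw _ _) (hq _ _)
  set sA : (S × S × X) × (Bool × Y) × Q → S × S := fun z => (z.1.1, z.1.2.1) with hsA
  set sT : (S × S × X) × (Bool × Y) × Q → S := fun z => pick z.2.1.1 z.1 with hsT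
  set sN : (S × S × X) × (Bool × Y) × Q → S := fun z => pick (!z.2.1.1) z.1 with hsN
  -- Given `K`, the pairs `(S_K, S_K̄)` and `(S₀, S₁)` determine each other.
  have pairs : ∀ z z' : (S × S × X) × (Bool × Y) × Q, z.2.1.1 = z'.2.1.1 →
      ((sT z = sT z' ∧ sN z = sN z') ↔ sA z = sA z') := by
    rintro ⟨⟨a, b, x⟩, ⟨k, y⟩, r⟩ ⟨⟨a', b', x'⟩, ⟨k', y'⟩, r'⟩ h
    simp only at h
    subst h
    cases k <;> simp [hsT, hsN, hsA, pick, and_comm]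
  have pV : ∀ z z' : (S × S × X) × (Bool × Y) × Q,
      z.2.1 = z'.2.1 ↔ z.2.1.1 = z'.2.1.1 ∧ z.2.1.2 = z'.2.1.2 := fun z z' => Prod.ext_iff
  have i1 := ent_submodular hρ (fun z => z.1.2.2) (fun z => z.2.2) (fun z => (sA z, z.2.1))
  have i2 := ent_submodular hρ (fun z => z.1.2.2) (fun z => z.2.1) (fun z => (sA z, z.2.2))
  have i3 := ent_mono hρ (fun z => (z.2.1, sN z)) sA
  have i4 := ent_submodular hρ sN (fun z => z.2.1.2) (fun z => (z.2.1.1, sT z, z.2.2))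
  have i5 := ent_submodular hρ sT (fun z => z.2.2) (fun z => z.2.1)
  have i6 := ent_submodular hρ sA (fun z => z.2.1.1) (fun z => z.2.2)
  have i7 := ent_submodular hρ sT sN (fun z => (z.2.1.1, z.2.2))
  have r1 : ent ρ (fun z => ((sA z, z.2.1), z.1.2.2, z.2.2)) = ent ρ (fun z => z) :=
    ent_congr _ (by rintro ⟨⟨a, b, x⟩, v, r⟩ ⟨⟨a', b', x'⟩, v', r'⟩; simp [hsA]; tauto)
  have r2 : ent ρ (fun z => ((sA z, z.2.2), z.1.2.2, z.2.1)) = ent ρ (fun z => z) :=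
    ent_congr _ (by rintro ⟨⟨a, b, x⟩, v, r⟩ ⟨⟨a', b', x'⟩, v', r'⟩; simp [hsA]; tauto)
  have r3 : ent ρ (fun z => ((sA z, z.2.1), z.1.2.2)) = ent ρ (fun z => (z.1, z.2.1)) :=
    ent_congr _ (by rintro ⟨⟨a, b, x⟩, v, r⟩ ⟨⟨a', b', x'⟩, v', r'⟩; simp [hsA]; tauto)
  have r4 : ent ρ (fun z => ((sA z, z.2.2), z.1.2.2)) = ent ρ (fun z => (z.1, z.2.2)) :=
    ent_congr _ (by rintro ⟨⟨a, b, x⟩, v, r⟩ ⟨⟨a', b', x'⟩, v', r'⟩; simp [hsA]; tauto)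
  have r5 : ent ρ (fun z => ((sA z, z.2.2), z.2.1)) = ent ρ (fun z => ((sA z, z.2.1), z.2.2)) :=
    ent_congr _ (by intro z z'; simp only [Prod.mk.injEq]; tauto)
  have r6 : ent ρ (fun z => ((z.2.1, sN z), sA z)) = ent ρ (fun z => (sA z, z.2.1)) :=
    ent_congr _ (by
      intro z z'
      have := pairs z z'
      simp only [Prod.mk.injEq, pV z z']
      tauto)
  have r7 : ent ρ (fun z => ((z.2.1.1, sT z, z.2.2), sN z, z.2.1.2)) =
      ent ρ (fun z => ((sA z, z.2.1), z.2.2)) :=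
    ent_congr _ (by
      intro z z'
      have := pairs z z'
      simp only [Prod.mk.injEq, pV z z']
      tauto)
  have r8 : ent ρ (fun z => ((z.2.1.1, sT z, z.2.2), sN z)) =
      ent ρ (fun z => (z.2.2, sA z, z.2.1.1)) :=
    ent_congr _ (by
      intro z z'
      have := pairs z z'
      simp only [Prod.mk.injEq]
      tauto)
  have r9 : ent ρ (fun z => ((z.2.1.1, sT z, z.2.2), z.2.1.2)) =
      ent ρ (fun z => (z.2.1, sT z, z.2.2)) :=
    ent_congr _ (by
      intro z z'
      simp only [Prod.mk.injEq, pV z z']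
      tauto)
  have r10 : ent ρ (fun z => (z.2.2, z.2.1.1)) = ent ρ (fun z => (z.2.1.1, z.2.2)) :=
    ent_congr _ (by intro z z'; simp only [Prod.mk.injEq]; tauto)
  have r11 : ent ρ (fun z => ((z.2.1.1, z.2.2), sT z, sN z)) =
      ent ρ (fun z => (z.2.2, sA z, z.2.1.1)) :=
    ent_congr _ (by
      intro z z'
      have := pairs z z'
      simp only [Prod.mk.injEq]
      tauto)
  have r12 : ent ρ (fun z => (z.2.1.1, sT z, z.2.2)) = ent ρ (fun z => ((z.2.1.1, z.2.2), sT z)) :=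
    ent_congr _ (by intro z z'; simp only [Prod.mk.injEq]; tauto)
  have r13 : ent ρ (fun z => (z.2.2, sA z)) = ent ρ (fun z => (sA z, z.2.2)) :=
    ent_congr _ (by intro z z'; simp only [Prod.mk.injEq]; tauto)
  have mV : ∀ (f : Bool → Bool) v τ, marg ρ (fun z => (z.2.1, pick (f z.2.1.1) z.1)) (v, τ) =
      pickWeight w (f v.1) v τ := by
    intro f v τ
    unfold marg pickWeight
    rw [Fintype.sum_prod_type]
    refine Finset.sum_congr rfl fun u _ => ?_
    simp only [Fintype.sum_prod_type (α₁ := Bool × Y), Prod.mk.injEq, ite_and]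
    rw [Finset.sum_eq_single v]
    · by_cases h : pick (f v.1) u = τ
      · simp [h, hρdef, ← Finset.mul_sum, hq1]
      · simp [h]
    · intro b _ hb; simp [hb]
    · simp
  have eT := ent_pair_sub ρ (fun z => z.2.1) sT
  have eN := ent_pair_sub ρ (fun z => z.2.1) sN
  simp only [hsT, mV fun b => b] at eT
  simp only [hsN, mV Bool.not] at eN
  have mK : ∀ (f : Bool → Bool) k r τ,
      marg ρ (fun z => ((z.2.1.1, z.2.2), pick (f z.2.1.1) z.1)) ((k, r), τ) =
      pickWeight (fun u r => (∑ y, w u (k, y)) * q u r) (f k) r τ := by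
    intro f k r τ
    unfold marg pickWeight
    rw [Fintype.sum_prod_type]
    refine Finset.sum_congr rfl fun u _ => ?_
    simp only [Fintype.sum_prod_type, Prod.mk.injEq, ite_and]
    rw [Finset.sum_eq_single k]
    · by_cases h : pick (f k) u = τ
      · simp [h, hρdef, Finset.sum_mul]
      · simp [h]
    · intro b _ hb; simp [hb]
    · simp
  have eT' := ent_pair_sub ρ (fun z => (z.2.1.1, z.2.2)) sT
  have eN' := ent_pair_sub ρ (fun z => (z.2.1.1, z.2.2)) sN
  simp only [hsT, Fintype.sum_prod_type, mK fun b => b] at eT'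
  simp only [hsN, Fintype.sum_prod_type, mK Bool.not] at eN'
  simp only [Fintype.sum_bool, Bool.not_true, Bool.not_false] at eT' eN'
  have hm : ∀ k u, 0 ≤ ∑ y, w u (k, y) := fun k u => Finset.sum_nonneg fun y _ => hw _ _
  -- `S₀` is the unchosen string for `K = true` and the chosen one for `K = false`. Exchanging the
  -- weights of these two cases compares its two entropies given `Q`; `c2` does the same for `S₁`.
  have c1 := sum_massEntropy_pickWeight_le (hm true) (hm false) hq hq1 false
  have c2 := sum_massEntropy_pickWeight_le (hm false) (hm true) hq hq1 true
  have c3 : ∑ u, |∑ y, w u (false, y) - ∑ y, w u (true, y)| =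
      ∑ u, max (∑ y, w u (true, y) - ∑ y, w u (false, y)) 0 +
        ∑ u, max (∑ y, w u (false, y) - ∑ y, w u (true, y)) 0 := by
    rw [← Finset.sum_add_distrib]
    refine Finset.sum_congr rfl fun u _ => ?_
    rcases le_total (∑ y, w u (false, y)) (∑ y, w u (true, y)) with h | h
    · rw [abs_of_nonpos (by linarith), max_eq_left (by linarith), max_eq_right (by linarith)]; ring
    · rw [abs_of_nonneg (by linarith), max_eq_right (by linarith), max_eq_left (by linarith)]; ring
  have c4 : ∑ u, ∑ v, w u v = ∑ u, ∑ y, w u (true, y) + ∑ u, ∑ y, w u (false, y) := by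
    simp only [Fintype.sum_prod_type, Fintype.sum_bool, Finset.sum_add_distrib]
  rw [tension_eq_ent hq1, transferBound, c3, c4, mul_add, add_mul]
  rw [r1, r3] at i1
  rw [r2, r4, r5] at i2
  rw [r6] at i3
  rw [r7, r8, r9, r12] at i4
  rw [r10, r13] at i6
  rw [r11] at i7
  simp only [hsT, hsN] at i1 i2 i3 i4 i5 i6 i7
  linarith

end Terminal

/-! ### The tree of transcripts -/

namespace OTProtocol

variable {𝒳 : Type u} {𝒴 : Type v} {n m : ℕ} (P : OTProtocol.{u, v, w} 𝒳 𝒴 n m)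

/-- A node of the tree of transcripts: the messages and the number of channel uses so far, and the
events, for each sequence of inputs and outputs, that the private randomness of Alice and of Bob
leads to it. -/
structure Node where
  msgs : List Msg
  uses : ℕ
  evA : BitString m → BitString m → List 𝒳 → Set P.RA
  evB : Bool → List 𝒴 → Set P.RB
  measurable_evA : ∀ s₀ s₁ xs, MeasurableSet (evA s₀ s₁ xs)
  measurable_evB : ∀ k ys, MeasurableSet (evB k ys)

namespace Node

variable {P}

/-- The node after the message `a` of Alice. -/
def sendA (N : P.Node) (a : Msg) : P.Node where
  msgs := N.msgs ++ [a]
  uses := N.uses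
  evA s₀ s₁ xs := N.evA s₀ s₁ xs ∩ {r | P.msgA s₀ s₁ r xs N.msgs = a}
  evB := N.evB
  measurable_evA _ _ _ := (N.measurable_evA _ _ _).inter (P.measurable_msgA _ _ _ _ _)
  measurable_evB := N.measurable_evB

/-- The node after the message `a` of Bob. -/
def sendB (N : P.Node) (a : Msg) : P.Node where
  msgs := N.msgs ++ [a]
  uses := N.uses
  evA := N.evA
  evB k ys := N.evB k ys ∩ {r | P.msgB k r ys N.msgs = a}
  measurable_evA := N.measurable_evA
  measurable_evB _ _ := (N.measurable_evB _ _).inter (P.measurable_msgB _ _ _ _)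

/-- The node after a use of the channel. -/
def transmit (N : P.Node) : P.Node where
  msgs := N.msgs
  uses := N.uses + 1
  evA s₀ s₁ xs := N.evA s₀ s₁ xs.dropLast ∩
    {r | xs.getLast? = some (P.input s₀ s₁ r xs.dropLast N.msgs)}
  -- The new output does not restrict Bob's randomness; it is tied to the noise in `Mem`.
  evB k ys := N.evB k ys.dropLast
  measurable_evA s₀ s₁ xs := by
    refine (N.measurable_evA _ _ _).inter ?_
    cases h : xs.getLast? with
    | none => simp
    | some c =>
      simp only [Option.some.injEq, eq_comm (a := c)]
      exact P.measurable_input _ _ _ _ _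
  measurable_evB _ _ := N.measurable_evB _ _

/-- The next node. The argument `a` is the message, or empty if the channel is used. -/
def child (N : P.Node) (a : Msg) : Option P.Node :=
  match P.turn N.uses N.msgs with
  | .alice => some (N.sendA a)
  | .bob => some (N.sendB a)
  | .channel => if N.uses < n ∧ a = [] then some N.transmit else none

/-- The node that is reached from `N` along a path. -/
def descend : P.Node → List Msg → Option P.Node
  | N, [] => some N
  | N, a :: l => (N.child a).bind fun N' => descend N' l

/-- The channel has been used `n` times and the last discussion is over. -/
def IsTerminal (N : P.Node) : Prop := N.uses = n ∧ P.turn N.uses N.msgs = .channel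

/-- The sample point `ω` leads to `N`, with inputs `xs` and outputs `ys`. -/
def Mem (N : P.Node) (ω : P.Sample) (xs : List 𝒳) (ys : List 𝒴) : Prop :=
  ω.2.1.1 ∈ N.evA (P.S₀ ω) (P.S₁ ω) xs ∧ ω.2.1.2 ∈ N.evB (P.K ω) ys ∧
    xs.length = N.uses ∧ ys.length = N.uses ∧
    ∀ (i : Fin n) (a : 𝒳) (b : 𝒴), xs[(i : ℕ)]? = some a → ys[(i : ℕ)]? = some b →
      ω.2.2.out i a = b

theorem mem_sendA {N : P.Node} {a : Msg} {ω : P.Sample} {xs : List 𝒳} {ys : List 𝒴} :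
    (N.sendA a).Mem ω xs ys ↔
      N.Mem ω xs ys ∧ P.msgA (P.S₀ ω) (P.S₁ ω) ω.2.1.1 xs N.msgs = a := by
  simp only [Mem, sendA, mem_inter_iff, mem_ofPred_eq]; tauto

theorem mem_sendB {N : P.Node} {a : Msg} {ω : P.Sample} {xs : List 𝒳} {ys : List 𝒴} :
    (N.sendB a).Mem ω xs ys ↔
      N.Mem ω xs ys ∧ P.msgB (P.K ω) ω.2.1.2 ys N.msgs = a := by
  simp only [Mem, sendB, mem_inter_iff, mem_ofPred_eq]; tauto

theorem Mem.transmit {N : P.Node} {ω : P.Sample} {xs : List 𝒳} {ys : List 𝒴}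
    (h : N.Mem ω xs ys) (hN : N.uses < n) :
    N.transmit.Mem ω (xs ++ [P.input (P.S₀ ω) (P.S₁ ω) ω.2.1.1 xs N.msgs])
      (ys ++ [ω.2.2.out ⟨N.uses, hN⟩ (P.input (P.S₀ ω) (P.S₁ ω) ω.2.1.1 xs N.msgs)]) := by
  obtain ⟨h1, h2, h3, h4, h5⟩ := h
  refine ⟨⟨by simpa using h1, by simp⟩, by simpa [Node.transmit] using h2,
    by simp [Node.transmit, h3], by simp [Node.transmit, h4], fun i a b ha hb => ?_⟩
  rcases lt_trichotomy (i : ℕ) N.uses with hi | hi | hi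
  · rw [List.getElem?_append_left (by omega)] at ha hb
    exact h5 i a b ha hb
  · have hi' : i = ⟨N.uses, hN⟩ := Fin.ext hi
    subst hi'
    rw [List.getElem?_append_right (by omega)] at ha hb
    simp only [h3, h4, Nat.sub_self, List.getElem?_cons_zero, Option.some.injEq] at ha hb
    rw [← ha, ← hb]
  · rw [List.getElem?_eq_none (by simp; omega)] at ha
    simp at ha

theorem mem_of_mem_transmit {N : P.Node} {ω : P.Sample} {xs' : List 𝒳} {ys' : List 𝒴}
    (h : N.transmit.Mem ω xs' ys') (hN : N.uses < n) :
    ∃ xs ys, N.Mem ω xs ys ∧ xs' = xs ++ [P.input (P.S₀ ω) (P.S₁ ω) ω.2.1.1 xs N.msgs] ∧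
      ys' = ys ++ [ω.2.2.out ⟨N.uses, hN⟩ (P.input (P.S₀ ω) (P.S₁ ω) ω.2.1.1 xs N.msgs)] := by
  obtain ⟨⟨h1, h1'⟩, h2, h3, h4, h5⟩ := h
  have h3 : xs'.length = N.uses + 1 := h3
  have h4 : ys'.length = N.uses + 1 := h4
  obtain ⟨xs, c, rfl⟩ : ∃ xs c, xs' = xs ++ [c] :=
    ⟨_, _, (List.dropLast_concat_getLast (by rintro rfl; simp at h3)).symm⟩
  obtain ⟨ys, d, rfl⟩ : ∃ ys d, ys' = ys ++ [d] :=
    ⟨_, _, (List.dropLast_concat_getLast (by rintro rfl; simp at h4)).symm⟩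
  simp only [List.length_append, List.length_singleton, Nat.add_right_cancel_iff] at h3 h4
  simp only [List.dropLast_concat, mem_ofPred_eq, List.getLast?_append, List.getLast?_singleton,
    Option.some_or, Option.some.injEq] at h1 h1'
  have h2 : ω.2.1.2 ∈ N.evB (P.K ω) (ys ++ [d]).dropLast := h2
  simp only [List.dropLast_concat] at h2
  refine ⟨xs, ys, ⟨h1, h2, h3, h4, fun i a b ha hb => h5 i a b ?_ ?_⟩, by rw [← h1'], ?_⟩
  · rw [List.getElem?_append_left]
    · exact ha
    · by_contra hlt; rw [List.getElem?_eq_none (by omega)] at ha; simp at ha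
  · rw [List.getElem?_append_left]
    · exact hb
    · by_contra hlt; rw [List.getElem?_eq_none (by omega)] at hb; simp at hb
  · rw [← h1', h5 ⟨N.uses, hN⟩ c d]
    · simp [← h3]
    · simp [← h4]

/-- With its converse `exists_mem_of_child`, this makes an edge of the tree correspond to one step
of the execution. -/
theorem Mem.exists_child {N : P.Node} {ω : P.Sample} {xs : List 𝒳} {ys : List 𝒴}
    (h : N.Mem ω xs ys) (hN : N.uses ≤ n) (ht : ¬ N.IsTerminal) :
    ∃ a N', N.child a = some N' ∧ ∃ xs' ys', N'.Mem ω xs' ys' ∧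
      P.step ω ⟨N.msgs, xs, ys⟩ = ⟨N'.msgs, xs', ys'⟩ := by
  unfold child step
  simp only [h.2.2.1]
  cases hT : P.turn N.uses N.msgs with
  | alice => exact ⟨_, _, rfl, xs, ys, mem_sendA.2 ⟨h, rfl⟩, rfl⟩
  | bob => exact ⟨_, _, rfl, xs, ys, mem_sendB.2 ⟨h, rfl⟩, rfl⟩
  | channel =>
    have hlt : N.uses < n := lt_of_le_of_ne hN fun h' => ht ⟨h', hT⟩
    refine ⟨[], N.transmit, by simp [hlt], _, _, h.transmit hlt, ?_⟩
    simp [hlt, Node.transmit]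

theorem exists_mem_of_child {N N' : P.Node} {a : Msg} (hc : N.child a = some N') {ω : P.Sample}
    {xs' : List 𝒳} {ys' : List 𝒴} (h : N'.Mem ω xs' ys') :
    ∃ xs ys, N.Mem ω xs ys ∧ P.step ω ⟨N.msgs, xs, ys⟩ = ⟨N'.msgs, xs', ys'⟩ := by
  unfold child at hc
  unfold step
  cases hT : P.turn N.uses N.msgs with
  | alice =>
    simp only [hT, Option.some.injEq] at hc
    subst hc
    obtain ⟨h1, h2⟩ := mem_sendA.1 h
    exact ⟨xs', ys', h1, by simp [h1.2.2.1, hT, h2, sendA]⟩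
  | bob =>
    simp only [hT, Option.some.injEq] at hc
    subst hc
    obtain ⟨h1, h2⟩ := mem_sendB.1 h
    exact ⟨xs', ys', h1, by simp [h1.2.2.1, hT, h2, sendB]⟩
  | channel =>
    simp only [hT, Option.ite_none_right_eq_some, Option.some.injEq] at hc
    obtain ⟨⟨hlt, rfl⟩, rfl⟩ := hc
    obtain ⟨xs, ys, h1, rfl, rfl⟩ := mem_of_mem_transmit h hlt
    exact ⟨xs, ys, h1, by simp [h1.2.2.1, hT, hlt, Node.transmit]⟩

theorem child_uses_le {N N' : P.Node} {a : Msg} (hc : N.child a = some N') (hN : N.uses ≤ n) :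
    N'.uses ≤ n := by
  unfold child at hc
  cases hT : P.turn N.uses N.msgs with
  | alice => simp only [hT, Option.some.injEq] at hc; subst hc; exact hN
  | bob => simp only [hT, Option.some.injEq] at hc; subst hc; exact hN
  | channel =>
    simp only [hT, Option.ite_none_right_eq_some, Option.some.injEq] at hc
    obtain ⟨⟨hlt, rfl⟩, rfl⟩ := hc
    exact hlt

theorem exists_mem_of_descend {l : List Msg} {N N' : P.Node} (hd : N.descend l = some N')
    {ω : P.Sample} {xs' : List 𝒳} {ys' : List 𝒴} (h : N'.Mem ω xs' ys') :
    ∃ xs ys, N.Mem ω xs ys ∧ (P.step ω)^[l.length] ⟨N.msgs, xs, ys⟩ = ⟨N'.msgs, xs', ys'⟩ := by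
  induction l generalizing N with
  | nil =>
    simp only [descend, Option.some.injEq] at hd
    subst hd
    exact ⟨xs', ys', h, rfl⟩
  | cons a l ih =>
    simp only [descend, Option.bind_eq_some_iff] at hd
    obtain ⟨M, hM, hd⟩ := hd
    obtain ⟨xs, ys, h1, h2⟩ := ih hd
    obtain ⟨xs₀, ys₀, h3, h4⟩ := exists_mem_of_child hM h1
    exact ⟨xs₀, ys₀, h3, by rw [List.length_cons, Function.iterate_succ_apply, h4, h2]⟩

theorem IsTerminal.step_eq {N : P.Node} (ht : N.IsTerminal) {ω : P.Sample} {xs : List 𝒳}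
    {ys : List 𝒴} (h : xs.length = N.uses) :
    P.step ω ⟨N.msgs, xs, ys⟩ = ⟨N.msgs, xs, ys⟩ := by
  unfold step
  simp only [h, ht.2]
  simp [ht.1]

/-- The path may be shorter than `t`, because the state at a terminal node is a fixed point of
`step`. -/
theorem Mem.exists_terminal {N : P.Node} {ω : P.Sample} {xs : List 𝒳} {ys : List 𝒴}
    (h : N.Mem ω xs ys) (hN : N.uses ≤ n) {t : ℕ}
    (he : P.Ended ((P.step ω)^[t] ⟨N.msgs, xs, ys⟩)) :
    ∃ l N' xs' ys', N.descend l = some N' ∧ N'.IsTerminal ∧ N'.Mem ω xs' ys' ∧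
      (P.step ω)^[t] ⟨N.msgs, xs, ys⟩ = ⟨N'.msgs, xs', ys'⟩ := by
  by_cases ht : N.IsTerminal
  · exact ⟨[], N, xs, ys, rfl, ht, h, Function.iterate_fixed (ht.step_eq h.2.2.1) t⟩
  induction t generalizing N xs ys with
  | zero =>
    obtain ⟨h1, h2⟩ := he
    simp only [Function.iterate_zero, id, h.2.2.1] at h1 h2
    exact absurd ⟨le_antisymm hN h1, h2⟩ ht
  | succ t ih =>
    obtain ⟨a, M, hM, xs₁, ys₁, h1, h2⟩ := h.exists_child hN ht
    rw [Function.iterate_succ_apply, h2] at he ⊢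
    by_cases ht' : M.IsTerminal
    · exact ⟨[a], M, xs₁, ys₁, by simp [descend, hM], ht', h1,
        Function.iterate_fixed (ht'.step_eq h1.2.2.1) t⟩
    · obtain ⟨l, N', xs', ys', h3, h4⟩ := ih h1 (child_uses_le hM hN) he ht'
      exact ⟨a :: l, N', xs', ys', by simp [descend, hM, h3], h4⟩

theorem child_eq_none_of_isTerminal {N : P.Node} (ht : N.IsTerminal) (a : Msg) :
    N.child a = none := by
  simp only [child, ht.2]
  simp [ht.1]

theorem child_msgs_prefix {N N' : P.Node} {a : Msg} (hc : N.child a = some N') :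
    N.msgs <+: N'.msgs := by
  unfold child at hc
  cases hT : P.turn N.uses N.msgs with
  | alice => simp only [hT, Option.some.injEq] at hc; subst hc; exact List.prefix_append _ _
  | bob => simp only [hT, Option.some.injEq] at hc; subst hc; exact List.prefix_append _ _
  | channel =>
    simp only [hT, Option.ite_none_right_eq_some, Option.some.injEq] at hc
    obtain ⟨⟨hlt, rfl⟩, rfl⟩ := hc
    exact List.prefix_rfl

theorem descend_msgs_prefix {l : List Msg} {N N' : P.Node} (hd : N.descend l = some N') :
    N.msgs <+: N'.msgs := by
  induction l generalizing N with
  | nil => simp only [descend, Option.some.injEq] at hd; subst hd; exact List.prefix_rfl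
  | cons a l ih =>
    simp only [descend, Option.bind_eq_some_iff] at hd
    obtain ⟨M, hM, hd⟩ := hd
    exact (child_msgs_prefix hM).trans (ih hd)

/-- Siblings differ in the message that follows `N.msgs`, and a channel use has a single child, so a
transcript extends at most one branch. -/
theorem eq_of_child_prefix {N M M' : P.Node} {a a' : Msg} (hc : N.child a = some M)
    (hc' : N.child a' = some M') {f : List Msg} (h : M.msgs <+: f) (h' : M'.msgs <+: f) :
    a = a' := by
  have key : N.msgs ++ [a] <+: f → N.msgs ++ [a'] <+: f → a = a' := by
    rintro ⟨t, rfl⟩ ⟨t', ht⟩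
    simp only [List.append_assoc, List.append_cancel_left_eq, List.cons_append,
      List.cons.injEq] at ht
    exact ht.1.symm
  unfold child at hc hc'
  cases hT : P.turn N.uses N.msgs with
  | alice =>
    simp only [hT, Option.some.injEq] at hc hc'; subst hc hc'; exact key h h'
  | bob =>
    simp only [hT, Option.some.injEq] at hc hc'; subst hc hc'; exact key h h'
  | channel =>
    simp only [hT, Option.ite_none_right_eq_some] at hc hc'
    rw [hc.1.2, hc'.1.2]

/-- A terminal node is determined by its transcript. -/
theorem descend_injective {l l' : List Msg} {N M M' : P.Node} (hd : N.descend l = some M)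
    (hd' : N.descend l' = some M') (ht : M.IsTerminal) (ht' : M'.IsTerminal)
    (h : M.msgs = M'.msgs) : l = l' := by
  induction l generalizing N l' with
  | nil =>
    simp only [descend, Option.some.injEq] at hd
    subst hd
    -- A terminal node has no children, so neither path can properly extend the other.
    cases l' with
    | nil => rfl
    | cons a l' => simp [descend, child_eq_none_of_isTerminal ht] at hd'
  | cons a l ih =>
    cases l' with
    | nil =>
      simp only [descend, Option.some.injEq] at hd'
      subst hd'
      simp [descend, child_eq_none_of_isTerminal ht'] at hd
    | cons a' l' =>
      simp only [descend, Option.bind_eq_some_iff] at hd hd'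
      obtain ⟨L, hL, hd⟩ := hd
      obtain ⟨L', hL', hd'⟩ := hd'
      have haa : a = a' := eq_of_child_prefix hL hL' (descend_msgs_prefix hd)
        (h ▸ descend_msgs_prefix hd')
      subst haa
      rw [hL, Option.some.injEq] at hL'
      subst hL'
      rw [ih hd hd']

end Node

/-- The node at which the execution starts. -/
def root : P.Node where
  msgs := []
  uses := 0
  evA _ _ _ := univ
  evB _ _ := univ
  measurable_evA _ _ _ := MeasurableSet.univ
  measurable_evB _ _ := MeasurableSet.univ

variable {P} in
theorem mem_root {ω : P.Sample} {xs : List 𝒳} {ys : List 𝒴} :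
    P.root.Mem ω xs ys ↔ xs = [] ∧ ys = [] := by
  simp only [Node.Mem, root, mem_univ, true_and, List.length_eq_zero_iff]
  constructor
  · rintro ⟨h1, h2, -⟩; exact ⟨h1, h2⟩
  · rintro ⟨rfl, rfl⟩; simp

variable {P} in
theorem ended_step_eq {ω : P.Sample} {st : OTState 𝒳 𝒴} (h : P.Ended st) : P.step ω st = st := by
  unfold step
  rw [h.2]
  simp [not_lt.2 h.1]

variable {P} in
theorem final_eq_of_ended {ω : P.Sample} {t : ℕ} (h : P.Ended (P.stateAt ω t)) :
    P.final ω = P.stateAt ω t := by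
  have h0 : P.Ended (P.stateAt ω (sInf {t | P.Ended (P.stateAt ω t)})) :=
    Nat.sInf_mem (s := {t | P.Ended (P.stateAt ω t)}) ⟨t, h⟩
  have hle : sInf {t | P.Ended (P.stateAt ω t)} ≤ t := Nat.sInf_le h
  obtain ⟨d, hd⟩ := Nat.exists_eq_add_of_le hle
  unfold final
  rw [hd]
  generalize sInf {t | P.Ended (P.stateAt ω t)} = t₀ at h0
  unfold stateAt at *
  rw [add_comm, Function.iterate_add_apply, Function.iterate_fixed (ended_step_eq h0)]

variable {P} in
theorem final_of_mem_terminal {l : List Msg} {N : P.Node} (hd : P.root.descend l = some N)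
    (ht : N.IsTerminal) {ω : P.Sample} {xs : List 𝒳} {ys : List 𝒴} (h : N.Mem ω xs ys) :
    P.final ω = ⟨N.msgs, xs, ys⟩ := by
  obtain ⟨xs₀, ys₀, h0, h1⟩ := Node.exists_mem_of_descend hd h
  obtain ⟨rfl, rfl⟩ := mem_root.1 h0
  have h2 : P.stateAt ω l.length = ⟨N.msgs, xs, ys⟩ := h1
  rw [← h2]
  apply final_eq_of_ended
  rw [h2]
  exact ⟨by simp [h.2.2.1, ht.1], by simpa [h.2.2.1] using ht.2⟩

variable {P} in
theorem exists_terminal_of_ended {ω : P.Sample} {t : ℕ} (h : P.Ended (P.stateAt ω t)) :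
    ∃ l N, P.root.descend l = some N ∧ N.IsTerminal ∧ N.msgs = P.F ω ∧
      N.Mem ω (P.Xn ω) (P.Yn ω) := by
  obtain ⟨l, N, xs, ys, h1, h2, h3, -⟩ :=
    (mem_root (ω := ω).2 ⟨rfl, rfl⟩).exists_terminal (Nat.zero_le n) h
  have h4 := final_of_mem_terminal h1 h2 h3
  refine ⟨l, N, h1, h2, by simp [F, h4], ?_⟩
  simpa [Xn, Yn, h4] using h3

end OTProtocol

/-! ### The tension grows by at most the single-letter bound in each channel use -/

section Fibers

variable {Ω ι : Type*} {mΩ : MeasurableSpace Ω} (ν : Measure Ω) [IsFiniteMeasure ν]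

theorem sum_measureReal_inter_fiber_le (T : Finset ι) {E : Set Ω} (hE : MeasurableSet E)
    {f : Ω → ι} (hf : ∀ i, MeasurableSet {r | f r = i}) :
    ∑ i ∈ T, ν.real (E ∩ {r | f r = i}) ≤ ν.real E := by
  rw [← measureReal_biUnion_finset]
  · exact measureReal_mono (iUnion₂_subset fun i _ => inter_subset_left)
  · intro i _ j _ hij
    refine Set.disjoint_left.2 fun r h h' => hij ?_
    rw [← h.2, ← h'.2]
  · exact fun i _ => hE.inter (hf i)

theorem sum_measureReal_inter_fiber [Fintype ι] {E : Set Ω} (hE : MeasurableSet E)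
    {f : Ω → ι} (hf : ∀ i, MeasurableSet {r | f r = i}) :
    ∑ i, ν.real (E ∩ {r | f r = i}) = ν.real E := by
  rw [← measureReal_biUnion_finset]
  · congr 1
    ext r; simp
  · intro i _ j _ hij
    refine Set.disjoint_left.2 fun r h h' => hij ?_
    rw [← h.2, ← h'.2]
  · exact fun i _ => hE.inter (hf i)

end Fibers

/-- For the induction over the tree: the descendants of a node are the node itself and the
descendants of its children. -/
theorem tsum_list_le {α : Type*} (g : List α → ENNReal) :
    ∑' l, g l ≤ g [] + ∑' a, ∑' l, g (a :: l) := by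
  classical
  rw [ENNReal.tsum_eq_add_tsum_ite (f := g) []]
  gcongr
  have hinj : Function.Injective fun p : α × List α => p.1 :: p.2 := by
    rintro ⟨a, l⟩ ⟨a', l'⟩ h; simpa using h
  have h := hinj.tsum_eq (f := fun l => if l = [] then 0 else g l) (by
    intro l hl
    cases l with
    | nil => simp at hl
    | cons a l => exact ⟨(a, l), rfl⟩)
  refine (tsum_congr fun l => ?_).trans_le (h.symm.trans_le ?_)
  · split_ifs <;> rfl
  · rw [ENNReal.tsum_prod']
    simp

namespace OTProtocol

variable {𝒳 : Type u} {𝒴 : Type v} {n m : ℕ} {P : OTProtocol.{u, v, w} 𝒳 𝒴 n m}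

/-! ### Weights of nodes and the potential argument -/

namespace Node

/-- The probability that the execution reaches the node `N` with given strings and inputs of Alice,
and given bit and outputs of Bob, after `i` channel uses. -/
noncomputable def weight (N : P.Node) (W : 𝒳 → PMF 𝒴) (i : ℕ)
    (a : BitString m × BitString m × (Fin i → 𝒳)) (b : Bool × (Fin i → 𝒴)) : ℝ :=
  (Fintype.card (BitString m × BitString m × Bool) : ℝ)⁻¹ *
    P.lawA.real (N.evA a.1 a.2.1 (List.ofFn a.2.2)) * P.lawB.real (N.evB b.1 (List.ofFn b.2)) *
    ∏ j, (W (a.2.2 j) (b.2 j)).toReal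

theorem weight_nonneg (N : P.Node) (W : 𝒳 → PMF 𝒴) (i : ℕ) (a) (b) : 0 ≤ N.weight W i a b := by
  unfold weight
  have : 0 ≤ ∏ j, (W (a.2.2 j) (b.2 j)).toReal :=
    Finset.prod_nonneg fun _ _ => ENNReal.toReal_nonneg
  positivity

/-- The factor is the conditional probability of the message given Alice's view, a function of `a`
alone, as `sum_tension_left_step` requires. Where the denominator vanishes, both weights vanish too.
-/
theorem weight_sendA (N : P.Node) (W : 𝒳 → PMF 𝒴) (i : ℕ) (c : Msg) (a) (b) :
    (N.sendA c).weight W i a b =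
      P.lawA.real ((N.sendA c).evA a.1 a.2.1 (List.ofFn a.2.2)) /
        P.lawA.real (N.evA a.1 a.2.1 (List.ofFn a.2.2)) * N.weight W i a b := by
  by_cases h : P.lawA.real (N.evA a.1 a.2.1 (List.ofFn a.2.2)) = 0
  · have h' : P.lawA.real ((N.sendA c).evA a.1 a.2.1 (List.ofFn a.2.2)) = 0 :=
      le_antisymm (h ▸ measureReal_mono inter_subset_left) measureReal_nonneg
    simp [weight, h, h']
  · unfold weight
    rw [show (N.sendA c).evB = N.evB from rfl]
    field_simp

theorem weight_sendB (N : P.Node) (W : 𝒳 → PMF 𝒴) (i : ℕ) (c : Msg) (a) (b) :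
    (N.sendB c).weight W i a b =
      P.lawB.real ((N.sendB c).evB b.1 (List.ofFn b.2)) /
        P.lawB.real (N.evB b.1 (List.ofFn b.2)) * N.weight W i a b := by
  by_cases h : P.lawB.real (N.evB b.1 (List.ofFn b.2)) = 0
  · have h' : P.lawB.real ((N.sendB c).evB b.1 (List.ofFn b.2)) = 0 :=
      le_antisymm (h ▸ measureReal_mono inter_subset_left) measureReal_nonneg
    simp [weight, h, h']
  · unfold weight
    rw [show (N.sendB c).evA = N.evA from rfl]
    field_simp

open Classical in
/-- The conditional law of the next channel input. -/
noncomputable def inputKernel [Nonempty 𝒳] (N : P.Node) (i : ℕ)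
    (a : BitString m × BitString m × (Fin i → 𝒳)) (x : 𝒳) : ℝ :=
  -- On a null event the law of the input is immaterial; a point mass keeps the kernel stochastic.
  if P.lawA.real (N.evA a.1 a.2.1 (List.ofFn a.2.2)) = 0 then
    if x = Classical.arbitrary 𝒳 then 1 else 0
  else P.lawA.real (N.evA a.1 a.2.1 (List.ofFn a.2.2) ∩
      {r | P.input a.1 a.2.1 r (List.ofFn a.2.2) N.msgs = x}) /
    P.lawA.real (N.evA a.1 a.2.1 (List.ofFn a.2.2))

theorem inputKernel_nonneg [Nonempty 𝒳] (N : P.Node) (i : ℕ) (a) (x) :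
    0 ≤ N.inputKernel i a x := by
  unfold inputKernel
  split_ifs <;> positivity

theorem sum_inputKernel [Fintype 𝒳] [Nonempty 𝒳] (N : P.Node) (i : ℕ) (a) :
    ∑ x, N.inputKernel i a x = 1 := by
  unfold inputKernel
  by_cases h : P.lawA.real (N.evA a.1 a.2.1 (List.ofFn a.2.2)) = 0
  · simp only [h, if_true]
    rw [Finset.sum_eq_single (Classical.arbitrary 𝒳)] <;> simp +contextual
  · simp only [h, if_false]
    rw [← Finset.sum_div, sum_measureReal_inter_fiber _ (N.measurable_evA _ _ _)
      fun x => P.measurable_input _ _ _ _ _, div_self h]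

/-- The shape that `tension_channel_step` expects: old weight, input kernel of Alice's view,
channel. -/
theorem weight_transmit [Nonempty 𝒳] (N : P.Node) (W : 𝒳 → PMF 𝒴) (i : ℕ) (s₀ s₁ k)
    (x : Fin i → 𝒳) (x' : 𝒳) (y : Fin i → 𝒴) (y' : 𝒴) :
    N.transmit.weight W (i + 1) (s₀, s₁, Fin.snoc x x') (k, Fin.snoc y y') =
      N.weight W i (s₀, s₁, x) (k, y) * N.inputKernel i (s₀, s₁, x) x' * (W x' y').toReal := by
  have hA : N.transmit.evA s₀ s₁ (List.ofFn (Fin.snoc x x' : Fin (i + 1) → 𝒳)) =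
      N.evA s₀ s₁ (List.ofFn x) ∩ {r | P.input s₀ s₁ r (List.ofFn x) N.msgs = x'} := by
    simp only [transmit, List.ofFn_succ_last, Fin.snoc_castSucc, Fin.snoc_last,
      List.dropLast_concat, List.getLast?_append, List.getLast?_singleton, Option.some_or,
      Option.some.injEq, eq_comm]
  have hB : N.transmit.evB k (List.ofFn (Fin.snoc y y' : Fin (i + 1) → 𝒴)) =
      N.evB k (List.ofFn y) := by
    simp only [transmit, List.ofFn_succ_last, Fin.snoc_castSucc, Fin.snoc_last,
      List.dropLast_concat]
  simp only [weight, hA, hB, Fin.prod_univ_castSucc, Fin.snoc_castSucc, Fin.snoc_last, inputKernel]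
  by_cases h : P.lawA.real (N.evA s₀ s₁ (List.ofFn x)) = 0
  · have h' : P.lawA.real (N.evA s₀ s₁ (List.ofFn x) ∩
        {r | P.input s₀ s₁ r (List.ofFn x) N.msgs = x'}) = 0 :=
      le_antisymm (h ▸ measureReal_mono inter_subset_left) measureReal_nonneg
    simp [h, h']
  · simp only [h, if_false]
    field_simp

/-- Appending an input to Alice's view. -/
def viewEquivA (m i : ℕ) (𝒳 : Type u) : (BitString m × BitString m × (Fin i → 𝒳)) × 𝒳 ≃
    BitString m × BitString m × (Fin (i + 1) → 𝒳) where
  toFun a := (a.1.1, a.1.2.1, Fin.snoc a.1.2.2 a.2)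
  invFun a := ((a.1, a.2.1, Fin.init a.2.2), a.2.2 (Fin.last i))
  left_inv a := by simp
  right_inv a := by simp

/-- Appending an output to Bob's view. -/
def viewEquivB (i : ℕ) (𝒴 : Type v) : (Bool × (Fin i → 𝒴)) × 𝒴 ≃ Bool × (Fin (i + 1) → 𝒴) where
  toFun b := (b.1.1, Fin.snoc b.1.2 b.2)
  invFun b := ((b.1, Fin.init b.2), b.2 (Fin.last i))
  left_inv b := by simp
  right_inv b := by simp

/-- The contribution of a node to the sum over all ends of the execution. -/
noncomputable def terminalBound [Fintype 𝒳] [Fintype 𝒴] (W : 𝒳 → PMF 𝒴) (N : Option P.Node) :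
    ENNReal :=
  open Classical in
  match N with
  | none => 0
  -- Negative values are cut off at zero. This does no harm, since the potential that bounds them is
  -- nonnegative.
  | some N => if N.IsTerminal then ENNReal.ofReal (transferBound (N.weight W n)) else 0

/-- `B` bounds the tension of the channel for each weight on the inputs, with a suitable kernel. -/
def ChannelTensionLE [Fintype 𝒳] [Fintype 𝒴] (W : 𝒳 → PMF 𝒴) (B : ℝ) : Prop :=
  ∀ p : 𝒳 → ℝ, (∀ x, 0 ≤ p x) → ∃ (k : ℕ) (q : 𝒳 → Fin k → ℝ), (∀ x r, 0 ≤ q x r) ∧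
    (∀ x, ∑ r, q x r = 1) ∧ tension (fun x y => p x * (W x y).toReal) q ≤ (∑ x, p x) * B

theorem sum_toReal_pmf {α : Type*} [Fintype α] (p : PMF α) : ∑ x, (p x).toReal = 1 := by
  rw [← ENNReal.toReal_sum fun x _ => p.apply_ne_top x, ← tsum_fintype (L := .unconditional _),
    p.tsum_coe, ENNReal.toReal_one]

theorem tsum_ofReal_le {ι : Type*} {f : ι → ℝ} (hf : ∀ i, 0 ≤ f i) {c : ℝ}
    (h : ∀ T : Finset ι, ∑ i ∈ T, f i ≤ c) : ∑' i, ENNReal.ofReal (f i) ≤ ENNReal.ofReal c := by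
  rw [ENNReal.tsum_eq_iSup_sum]
  refine iSup_le fun T => ?_
  rw [← ENNReal.ofReal_sum_of_nonneg fun i _ => hf i]
  exact ENNReal.ofReal_le_ofReal (h T)

theorem tsum_terminalBound_of_isTerminal [Fintype 𝒳] [Fintype 𝒴] (W : 𝒳 → PMF 𝒴) (t : ℕ)
    {N : P.Node} (ht : N.IsTerminal) :
    ∑' l : List Msg, (if l.length ≤ t then terminalBound W (N.descend l) else 0) ≤
      ENNReal.ofReal (transferBound (N.weight W n)) := by
  rw [tsum_eq_single ([] : List Msg)]
  · simp [descend, terminalBound, ht]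
  · intro l hl
    cases l with
    | nil => exact absurd rfl hl
    | cons a l => simp [descend, child_eq_none_of_isTerminal ht, terminalBound]

/-- The potential is the tension plus `B` per unit of mass for each remaining channel use; it
dominates the total potential of the children. The tree may be infinite, so the induction is on the
depth `t`. The kernel `q` has to be arbitrary: messages keep it, channel uses extend it, and
`transferBound_le_tension` accepts any kernel at a terminal node. -/
theorem tsum_terminalBound_le_of_length_le [Fintype 𝒳] [Fintype 𝒴] [Nonempty 𝒳] {W : 𝒳 → PMF 𝒴} {B : ℝ} (hB : 0 ≤ B)
    (hW : ChannelTensionLE W B) (t : ℕ) (N : P.Node) (i : ℕ) (hi : N.uses = i) (hin : i ≤ n)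
    {Q : Type} [Fintype Q] {q : BitString m × BitString m × (Fin i → 𝒳) → Q → ℝ}
    (hq : ∀ a r, 0 ≤ q a r) (hq1 : ∀ a, ∑ r, q a r = 1) :
    ∑' l : List Msg, (if l.length ≤ t then terminalBound W (N.descend l) else 0) ≤
      ENNReal.ofReal (tension (N.weight W i) q +
        ((n - i : ℕ) : ℝ) * B * ∑ a, ∑ b, N.weight W i a b) := by
  have hmass : ∀ (M : P.Node) j, 0 ≤ ∑ a, ∑ b, M.weight W j a b := fun M j =>
    Finset.sum_nonneg fun a _ => Finset.sum_nonneg fun b _ => M.weight_nonneg W j a b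
  have hten := tension_nonneg (N.weight_nonneg W i) hq hq1
  have hC : ∀ j : ℕ, 0 ≤ ((n - j : ℕ) : ℝ) * B := fun j => by positivity
  by_cases ht : N.IsTerminal
  · have hin' : i = n := hi ▸ ht.1
    subst hin'
    refine (tsum_terminalBound_of_isTerminal W t ht).trans (ENNReal.ofReal_le_ofReal ?_)
    have := transferBound_le_tension (N.weight_nonneg W i) hq hq1
    have := mul_nonneg (hC i) (hmass N i)
    linarith
  induction t generalizing N i Q with
  | zero =>
    refine (tsum_list_le _).trans ?_
    simp [descend, terminalBound, ht]
  | succ t ih =>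
    -- The induction hypothesis freed from the assumption that the node is not terminal.
    have ih' : ∀ (M : P.Node) (j : ℕ), M.uses = j → j ≤ n → ∀ {Q : Type} [Fintype Q]
        {q : BitString m × BitString m × (Fin j → 𝒳) → Q → ℝ}, (∀ a r, 0 ≤ q a r) →
        (∀ a, ∑ r, q a r = 1) →
        ∑' l : List Msg, (if l.length ≤ t then terminalBound W (M.descend l) else 0) ≤
          ENNReal.ofReal (tension (M.weight W j) q +
            ((n - j : ℕ) : ℝ) * B * ∑ a, ∑ b, M.weight W j a b) := by
      intro M j hj hjn Q _ q hq hq1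
      by_cases ht' : M.IsTerminal
      · have hin' : j = n := hj ▸ ht'.1
        subst hin'
        refine (tsum_terminalBound_of_isTerminal W t ht').trans (ENNReal.ofReal_le_ofReal ?_)
        have := transferBound_le_tension (M.weight_nonneg W j) hq hq1
        have := mul_nonneg (hC j) (hmass M j)
        linarith
      · exact ih M j hj hjn hq hq1 (tension_nonneg (M.weight_nonneg W j) hq hq1) ht'
    refine (tsum_list_le _).trans ?_
    simp only [List.length_nil, zero_le, if_true, descend, terminalBound, ht, if_false, zero_add,
      List.length_cons, Nat.add_le_add_iff_right]
    cases hT : P.turn N.uses N.msgs with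
    | alice =>
      have hc : ∀ a, N.child a = some (N.sendA a) := fun a => by simp only [child, hT]
      simp only [hc, Option.bind_some]
      refine (ENNReal.tsum_le_tsum fun a => ih' (N.sendA a) i hi hin hq hq1).trans ?_
      refine tsum_ofReal_le (fun a => add_nonneg
        (tension_nonneg ((N.sendA a).weight_nonneg W i) hq hq1)
        (mul_nonneg (hC i) (hmass _ _))) fun T => ?_
      have hcn : ∀ (c : Msg) (a : BitString m × BitString m × (Fin i → 𝒳)),
          0 ≤ P.lawA.real ((N.sendA c).evA a.1 a.2.1 (List.ofFn a.2.2)) /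
            P.lawA.real (N.evA a.1 a.2.1 (List.ofFn a.2.2)) := fun c a => by positivity
      have hc1 : ∀ a : BitString m × BitString m × (Fin i → 𝒳),
          ∑ c ∈ T, P.lawA.real ((N.sendA c).evA a.1 a.2.1 (List.ofFn a.2.2)) /
            P.lawA.real (N.evA a.1 a.2.1 (List.ofFn a.2.2)) ≤ 1 := fun a => by
        rw [← Finset.sum_div]
        exact div_le_one_of_le₀ (sum_measureReal_inter_fiber_le _ T (N.measurable_evA _ _ _)
          fun c => P.measurable_msgA _ _ _ _ _) measureReal_nonneg
      have hw : ∀ c, (N.sendA c).weight W i = fun a b =>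
          P.lawA.real ((N.sendA c).evA a.1 a.2.1 (List.ofFn a.2.2)) /
            P.lawA.real (N.evA a.1 a.2.1 (List.ofFn a.2.2)) * N.weight W i a b := fun c => by
        ext a b; exact weight_sendA N W i c a b
      simp only [hw, Finset.sum_add_distrib]
      refine add_le_add (sum_tension_left_step T (N.weight_nonneg W i) hq hq1 hcn hc1) ?_
      rw [← Finset.mul_sum]
      refine mul_le_mul_of_nonneg_left ?_ (hC i)
      rw [Finset.sum_comm]
      refine Finset.sum_le_sum fun a _ => ?_
      simp only [← Finset.mul_sum, ← Finset.sum_mul]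
      exact mul_le_of_le_one_left (Finset.sum_nonneg fun b _ => N.weight_nonneg W i a b) (hc1 a)
    | bob =>
      have hc : ∀ a, N.child a = some (N.sendB a) := fun a => by simp only [child, hT]
      simp only [hc, Option.bind_some]
      refine (ENNReal.tsum_le_tsum fun a => ih' (N.sendB a) i hi hin hq hq1).trans ?_
      refine tsum_ofReal_le (fun a => add_nonneg
        (tension_nonneg ((N.sendB a).weight_nonneg W i) hq hq1)
        (mul_nonneg (hC i) (hmass _ _))) fun T => ?_
      have hcn : ∀ (c : Msg) (b : Bool × (Fin i → 𝒴)),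
          0 ≤ P.lawB.real ((N.sendB c).evB b.1 (List.ofFn b.2)) /
            P.lawB.real (N.evB b.1 (List.ofFn b.2)) := fun c a => by positivity
      have hc1 : ∀ b : Bool × (Fin i → 𝒴),
          ∑ c ∈ T, P.lawB.real ((N.sendB c).evB b.1 (List.ofFn b.2)) /
            P.lawB.real (N.evB b.1 (List.ofFn b.2)) ≤ 1 := fun b => by
        rw [← Finset.sum_div]
        exact div_le_one_of_le₀ (sum_measureReal_inter_fiber_le _ T (N.measurable_evB _ _)
          fun c => P.measurable_msgB _ _ _ _) measureReal_nonneg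
      have hw : ∀ c, (N.sendB c).weight W i = fun a b =>
          P.lawB.real ((N.sendB c).evB b.1 (List.ofFn b.2)) /
            P.lawB.real (N.evB b.1 (List.ofFn b.2)) * N.weight W i a b := fun c => by
        ext a b; exact weight_sendB N W i c a b
      simp only [hw, Finset.sum_add_distrib]
      refine add_le_add (sum_tension_right_step T (N.weight_nonneg W i) hq hq1 hcn hc1) ?_
      rw [← Finset.mul_sum]
      refine mul_le_mul_of_nonneg_left ?_ (hC i)
      rw [Finset.sum_comm]
      refine Finset.sum_le_sum fun a _ => ?_
      rw [Finset.sum_comm]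
      refine Finset.sum_le_sum fun b _ => ?_
      rw [← Finset.sum_mul]
      exact mul_le_of_le_one_left (N.weight_nonneg W i a b) (hc1 b)
    | channel =>
      have hlt : N.uses < n := lt_of_le_of_ne (hi ▸ hin) fun h' => ht ⟨h', hT⟩
      have hc : N.child [] = some N.transmit := by simp [child, hT, hlt]
      have hc' : ∀ a, a ≠ [] → N.child a = none := fun a ha => by simp [child, hT, ha]
      rw [tsum_eq_single ([] : Msg) fun a ha => by simp [hc' a ha]]
      simp only [hc, Option.bind_some]
      set c := N.inputKernel i with hcdef
      -- The new auxiliary variable is adapted to the input weight at this very node.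
      obtain ⟨k, q', hq', hq'1, hle⟩ := hW
        (fun x => ∑ a, ∑ b, N.weight W i a b * c a x) fun x =>
          Finset.sum_nonneg fun a _ => Finset.sum_nonneg fun b _ =>
            mul_nonneg (N.weight_nonneg W i a b) (N.inputKernel_nonneg i a x)
      have hstep := tension_channel_step (N.weight_nonneg W i) hq hq1 (N.inputKernel_nonneg i)
        (N.sum_inputKernel i) (fun x y => ENNReal.toReal_nonneg (a := W x y))
        (fun x => sum_toReal_pmf (W x)) hq' hq'1
      have hwt : ∀ (a : (BitString m × BitString m × (Fin i → 𝒳)) × 𝒳)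
          (b : (Bool × (Fin i → 𝒴)) × 𝒴),
          N.transmit.weight W (i + 1) (viewEquivA m i 𝒳 a) (viewEquivB i 𝒴 b) =
            N.weight W i a.1 b.1 * N.inputKernel i a.1 a.2 * (W a.2 b.2).toReal :=
        fun a b => weight_transmit N W i _ _ _ _ _ _ _
      have hsum : ∑ x, ∑ a, ∑ b, N.weight W i a b * c a x = ∑ a, ∑ b, N.weight W i a b := by
        rw [Finset.sum_comm]
        refine Finset.sum_congr rfl fun a _ => ?_
        simp only [← Finset.sum_mul, ← Finset.mul_sum, hcdef, N.sum_inputKernel i a, mul_one]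
      have hmass' : ∑ a, ∑ b, N.transmit.weight W (i + 1) a b = ∑ a, ∑ b, N.weight W i a b := by
        rw [← (viewEquivA m i 𝒳).sum_comp]
        simp only [← (viewEquivB i 𝒴).sum_comp, hwt]
        simp only [Fintype.sum_prod_type (α₁ := Bool × (Fin i → 𝒴)), ← Finset.mul_sum,
          sum_toReal_pmf, mul_one, ← Finset.sum_mul]
        simp only [Fintype.sum_prod_type (α₂ := 𝒳), ← Finset.mul_sum, N.sum_inputKernel i, mul_one]
      refine (ih' N.transmit (i + 1) (by simp [Node.transmit, hi]) (by omega)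
        (Q := Q × Fin k)
        (q := fun a t => q ((viewEquivA m i 𝒳).symm a).1 t.1 * q' ((viewEquivA m i 𝒳).symm a).2 t.2)
        (fun a t => mul_nonneg (hq _ _) (hq' _ _)) (fun a => ?_)).trans ?_
      · simp only [Fintype.sum_prod_type, ← Finset.mul_sum, hq'1, hq1, mul_one]
      refine ENNReal.ofReal_le_ofReal ?_
      rw [hmass', ← tension_comp_equiv (viewEquivA m i 𝒳) (viewEquivB i 𝒴)]
      simp only [hwt, Equiv.symm_apply_apply]
      -- The use just made releases one `B` times the mass, which by `hle` pays for the tension of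
      -- the new input-output pair.
      have hnat : ((n - i : ℕ) : ℝ) = ((n - (i + 1) : ℕ) : ℝ) + 1 := by
        rw [show n - i = n - (i + 1) + 1 by omega]; push_cast; ring
      rw [hsum] at hle
      rw [hnat]
      linarith

end Node

/-- At the root the tension with a constant `Q` is zero and the mass is one, so the potential is `n
* B`. -/
theorem tsum_terminalBound_le [Fintype 𝒳] [Fintype 𝒴] [Nonempty 𝒳] {W : 𝒳 → PMF 𝒴} {B : ℝ}
    (hB : 0 ≤ B) (hW : Node.ChannelTensionLE W B) :
    ∑' l : List Msg, Node.terminalBound W (P.root.descend l) ≤ ENNReal.ofReal (n * B) := by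
  have hroot : ∀ a b, P.root.weight W 0 a b =
      (Fintype.card (BitString m × BitString m × Bool) : ℝ)⁻¹ := by
    intro a b
    simp [Node.weight, root]
  have hq := fun t => Node.tsum_terminalBound_le_of_length_le (P := P) hB hW t P.root 0 rfl
    (Nat.zero_le n) (Q := Unit) (q := fun _ _ => 1) (fun _ _ => zero_le_one) (fun _ => by simp)
  have h0 : tension (P.root.weight W 0) (fun _ (_ : Unit) => 1) = 0 := by
    have := tension_const_of_product
      (fun _ : BitString m × BitString m × (Fin 0 → 𝒳) =>
        (Fintype.card (BitString m × BitString m × Bool) : ℝ)⁻¹)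
      (fun _ : Bool × (Fin 0 → 𝒴) => (1 : ℝ))
    rw [← this]
    congr 1
    ext a b; rw [hroot, mul_one]
  have h1 : ∑ a, ∑ b, P.root.weight W 0 a b = 1 := by
    simp only [hroot, Finset.sum_const, Finset.card_univ, nsmul_eq_mul, Fintype.card_prod,
      Fintype.card_unique, Fintype.card_bool]
    push_cast
    have : (Fintype.card (BitString m) : ℝ) ≠ 0 := by exact_mod_cast Fintype.card_ne_zero
    field_simp
  rw [ENNReal.tsum_eq_iSup_sum]
  refine iSup_le fun T => ?_
  -- A depth that contains all paths of the finite set `T`.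
  have := hq (T.sup List.length)
  rw [h0, h1, Nat.sub_zero, zero_add, mul_one] at this
  refine le_trans ?_ this
  refine le_trans (le_of_eq ?_) (ENNReal.sum_le_tsum T)
  exact Finset.sum_congr rfl fun l hl => (if_pos (Finset.le_sup hl)).symm

end OTProtocol

/-! ### The law of the end of an execution -/

/-- The noise at inputs that are not used sums out to one, by two exchanges of product and sum. -/
theorem channelNoise_apply {𝒳 : Type u} {𝒴 : Type v} [Fintype 𝒳] [Fintype 𝒴]
    (W : 𝒳 → PMF 𝒴) (n : ℕ) (x : Fin n → 𝒳) (y : Fin n → 𝒴) :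
    (channelNoise W n).toMeasure {z | ∀ i, z.out i (x i) = y i} = ∏ i, W (x i) (y i) := by
  classical
  have h1 : ∀ x, ∑ y, W x y = 1 := fun x => by
    rw [← tsum_fintype (L := .unconditional _)]; exact (W x).tsum_coe
  have h2 : ∀ (x : 𝒳) (y : 𝒴),
      ∑ g : 𝒳 → 𝒴, (if g x = y then ∏ x', W x' (g x') else 0) = W x y := by
    intro x y
    have : ∀ g : 𝒳 → 𝒴, (if g x = y then ∏ x', W x' (g x') else 0) =
        ∏ x', if x' = x then (if g x' = y then W x' (g x') else 0) else W x' (g x') := by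
      intro g
      split_ifs with h
      · refine Finset.prod_congr rfl fun x' _ => ?_
        split_ifs with h1 h2
        · rfl
        · exact absurd (h1 ▸ h) h2
        · rfl
      · exact (Finset.prod_eq_zero (Finset.mem_univ x) (by simp [h])).symm
    simp only [this]
    rw [← Fintype.prod_sum (fun x' b => if x' = x then (if b = y then W x' b else 0) else W x' b),
      Finset.prod_eq_single x]
    · simp
    · intro b _ hb; simp [hb, h1]
    · simp
  rw [PMF.toMeasure_apply_fintype]
  rw [← (channelNoiseEquiv 𝒳 𝒴 n).sum_comp]
  have h3 : ∀ g : Fin n → 𝒳 → 𝒴, Set.indicator {z | ∀ i, z.out i (x i) = y i} (channelNoise W n)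
      (channelNoiseEquiv 𝒳 𝒴 n g) =
      ∏ i, if g i (x i) = y i then ∏ x', W x' (g i x') else 0 := by
    intro g
    by_cases h : ∀ i, g i (x i) = y i
    · rw [Set.indicator_of_mem (by exact h)]
      simp only [h, if_true]
      rfl
    · rw [Set.indicator_of_notMem (by exact h)]
      push Not at h
      obtain ⟨i, hi⟩ := h
      exact (Finset.prod_eq_zero (Finset.mem_univ i) (by simp [hi])).symm
  simp only [h3]
  rw [← Fintype.prod_sum (fun i (b : 𝒳 → 𝒴) => if b (x i) = y i then ∏ x', W x' (b x') else 0)]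
  simp only [h2]

/-! ### Product form of the end events and the sum over transcripts -/

namespace OTProtocol

variable {𝒳 : Type u} {𝒴 : Type v} {n m : ℕ} (P : OTProtocol.{u, v, w} 𝒳 𝒴 n m)

-- Membership constrains the strings and the bit, Alice's randomness, Bob's randomness and the noise
-- separately. On this rectangle the product law can be evaluated.
variable {P} in
theorem Node.setOf_mem_eq {N : P.Node} (hN : N.uses = n) (x : Fin n → 𝒳) (y : Fin n → 𝒴)
    (s : BitString m × BitString m × Bool) :
    {ω | N.Mem ω (List.ofFn x) (List.ofFn y) ∧ ω.1 = s} =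
      {s} ×ˢ ((N.evA s.1 s.2.1 (List.ofFn x) ×ˢ N.evB s.2.2 (List.ofFn y)) ×ˢ
        {z | ∀ i, z.out i (x i) = y i}) := by
  ext ω
  simp only [mem_prod, mem_singleton_iff, mem_ofPred_eq]
  constructor
  · rintro ⟨⟨h1, h2, h3, h4, h5⟩, rfl⟩
    refine ⟨rfl, ⟨h1, h2⟩, fun i => h5 i (x i) (y i) ?_ ?_⟩ <;> simp
  · rintro ⟨rfl, ⟨h1, h2⟩, h3⟩
    refine ⟨⟨h1, h2, by simp [hN], by simp [hN], fun i a b ha hb => ?_⟩, rfl⟩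
    simp only [List.getElem?_ofFn, i.2, dif_pos, Fin.eta, Option.some.injEq] at ha hb
    rw [← ha, ← hb, h3 i]

variable [Fintype 𝒳] [Fintype 𝒴] (W : 𝒳 → PMF 𝒴)

instance : IsProbabilityMeasure (P.law W) := by
  unfold law; infer_instance

theorem law_real_rectangle (s : BitString m × BitString m × Bool) (A : Set P.RA) (B : Set P.RB)
    (x : Fin n → 𝒳) (y : Fin n → 𝒴) :
    (P.law W).real ({s} ×ˢ ((A ×ˢ B) ×ˢ {z | ∀ i, z.out i (x i) = y i})) =
      (Fintype.card (BitString m × BitString m × Bool) : ℝ)⁻¹ * P.lawA.real A * P.lawB.real B *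
        ∏ j, (W (x j) (y j)).toReal := by
  simp only [Measure.real, law, Measure.prod_prod, ENNReal.toReal_mul, channelNoise_apply,
    ENNReal.toReal_prod]
  rw [PMF.toMeasure_apply_singleton _ _ (MeasurableSet.singleton s), PMF.uniformOfFintype_apply]
  simp only [ENNReal.toReal_inv, ENNReal.toReal_natCast]
  ring

/-- The event that the execution ends with given messages, inputs and outputs, for given strings
and a given bit. -/
def endEvent (f : List Msg) (xs : List 𝒳) (ys : List 𝒴) (s : BitString m × BitString m × Bool) :
    Set P.Sample :=
  {ω | P.F ω = f ∧ P.Xn ω = xs ∧ P.Yn ω = ys ∧ ω.1 = s}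

/-- The law of the transcript, the channel inputs and outputs, the strings and the bit. -/
noncomputable def endWeight (f : List Msg) (a : BitString m × BitString m × (Fin n → 𝒳))
    (b : Bool × (Fin n → 𝒴)) : ℝ :=
  (P.law W).real (P.endEvent f (List.ofFn a.2.2) (List.ofFn b.2) (a.1, a.2.1, b.1))

variable {P W}

section Ends

variable (hend : ∀ᵐ ω ∂P.law W, ∃ t, P.Ended (P.stateAt ω t))
include hend

theorem ae_length : ∀ᵐ ω ∂P.law W, (P.Xn ω).length = n ∧ (P.Yn ω).length = n := by
  filter_upwards [hend] with ω ⟨t, ht⟩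
  obtain ⟨l, N, -, h2, -, h4⟩ := exists_terminal_of_ended ht
  exact ⟨h4.2.2.1.trans h2.1, h4.2.2.2.1.trans h2.1⟩

/-- Almost every execution ends at a terminal node, and by `descend_injective` the transcript tells
which one. -/
theorem endEvent_ae_eq_of_terminal {l : List Msg} {N : P.Node}
    (hl : P.root.descend l = some N) (ht : N.IsTerminal) (xs : List 𝒳) (ys : List 𝒴) (s) :
    P.endEvent N.msgs xs ys s =ᵐ[P.law W] {ω | N.Mem ω xs ys ∧ ω.1 = s} := by
  filter_upwards [hend] with ω ⟨t, hω⟩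
  refine propext ⟨?_, ?_⟩
  · rintro ⟨h1, rfl, rfl, h4⟩
    obtain ⟨l', N', h5, h6, h7, h8⟩ := exists_terminal_of_ended hω
    have := Node.descend_injective hl h5 ht h6 (by rw [h7, h1])
    subst this
    rw [hl, Option.some.injEq] at h5
    subst h5
    exact ⟨h8, h4⟩
  · rintro ⟨h1, h2⟩
    have := final_of_mem_terminal hl ht h1
    exact ⟨by simp [F, this], by simp [Xn, this], by simp [Yn, this], h2⟩

theorem endEvent_ae_eq_empty {f : List Msg}
    (hf : ¬ ∃ l N, P.root.descend l = some N ∧ N.IsTerminal ∧ N.msgs = f) (xs : List 𝒳)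
    (ys : List 𝒴) (s) : P.endEvent f xs ys s =ᵐ[P.law W] (∅ : Set P.Sample) := by
  filter_upwards [hend] with ω ⟨t, hω⟩
  refine propext ⟨fun h => ?_, fun h => h.elim⟩
  obtain ⟨l', N', h5, h6, h7, h8⟩ := exists_terminal_of_ended hω
  exact hf ⟨l', N', h5, h6, by rw [h7, h.1]⟩

theorem endWeight_of_terminal {l : List Msg} {N : P.Node}
    (hl : P.root.descend l = some N) (ht : N.IsTerminal) :
    P.endWeight W N.msgs = N.weight W n := by
  ext a b
  rw [endWeight, measureReal_congr (endEvent_ae_eq_of_terminal hend hl ht _ _ _),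
    Node.setOf_mem_eq ht.1, law_real_rectangle]
  rfl

theorem endWeight_eq_zero {f : List Msg}
    (hf : ¬ ∃ l N, P.root.descend l = some N ∧ N.IsTerminal ∧ N.msgs = f) :
    P.endWeight W f = fun _ _ => 0 := by
  ext a b
  rw [endWeight, measureReal_congr (endEvent_ae_eq_empty hend hf _ _ _), measureReal_empty]

theorem nullMeasurableSet_endEvent (f : List Msg) (xs : List 𝒳) (ys : List 𝒴) (s) :
    NullMeasurableSet (P.endEvent f xs ys s) (P.law W) := by
  by_cases hlen : xs.length = n ∧ ys.length = n
  · by_cases hf : ∃ l N, P.root.descend l = some N ∧ N.IsTerminal ∧ N.msgs = f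
    · obtain ⟨l, N, hl, ht, rfl⟩ := hf
      refine NullMeasurableSet.congr (MeasurableSet.nullMeasurableSet ?_)
        (endEvent_ae_eq_of_terminal hend hl ht xs ys s).symm
      obtain ⟨hx, hy⟩ := hlen
      obtain ⟨x, rfl⟩ : ∃ x : Fin n → 𝒳, xs = List.ofFn x := by
        subst hx; exact ⟨_, (List.ofFn_get xs).symm⟩
      obtain ⟨y, rfl⟩ : ∃ y : Fin n → 𝒴, ys = List.ofFn y := by
        subst hy; exact ⟨_, (List.ofFn_get ys).symm⟩
      rw [Node.setOf_mem_eq ht.1]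
      exact (MeasurableSet.singleton s).prod
        (((N.measurable_evA _ _ _).prod (N.measurable_evB _ _)).prod (by trivial))
    · exact NullMeasurableSet.congr MeasurableSet.empty.nullMeasurableSet
        (endEvent_ae_eq_empty hend hf xs ys s).symm
  · refine NullMeasurableSet.congr MeasurableSet.empty.nullMeasurableSet (Filter.EventuallyEq.symm ?_)
    filter_upwards [ae_length hend] with ω hω
    refine propext ⟨fun h => ?_, fun h => h.elim⟩
    obtain ⟨-, rfl, rfl, -⟩ := h
    exact hlen hω

/-- Any event about the end of the execution is measurable up to a null set. -/
theorem nullMeasurableSet_end (C : List Msg → List 𝒳 → List 𝒴 →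
    (BitString m × BitString m × Bool) → Set P.Sample)
    (hC : ∀ f xs ys s, MeasurableSet (C f xs ys s)) :
    NullMeasurableSet {ω | ω ∈ C (P.F ω) (P.Xn ω) (P.Yn ω) ω.1} (P.law W) := by
  have : {ω | ω ∈ C (P.F ω) (P.Xn ω) (P.Yn ω) ω.1} =
      ⋃ z : List Msg × List 𝒳 × List 𝒴 × (BitString m × BitString m × Bool),
        P.endEvent z.1 z.2.1 z.2.2.1 z.2.2.2 ∩ C z.1 z.2.1 z.2.2.1 z.2.2.2 := by
    ext ω
    simp only [mem_ofPred_eq, mem_iUnion, mem_inter_iff, endEvent, Prod.exists]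
    constructor
    · intro h; exact ⟨_, _, _, _, _, _, ⟨rfl, rfl, rfl, rfl⟩, h⟩
    · rintro ⟨f, xs, ys, s₀, s₁, k, ⟨rfl, rfl, rfl, h⟩, h'⟩
      rw [h]; exact h'
  rw [this]
  exact NullMeasurableSet.iUnion fun z =>
    (nullMeasurableSet_endEvent hend _ _ _ _).inter (hC _ _ _ _).nullMeasurableSet

open Classical in
/-- Events about the end of the execution are finite unions of the events `endEvent`. -/
theorem real_end_eq_sum (f : List Msg)
    (C : List 𝒳 → List 𝒴 → (BitString m × BitString m × Bool) → Prop) :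
    (P.law W).real {ω | P.F ω = f ∧ C (P.Xn ω) (P.Yn ω) ω.1} =
      ∑ a, ∑ b, if C (List.ofFn a.2.2) (List.ofFn b.2) (a.1, a.2.1, b.1) then
        P.endWeight W f a b else 0 := by
  rw [← Fintype.sum_prod_type', ← Finset.sum_filter]
  unfold endWeight
  rw [← measureReal_biUnion_finset₀]
  · refine measureReal_congr ?_
    filter_upwards [ae_length hend] with ω ⟨hx, hy⟩
    refine propext ⟨?_, ?_⟩
    · rintro ⟨h1, h2⟩
      obtain ⟨x, hx'⟩ : ∃ x : Fin n → 𝒳, P.Xn ω = List.ofFn x := by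
        rw [← List.ofFn_get (P.Xn ω)]
        generalize P.Xn ω = xs at hx
        subst hx; exact ⟨_, rfl⟩
      obtain ⟨y, hy'⟩ : ∃ y : Fin n → 𝒴, P.Yn ω = List.ofFn y := by
        rw [← List.ofFn_get (P.Yn ω)]
        generalize P.Yn ω = ys at hy
        subst hy; exact ⟨_, rfl⟩
      refine mem_iUnion₂.2 ⟨((ω.1.1, ω.1.2.1, x), (ω.1.2.2, y)), ?_, h1, hx', hy', rfl⟩
      rw [hx', hy'] at h2
      simpa using h2
    · intro h
      obtain ⟨⟨a, b⟩, h1, h2, h3, h4, h5⟩ := mem_iUnion₂.1 h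
      refine ⟨h2, ?_⟩
      rw [h3, h4, h5]
      simpa using h1
  · rintro ⟨⟨s₀, s₁, x⟩, k, y⟩ _ ⟨⟨s₀', s₁', x'⟩, k', y'⟩ _ hne
    refine (Set.disjoint_left.2 fun ω h h' => hne ?_).aedisjoint
    obtain ⟨-, h3, h4, h5⟩ := h
    obtain ⟨-, h3', h4', h5'⟩ := h'
    have hx := List.ofFn_injective (h3.symm.trans h3')
    have hy := List.ofFn_injective (h4.symm.trans h4')
    have hs := h5.symm.trans h5'
    simp only [Prod.mk.injEq] at hs hx hy ⊢
    exact ⟨⟨hs.1, hs.2.1, hx⟩, hs.2.2, hy⟩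
  · exact fun z _ => nullMeasurableSet_endEvent hend _ _ _ _

theorem sum_sum_endWeight (f : List Msg) :
    ∑ a, ∑ b, P.endWeight W f a b = (P.law W).real {ω | P.F ω = f} := by
  have := real_end_eq_sum hend f fun _ _ _ => True
  simp only [and_true, if_true] at this
  exact this.symm

theorem nullMeasurableSet_F (f : List Msg) : NullMeasurableSet {ω | P.F ω = f} (P.law W) := by
  have := nullMeasurableSet_end hend (fun g _ _ _ => {_ω | g = f})
    fun g _ _ _ => MeasurableSet.const _
  exact this

/-- Summing, over a finite set of transcripts, the probabilities of events. -/
theorem sum_real_F_inter_le (T : Finset (List Msg)) {E : Set P.Sample}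
    (hE : NullMeasurableSet E (P.law W)) :
    ∑ f ∈ T, (P.law W).real ({ω | P.F ω = f} ∩ E) ≤ (P.law W).real E := by
  rw [← measureReal_biUnion_finset₀]
  · exact measureReal_mono (iUnion₂_subset fun i _ => inter_subset_right)
  · intro f _ g _ hfg
    refine (Set.disjoint_left.2 fun ω h h' => hfg ?_).aedisjoint
    exact h.1.symm.trans h'.1
  · exact fun f _ => (nullMeasurableSet_F hend f).inter hE

theorem sum_mass_endWeight_le (T : Finset (List Msg)) :
    ∑ f ∈ T, ∑ a, ∑ b, P.endWeight W f a b ≤ 1 := by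
  have := sum_real_F_inter_le hend T (E := univ) MeasurableSet.univ.nullMeasurableSet
  simpa [sum_sum_endWeight hend] using this

theorem summable_mass_endWeight : Summable fun f => ∑ a, ∑ b, P.endWeight W f a b :=
  summable_of_sum_le (fun _ => Finset.sum_nonneg fun _ _ => Finset.sum_nonneg fun _ _ =>
    measureReal_nonneg) (sum_mass_endWeight_le hend)

/-- Transcripts of positive probability correspond to distinct terminal paths, so the sum over
transcripts is part of the sum over the tree; other transcripts have zero weight. -/
theorem sum_transferBound_endWeight_le [Nonempty 𝒳] {B : ℝ} (hB : 0 ≤ B)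
    (hW : Node.ChannelTensionLE W B) (T : Finset (List Msg)) :
    ∑ f ∈ T, transferBound (P.endWeight W f) ≤ n * B := by
  set 𝓕 : Set (List Msg) := {f | ∃ l N, P.root.descend l = some N ∧ N.IsTerminal ∧ N.msgs = f}
    with h𝓕
  choose! l N hl ht hN using fun (f : List Msg) (hf : f ∈ 𝓕) => hf
  have hinj : Function.Injective fun f : 𝓕 => l f := by
    rintro ⟨f, hf⟩ ⟨g, hg⟩ h
    have h1 := hl f hf
    have h2 := hl g hg
    simp only at h
    rw [h, h2, Option.some.injEq] at h1
    have h3 := hN f hf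
    have h4 := hN g hg
    rw [← h1] at h3
    exact Subtype.ext (h3.symm.trans h4)
  have h1 : ∑' f, ENNReal.ofReal (transferBound (P.endWeight W f)) ≤
      ∑' l : List Msg, Node.terminalBound W (P.root.descend l) := by
    refine le_trans (le_of_eq ?_) (ENNReal.tsum_comp_le_tsum_of_injective hinj _)
    rw [← tsum_subtype_eq_of_support_subset (s := 𝓕)]
    · refine tsum_congr fun f => ?_
      rw [hl f f.2]
      simp only [Node.terminalBound, ht f f.2, if_true]
      rw [← endWeight_of_terminal hend (hl f f.2) (ht f f.2), hN f f.2]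
    · intro f hf
      by_contra hf'
      rw [Function.mem_support, endWeight_eq_zero hend hf', transferBound_zero] at hf
      simp at hf
  have h2 := (ENNReal.sum_le_tsum T).trans (h1.trans (tsum_terminalBound_le (P := P) hB hW))
  have h3 := ENNReal.toReal_mono ENNReal.ofReal_ne_top h2
  rw [ENNReal.toReal_ofReal (by positivity), ENNReal.toReal_sum fun _ _ => ENNReal.ofReal_ne_top]
    at h3
  refine (Finset.sum_le_sum fun f _ => ?_).trans h3
  -- A real number is at most its positive part.
  rw [ENNReal.toReal_ofReal']
  exact le_max_left _ _

end Ends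

end OTProtocol

/-! ### Entropies of the ends of the executions -/

section CondEntropy

variable {Ω α β : Type*} {mΩ : MeasurableSpace Ω} {μ : Measure Ω}

theorem mul_sum_negMulLog_div [Fintype β] {v : β → ℝ} {s : ℝ} (hv : ∀ b, 0 ≤ v b)
    (hs : ∑ b, v b = s) : s * ∑ b, Real.negMulLog (v b / s) = massEntropy v := by
  rcases eq_or_ne s 0 with rfl | h
  · have h0 : v = fun _ => 0 := by
      ext b
      exact (Finset.sum_eq_zero_iff_of_nonneg fun b _ => hv b).1 hs b (Finset.mem_univ b)
    rw [h0, massEntropy_zero, zero_mul]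
  · have h1 : massEntropy v = s * massEntropy fun b => v b / s := by
      rw [← massEntropy_smul]
      congr 1; ext b; field_simp
    rw [h1, massEntropy, ← Finset.sum_div, hs, div_self h, Real.negMulLog_one, sub_zero]

theorem condEntropy_mul_log [Countable α] [Fintype β] {A : Ω → α} {B : Ω → β}
    (h : ∀ a, ∑ b, μ.real {ω | A ω = a ∧ B ω = b} = μ.real {ω | A ω = a}) :
    condEntropy μ B A * Real.log 2 = ∑' a, massEntropy fun b => μ.real {ω | A ω = a ∧ B ω = b} := by
  have h2 : Real.log 2 ≠ 0 := (Real.log_pos one_lt_two).ne'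
  unfold condEntropy
  rw [← tsum_mul_right]
  refine tsum_congr fun a => ?_
  rw [← mul_sum_negMulLog_div (fun b => measureReal_nonneg) (h a), ← Finset.sum_div]
  field_simp

theorem sum_real_and_fiber [Fintype β] [IsFiniteMeasure μ] {A : Ω → α} {B : Ω → β} (a : α)
    (h : ∀ b, NullMeasurableSet {ω | A ω = a ∧ B ω = b} μ) :
    ∑ b, μ.real {ω | A ω = a ∧ B ω = b} = μ.real {ω | A ω = a} := by
  rw [← measureReal_biUnion_finset₀]
  · congr 1
    ext ω; simp
  · intro b _ b' _ hne
    exact (Set.disjoint_left.2 fun ω h h' => hne (h.2.symm.trans h'.2)).aedisjoint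
  · exact fun b _ => h b

theorem tsum_prod_fintype {ι : Type*} [Fintype ι] {h : α × ι → ℝ} (h0 : ∀ z, 0 ≤ h z)
    (hs : Summable fun a => ∑ i, h (a, i)) : ∑' z, h z = ∑' a, ∑ i, h (a, i) := by
  have hsum : Summable h := (summable_prod_of_nonneg h0).2
    ⟨fun a => (hasSum_fintype _).summable, by simpa only [tsum_fintype] using hs⟩
  rw [hsum.tsum_prod]
  simp only [tsum_fintype]

theorem massEntropy_const [Fintype β] [Nonempty β] (c : ℝ) :
    massEntropy (fun _ : β => c) = c * (Fintype.card β * Real.log (Fintype.card β)) := by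
  have := massEntropy_smul c fun _ : β => (1 : ℝ)
  simp only [mul_one] at this
  rw [this]
  simp [massEntropy, Real.negMulLog]

/-- Fano's inequality for one row. -/
theorem massEntropy_le_of_guess [Fintype β] {v : β → ℝ} (hv : ∀ b, 0 ≤ v b) (b₀ : β) :
    massEntropy v ≤ (∑ b, v b) * Real.log 2 +
      (∑ b, v b - v b₀) * Real.log (Fintype.card β) := by
  classical
  have h1 : ∀ b, 0 ≤ if b = b₀ then v b else 0 := fun b => by split_ifs <;> simp [hv]
  have h2 : ∀ b, 0 ≤ if b = b₀ then 0 else v b := fun b => by split_ifs <;> simp [hv]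
  -- The entry at the guess alone has no entropy; the other entries have at most `log |β|` per unit
  -- of mass.
  have h3 := massEntropy_add_le_add h1 h2
  have h4 : (fun b => (if b = b₀ then v b else 0) + if b = b₀ then 0 else v b) = v := by
    ext b; split_ifs <;> simp
  have h5 : massEntropy (fun b => if b = b₀ then v b else 0) = 0 := by
    have : ∀ b, Real.negMulLog (if b = b₀ then v b else 0) =
        if b = b₀ then Real.negMulLog (v b) else 0 := fun b => by split_ifs <;> simp
    simp [massEntropy, this]
  have h6 := massEntropy_le_log_card h2
  have h7 : ∑ b, (if b = b₀ then 0 else v b) = ∑ b, v b - v b₀ := by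
    rw [eq_sub_iff_add_eq]
    have : ∑ b, (if b = b₀ then v b else 0) = v b₀ := by simp
    rw [← this, ← Finset.sum_add_distrib]
    refine Finset.sum_congr rfl fun b _ => ?_
    split_ifs <;> simp
  rw [← Finset.sum_add_distrib, h4, h5] at h3
  rw [h7] at h6
  linarith

/-- A form of Pinsker's inequality for a bit. -/
theorem abs_sub_le_of_massEntropy {x y δ : ℝ} (hx : 0 ≤ x) (hy : 0 ≤ y) (hδ : 0 < δ) :
    |x - y| ≤ ((x + y) * Real.log 2 - massEntropy fun b : Bool => if b then y else x) / δ +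
      δ * (x + y) := by
  set h := Real.sqrt ((x + y) / 2) with hh
  -- `h` is the square root of the value that `x` and `y` would have for a fair bit.
  have hs : h ^ 2 = (x + y) / 2 := Real.sq_sqrt (by positivity)
  have key : ∀ z, 0 ≤ z → z ≤ x + y →
      2 * z - 2 * (Real.sqrt z * h) ≤ z * (Real.log z + Real.log 2 - Real.log (x + y)) := by
    intro z hz hz'
    rcases hz.eq_or_lt with rfl | hz
    · simp
    · have hxy : 0 < x + y := hz.trans_le hz'
      have hz0 : 0 < Real.sqrt z := Real.sqrt_pos.2 hz
      have hh0 : 0 < h := Real.sqrt_pos.2 (by positivity)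
      have h1 := Real.log_le_sub_one_of_pos (x := h / Real.sqrt z) (by positivity)
      rw [Real.log_div hh0.ne' hz0.ne', Real.log_sqrt hz.le, hh, Real.log_sqrt (by positivity),
        Real.log_div hxy.ne' two_ne_zero, ← hh] at h1
      have h2 := mul_le_mul_of_nonneg_left h1 hz.le
      have h3 : z * (h / Real.sqrt z - 1) = Real.sqrt z * h - z := by
        have : z = Real.sqrt z * Real.sqrt z := (Real.mul_self_sqrt hz.le).symm
        rw [mul_sub, mul_one]
        congr 1
        rw [mul_div_assoc', div_eq_iff hz0.ne']
        nlinarith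
      rw [h3] at h2
      linarith
  have kx := key x hx (by linarith)
  have ky := key y hy (by linarith)
  have hgap : (x + y) * Real.log 2 - massEntropy (fun b : Bool => if b then y else x) =
      x * (Real.log x + Real.log 2 - Real.log (x + y)) +
        y * (Real.log y + Real.log 2 - Real.log (x + y)) := by
    simp [massEntropy, Real.negMulLog]
    rw [add_comm y x]
    ring
  rw [hgap]
  set g := x * (Real.log x + Real.log 2 - Real.log (x + y)) +
        y * (Real.log y + Real.log 2 - Real.log (x + y))
  have hx2 := Real.sq_sqrt hx
  have hy2 := Real.sq_sqrt hy
  -- The entropy deficit dominates a squared Hellinger distance.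
  have hg : (Real.sqrt x - Real.sqrt y) ^ 2 / 2 ≤ g := by
    nlinarith [sq_nonneg (Real.sqrt x - h + (Real.sqrt y - h))]
  -- `x - y` is `√x - √y` times `√x + √y`, and the arithmetic-geometric mean inequality with
  -- parameter `δ` separates the factors. Unlike the square-root form of Pinsker's inequality, the
  -- outcome is linear in the weight for fixed `δ` and can be summed over transcripts.
  have habs : ∀ e : ℝ, e = 1 ∨ e = -1 → e * (x - y) ≤ g / δ + δ * (x + y) := by
    intro e he
    have he2 : e ^ 2 = 1 := by rcases he with rfl | rfl <;> norm_num
    have h5 : e * (x - y) * δ ≤ g + δ ^ 2 * (x + y) := by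
      have h6 : e * (x - y) * δ =
          e * (Real.sqrt x - Real.sqrt y) * (δ * (Real.sqrt x + Real.sqrt y)) := by
        linear_combination (e * δ) * (hy2 - hx2)
      have h7 : (δ * (Real.sqrt x + Real.sqrt y)) ^ 2 ≤ δ ^ 2 * (2 * (x + y)) := by
        rw [mul_pow]
        refine mul_le_mul_of_nonneg_left ?_ (sq_nonneg δ)
        nlinarith [sq_nonneg (Real.sqrt x - Real.sqrt y)]
      have h8 := sq_nonneg (e * (Real.sqrt x - Real.sqrt y) - δ * (Real.sqrt x + Real.sqrt y))
      have h9 : (e * (Real.sqrt x - Real.sqrt y)) ^ 2 = (Real.sqrt x - Real.sqrt y) ^ 2 := by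
        rw [mul_pow, he2, one_mul]
      nlinarith
    have : g / δ + δ * (x + y) = (g + δ ^ 2 * (x + y)) / δ := by field_simp
    rw [this, le_div_iff₀ hδ]
    exact h5
  rw [abs_le]
  constructor
  · have := habs (-1) (Or.inr rfl); linarith
  · have := habs 1 (Or.inl rfl); linarith

end CondEntropy

/-! ### The security conditions as sums over transcripts -/

namespace OTProtocol

variable {𝒳 : Type u} {𝒴 : Type v} {n m : ℕ} {P : OTProtocol.{u, v, w} 𝒳 𝒴 n m}

theorem measurableSet_strings (C : BitString m × BitString m × Bool → Prop) :
    MeasurableSet {ω : P.Sample | C ω.1} :=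
  measurable_fst (Set.toFinite {s | C s}).measurableSet

variable [Fintype 𝒳] [Fintype 𝒴] {W : 𝒳 → PMF 𝒴}

open Classical in
theorem real_strings (C : BitString m × BitString m × Bool → Prop) :
    (P.law W).real {ω | C ω.1} =
      ∑ s, if C s then (Fintype.card (BitString m × BitString m × Bool) : ℝ)⁻¹ else 0 := by
  have h1 : ∀ s, (P.law W).real {ω | ω.1 = s} =
      (Fintype.card (BitString m × BitString m × Bool) : ℝ)⁻¹ := by
    intro s
    have : {ω : P.Sample | ω.1 = s} = {s} ×ˢ univ := by ext ω; simp
    rw [this]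
    simp only [Measure.real, law, Measure.prod_prod, measure_univ, mul_one]
    rw [PMF.toMeasure_apply_singleton _ _ (MeasurableSet.singleton s), PMF.uniformOfFintype_apply]
    simp
  rw [← Finset.sum_filter, ← Finset.sum_congr rfl fun s _ => h1 s, ← measureReal_biUnion_finset]
  · congr 1; ext ω; simp
  · intro s _ s' _ hne
    exact Set.disjoint_left.2 fun ω h h' => hne (h.symm.trans h')
  · intro s _
    exact measurable_fst (MeasurableSet.singleton s)

theorem card_strings : (Fintype.card (BitString m) : ℝ) = 2 ^ m := by
  simp

theorem log_card_strings : Real.log (Fintype.card (BitString m)) = m * Real.log 2 := by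
  rw [card_strings, Real.log_pow]

theorem condEntropy_unchosen_K : condEntropy (P.law W) P.unchosen P.K = m := by
  have hL : Real.log 2 ≠ 0 := (Real.log_pos one_lt_two).ne'
  have h := condEntropy_mul_log (μ := P.law W) (A := P.K) (B := P.unchosen) fun k =>
    sum_real_and_fiber k fun τ => (measurableSet_strings fun s =>
      s.2.2 = k ∧ (if s.2.2 then s.1 else s.2.1) = τ).nullMeasurableSet
  have h1 : ∀ k τ, (P.law W).real {ω | P.K ω = k ∧ P.unchosen ω = τ} =
      (Fintype.card (BitString m) : ℝ) *
        (Fintype.card (BitString m × BitString m × Bool) : ℝ)⁻¹ := by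
    classical
    intro k τ
    refine (real_strings fun s => s.2.2 = k ∧ (if s.2.2 then s.1 else s.2.1) = τ).trans ?_
    simp only [Fintype.sum_prod_type, Fintype.sum_bool]
    cases k
    · simp
    · simp
  simp only [h1, massEntropy_const, tsum_fintype, Fintype.sum_bool] at h
  rw [log_card_strings] at h
  apply mul_right_cancel₀ hL
  rw [h]
  have hc : (Fintype.card (BitString m) : ℝ) ≠ 0 := by exact_mod_cast Fintype.card_ne_zero
  simp only [Fintype.card_prod, Fintype.card_bool]
  push_cast
  field_simp
  ring

theorem condEntropy_K_strings :
    condEntropy (P.law W) P.K (fun ω => (P.S₀ ω, P.S₁ ω)) = 1 := by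
  have hL : Real.log 2 ≠ 0 := (Real.log_pos one_lt_two).ne'
  have h := condEntropy_mul_log (μ := P.law W) (A := fun ω => (P.S₀ ω, P.S₁ ω)) (B := P.K)
    fun a => sum_real_and_fiber a fun k => (measurableSet_strings fun s =>
      (s.1, s.2.1) = a ∧ s.2.2 = k).nullMeasurableSet
  have h1 : ∀ a k, (P.law W).real {ω | (P.S₀ ω, P.S₁ ω) = a ∧ P.K ω = k} =
      (Fintype.card (BitString m × BitString m × Bool) : ℝ)⁻¹ := by
    classical
    rintro ⟨a, b⟩ k
    refine (real_strings fun s => (s.1, s.2.1) = (a, b) ∧ s.2.2 = k).trans ?_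
    rw [Finset.sum_eq_single (a, b, k)]
    · simp
    · rintro ⟨a', b', k'⟩ _ hne
      rw [if_neg]
      rintro ⟨h1, rfl⟩
      simp only [Prod.mk.injEq] at h1
      exact hne (by rw [h1.1, h1.2])
    · simp
  simp only [h1, massEntropy_const, tsum_fintype] at h
  apply mul_right_cancel₀ hL
  rw [h]
  have hc : (Fintype.card (BitString m) : ℝ) ≠ 0 := by exact_mod_cast Fintype.card_ne_zero
  simp only [Finset.sum_const, Finset.card_univ, nsmul_eq_mul, Fintype.card_prod,
    Fintype.card_bool]
  push_cast
  field_simp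

theorem endWeight_nonneg (f : List Msg) (a) (b) : 0 ≤ P.endWeight W f a b := measureReal_nonneg

section Ends

variable (hend : ∀ᵐ ω ∂P.law W, ∃ t, P.Ended (P.stateAt ω t))
include hend

theorem real_unchosen_eq (f : List Msg) (k : Bool) (y : Fin n → 𝒴) (τ : BitString m) :
    (P.law W).real {ω | ((P.F ω, P.Yn ω), P.K ω) = ((f, List.ofFn y), k) ∧ P.unchosen ω = τ} =
      pickWeight (P.endWeight W f) (!k) (k, y) τ := by
  classical
  have h := real_end_eq_sum hend f fun _ ys s =>
    ys = List.ofFn y ∧ s.2.2 = k ∧ (if s.2.2 then s.1 else s.2.1) = τ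
  have h' : {ω | ((P.F ω, P.Yn ω), P.K ω) = ((f, List.ofFn y), k) ∧ P.unchosen ω = τ} =
      {ω | P.F ω = f ∧ P.Yn ω = List.ofFn y ∧ ω.1.2.2 = k ∧
        (if ω.1.2.2 then ω.1.1 else ω.1.2.1) = τ} := by
    ext ω
    simp only [Prod.mk.injEq, mem_ofPred_eq, and_assoc]
    rfl
  rw [h', h]
  refine Finset.sum_congr rfl fun a _ => ?_
  rw [Finset.sum_eq_single (k, y)]
  · cases k <;> simp [pick]
  · rintro ⟨k', y'⟩ _ hne
    rw [if_neg]
    rintro ⟨h1, h2, -⟩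
    exact hne (Prod.ext h2 (List.ofFn_injective h1))
  · simp

/-- The sum over Bob's views is regrouped by transcript. Output sequences of a length other than `n`
have probability zero, and domination by the mass times `log |S|` gives the summability. -/
theorem condEntropy_unchosen_F :
    condEntropy (P.law W) P.unchosen (fun ω => ((P.F ω, P.Yn ω), P.K ω)) * Real.log 2 =
        ∑' f, ∑ v, massEntropy (pickWeight (P.endWeight W f) (!v.1) v) ∧
      Summable fun f => ∑ v, massEntropy (pickWeight (P.endWeight W f) (!v.1) v) := by
  have hs : Summable fun f => ∑ v, massEntropy (pickWeight (P.endWeight W f) (!v.1) v) := by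
    refine Summable.of_nonneg_of_le (fun f => Finset.sum_nonneg fun v _ => massEntropy_nonneg
      (pickWeight_nonneg (endWeight_nonneg f) _ _)) (fun f => ?_)
      ((summable_mass_endWeight hend).mul_right (Real.log (Fintype.card (BitString m))))
    rw [Finset.sum_comm, Finset.sum_mul]
    refine Finset.sum_le_sum fun v _ => ?_
    rw [← sum_pickWeight (P.endWeight W f) (!v.1) v]
    exact massEntropy_le_log_card (pickWeight_nonneg (endWeight_nonneg f) _ _)
  refine ⟨?_, hs⟩
  rw [condEntropy_mul_log fun a => sum_real_and_fiber a fun τ => ?_]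
  · have hinj : Function.Injective fun z : List Msg × (Bool × (Fin n → 𝒴)) =>
        ((z.1, List.ofFn z.2.2), z.2.1) := by
      rintro ⟨f, k, y⟩ ⟨f', k', y'⟩ h
      simp only [Prod.mk.injEq] at h
      rw [h.1.1, h.2, List.ofFn_injective h.1.2]
    rw [← hinj.tsum_eq]
    · rw [tsum_prod_fintype]
      · refine tsum_congr fun f => Finset.sum_congr rfl fun v _ => ?_
        congr 1; ext τ
        exact real_unchosen_eq hend f v.1 v.2 τ
      · exact fun z => massEntropy_nonneg fun τ => measureReal_nonneg
      · refine hs.congr fun f => Finset.sum_congr rfl fun v _ => ?_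
        congr 1; ext τ
        exact (real_unchosen_eq hend f v.1 v.2 τ).symm
    · rintro ⟨⟨f, ys⟩, k⟩ h
      by_contra hne
      refine h ?_
      have : (fun τ => (P.law W).real
          {ω | ((P.F ω, P.Yn ω), P.K ω) = ((f, ys), k) ∧ P.unchosen ω = τ}) = fun _ => 0 := by
        ext τ
        rw [measureReal_eq_zero_iff, measure_eq_zero_iff_ae_notMem]
        filter_upwards [ae_length hend] with ω hω hω'
        simp only [Prod.mk.injEq] at hω'
        have hlen : ys.length = n := by rw [← hω'.1.1.2]; exact hω.2
        subst hlen
        exact hne ⟨(f, k, ys.get), by simp⟩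
      exact (congrArg massEntropy this).trans massEntropy_zero
  · exact nullMeasurableSet_end hend (fun f _ ys s =>
      {_ω | ((f, ys), s.2.2) = a ∧ (if s.2.2 then s.1 else s.2.1) = τ})
      fun _ _ _ _ => MeasurableSet.const _

theorem real_K_eq (f : List Msg) (a : BitString m × BitString m × (Fin n → 𝒳)) (k : Bool) :
    (P.law W).real {ω | ((P.F ω, P.Xn ω), (P.S₀ ω, P.S₁ ω)) =
      ((f, List.ofFn a.2.2), (a.1, a.2.1)) ∧ P.K ω = k} = ∑ y, P.endWeight W f a (k, y) := by
  classical
  have h := real_end_eq_sum hend f fun xs _ s =>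
    xs = List.ofFn a.2.2 ∧ s.1 = a.1 ∧ s.2.1 = a.2.1 ∧ s.2.2 = k
  have h' : {ω | ((P.F ω, P.Xn ω), (P.S₀ ω, P.S₁ ω)) =
      ((f, List.ofFn a.2.2), (a.1, a.2.1)) ∧ P.K ω = k} =
      {ω | P.F ω = f ∧ P.Xn ω = List.ofFn a.2.2 ∧ ω.1.1 = a.1 ∧ ω.1.2.1 = a.2.1 ∧
        ω.1.2.2 = k} := by
    ext ω
    simp only [Prod.mk.injEq, mem_ofPred_eq, and_assoc]
    rfl
  rw [h', h, Finset.sum_eq_single a]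
  · rw [Fintype.sum_prod_type, Finset.sum_eq_single k]
    · simp
    · intro k' _ hne; simp [hne]
    · simp
  · rintro ⟨s₀, s₁, x⟩ _ hne
    refine Finset.sum_eq_zero fun b _ => ?_
    rw [if_neg]
    rintro ⟨h1, h2, h3, -⟩
    exact hne (Prod.ext h2 (Prod.ext h3 (List.ofFn_injective h1)))
  · simp

theorem condEntropy_K_F :
    condEntropy (P.law W) P.K (fun ω => ((P.F ω, P.Xn ω), (P.S₀ ω, P.S₁ ω))) * Real.log 2 =
        ∑' f, ∑ a, massEntropy (fun k => ∑ y, P.endWeight W f a (k, y)) ∧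
      Summable fun f => ∑ a, massEntropy (fun k => ∑ y, P.endWeight W f a (k, y)) := by
  have h0 : ∀ f a k, 0 ≤ ∑ y, P.endWeight W f a (k, y) := fun f a k =>
    Finset.sum_nonneg fun y _ => endWeight_nonneg f a (k, y)
  have hs : Summable fun f => ∑ a, massEntropy (fun k => ∑ y, P.endWeight W f a (k, y)) := by
    refine Summable.of_nonneg_of_le (fun f => Finset.sum_nonneg fun a _ => massEntropy_nonneg
      (h0 f a)) (fun f => ?_) ((summable_mass_endWeight hend).mul_right (Real.log 2))
    rw [Finset.sum_mul]
    refine Finset.sum_le_sum fun a _ => ?_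
    have := massEntropy_le_log_card (h0 f a)
    rw [← Fintype.sum_prod_type'] at this
    simpa using this
  refine ⟨?_, hs⟩
  rw [condEntropy_mul_log fun a => sum_real_and_fiber a fun τ => ?_]
  · have hinj : Function.Injective
        fun z : List Msg × (BitString m × BitString m × (Fin n → 𝒳)) =>
        ((z.1, List.ofFn z.2.2.2), (z.2.1, z.2.2.1)) := by
      rintro ⟨f, s, t, x⟩ ⟨f', s', t', x'⟩ h
      simp only [Prod.mk.injEq] at h
      rw [h.1.1, h.2.1, h.2.2, List.ofFn_injective h.1.2]
    rw [← hinj.tsum_eq]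
    · rw [tsum_prod_fintype]
      · refine tsum_congr fun f => Finset.sum_congr rfl fun a _ => ?_
        congr 1; ext k
        exact real_K_eq hend f a k
      · exact fun z => massEntropy_nonneg fun τ => measureReal_nonneg
      · refine hs.congr fun f => Finset.sum_congr rfl fun a _ => ?_
        congr 1; ext k
        exact (real_K_eq hend f a k).symm
    · rintro ⟨⟨f, xs⟩, s, t⟩ h
      by_contra hne
      refine h ?_
      have : (fun k => (P.law W).real
          {ω | ((P.F ω, P.Xn ω), (P.S₀ ω, P.S₁ ω)) = ((f, xs), (s, t)) ∧ P.K ω = k}) =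
            fun _ => 0 := by
        ext τ
        rw [measureReal_eq_zero_iff, measure_eq_zero_iff_ae_notMem]
        filter_upwards [ae_length hend] with ω hω hω'
        simp only [Prod.mk.injEq] at hω'
        have hlen : xs.length = n := by rw [← hω'.1.1.2]; exact hω.1
        subst hlen
        exact hne ⟨(f, s, t, xs.get), by simp⟩
      exact (congrArg massEntropy this).trans massEntropy_zero
  · exact nullMeasurableSet_end hend (fun f xs _ s =>
      {_ω | ((f, xs), (s.1, s.2.1)) = a ∧ s.2.2 = τ})
      fun _ _ _ _ => MeasurableSet.const _

theorem nullMeasurableSet_error :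
    NullMeasurableSet {ω | P.bobOutput ω = P.chosen ω} (P.law W) := by
  refine nullMeasurableSet_end hend (fun f _ ys s =>
    {ω | P.output s.2.2 ω.2.1.2 ys f = if s.2.2 then s.2.1 else s.1}) fun f _ ys s => ?_
  exact (measurable_fst.comp (measurable_snd)).snd
    (P.measurable_output s.2.2 ys f (if s.2.2 then s.2.1 else s.1))

/-- The probability of a correct output, at a fixed end of the execution on Bob's side, is at most
that of the most probable string. -/
theorem exists_real_correct_le (f : List Msg) (v : Bool × (Fin n → 𝒴)) :
    ∃ τ, (P.law W).real ({ω | P.F ω = f ∧ P.Yn ω = List.ofFn v.2 ∧ P.K ω = v.1} ∩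
      {ω | P.bobOutput ω = P.chosen ω}) ≤ pickWeight (P.endWeight W f) v.1 v τ := by
  classical
  obtain ⟨k, y⟩ := v
  by_cases hf : ∃ l N, P.root.descend l = some N ∧ N.IsTerminal ∧ N.msgs = f
  swap
  · refine ⟨fun _ => false, le_trans (le_of_eq ?_) (pickWeight_nonneg (endWeight_nonneg f) _ _ _)⟩
    have h0 : (P.law W).real {ω | P.F ω = f} = 0 := by
      rw [← sum_sum_endWeight hend, endWeight_eq_zero hend hf]; simp
    refine le_antisymm (h0 ▸ measureReal_mono fun ω h => h.1.1) measureReal_nonneg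
  obtain ⟨l, N, hl, ht, rfl⟩ := hf
  -- The factor of the node weight that remains when Bob's private randomness is removed.
  set g : BitString m × BitString m × (Fin n → 𝒳) → ℝ := fun a =>
    (Fintype.card (BitString m × BitString m × Bool) : ℝ)⁻¹ *
      P.lawA.real (N.evA a.1 a.2.1 (List.ofFn a.2.2)) * ∏ j, (W (a.2.2 j) (y j)).toReal with hg
  have hg0 : ∀ a, 0 ≤ g a := fun a => by
    have : 0 ≤ ∏ j, (W (a.2.2 j) (y j)).toReal :=
      Finset.prod_nonneg fun _ _ => ENNReal.toReal_nonneg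
    simp only [hg]
    positivity
  have hw : ∀ a, P.endWeight W N.msgs a (k, y) = P.lawB.real (N.evB k (List.ofFn y)) * g a := by
    intro a
    rw [endWeight_of_terminal hend hl ht]
    simp only [Node.weight, hg]
    ring
  set G : BitString m → ℝ := fun τ => ∑ a, if pick k a = τ then g a else 0 with hG
  have hGw : ∀ τ, pickWeight (P.endWeight W N.msgs) k (k, y) τ =
      P.lawB.real (N.evB k (List.ofFn y)) * G τ := by
    intro τ
    simp only [pickWeight, hG, hw, Finset.mul_sum, mul_ite, mul_zero]
  -- With Bob's bit and outputs fixed at this node, his private randomness is independent of Alice's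
  -- view. Averaging his output over it does no better than always naming a maximiser of `G`.
  obtain ⟨τ₀, -, hτ₀⟩ := Finset.exists_max_image Finset.univ G ⟨fun _ => false, Finset.mem_univ _⟩
  refine ⟨τ₀, ?_⟩
  rw [hGw]
  set β : BitString m → ℝ := fun τ => P.lawB.real (N.evB k (List.ofFn y) ∩
    {r | P.output k r (List.ofFn y) N.msgs = τ}) with hβ
  have hsub : ({ω | P.F ω = N.msgs ∧ P.Yn ω = List.ofFn y ∧ P.K ω = k} ∩
      {ω | P.bobOutput ω = P.chosen ω} : Set P.Sample) ≤ᵐ[P.law W]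
      ⋃ a ∈ (Finset.univ : Finset (BitString m × BitString m × (Fin n → 𝒳))),
        ({(a.1, a.2.1, k)} ×ˢ ((N.evA a.1 a.2.1 (List.ofFn a.2.2) ×ˢ (N.evB k (List.ofFn y) ∩
          {r | P.output k r (List.ofFn y) N.msgs = pick k a})) ×ˢ
          {z | ∀ i, z.out i (a.2.2 i) = y i}) : Set P.Sample) := by
    have hall := ae_all_iff.2 fun z : (BitString m × BitString m × (Fin n → 𝒳)) =>
      endEvent_ae_eq_of_terminal hend hl ht (List.ofFn z.2.2) (List.ofFn y) (z.1, z.2.1, k)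
    filter_upwards [hall, ae_length hend] with ω hω hlen hmem
    obtain ⟨⟨h1, h2, h3⟩, h4⟩ := hmem
    obtain ⟨x, hx'⟩ : ∃ x : Fin n → 𝒳, P.Xn ω = List.ofFn x := by
      rw [← List.ofFn_get (P.Xn ω)]
      have hx := hlen.1
      generalize P.Xn ω = xs at hx
      subst hx; exact ⟨_, rfl⟩
    have h5 : ω ∈ P.endEvent N.msgs (List.ofFn x) (List.ofFn y) (ω.1.1, ω.1.2.1, k) :=
      ⟨h1, hx', h2, by rw [← h3]; rfl⟩
    have h6 : N.Mem ω (List.ofFn x) (List.ofFn y) ∧ ω.1 = (ω.1.1, ω.1.2.1, k) :=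
      (hω (ω.1.1, ω.1.2.1, x)).mp h5
    have h7 : ω ∈ {ω | N.Mem ω (List.ofFn x) (List.ofFn y) ∧ ω.1 = (ω.1.1, ω.1.2.1, k)} := h6
    have h8 : ω ∈ {ω' | N.Mem ω' (List.ofFn x) (List.ofFn y) ∧ ω'.1 = (ω.1.1, ω.1.2.1, k)} := h6
    rw [Node.setOf_mem_eq ht.1] at h8
    obtain ⟨h9, ⟨h10, h11⟩, h12⟩ := h8
    refine mem_iUnion₂.2 ⟨(ω.1.1, ω.1.2.1, x), Finset.mem_univ _, h9, ⟨h10, h11, ?_⟩, h12⟩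
    have h13 : P.output (P.K ω) ω.2.1.2 (P.Yn ω) (P.F ω) = P.chosen ω := h4
    rw [h1, h2, h3] at h13
    change P.output k ω.2.1.2 (List.ofFn y) N.msgs = _
    rw [h13]
    unfold chosen
    rw [h3]
    rfl
  have h1 : (P.law W).real ({ω | P.F ω = N.msgs ∧ P.Yn ω = List.ofFn y ∧ P.K ω = k} ∩
      {ω | P.bobOutput ω = P.chosen ω}) ≤ ∑ a, g a * β (pick k a) := by
    refine (ENNReal.toReal_mono (measure_ne_top _ _) (measure_mono_ae hsub)).trans ?_
    refine (measureReal_biUnion_finset_le _ _).trans (le_of_eq ?_)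
    refine Finset.sum_congr rfl fun a _ => ?_
    rw [law_real_rectangle]
    simp only [hg, hβ]
    ring
  have h2 : ∑ a, g a * β (pick k a) = ∑ τ, G τ * β τ := by
    simp only [hG, Finset.sum_mul]
    rw [Finset.sum_comm]
    refine Finset.sum_congr rfl fun a _ => ?_
    simp
  have h3 : ∑ τ, G τ * β τ ≤ ∑ τ, G τ₀ * β τ :=
    Finset.sum_le_sum fun τ _ => mul_le_mul_of_nonneg_right (hτ₀ τ (Finset.mem_univ τ))
      measureReal_nonneg
  have h4 : ∑ τ, β τ = P.lawB.real (N.evB k (List.ofFn y)) :=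
    sum_measureReal_inter_fiber _ (N.measurable_evB _ _) fun τ => P.measurable_output _ _ _ _
  rw [← Finset.mul_sum, h4] at h3
  linarith

/-- Fano's inequality for the chosen string. -/
theorem sum_massEntropy_chosen_le {ε : ℝ}
    (hε : 1 - ε ≤ (P.law W).real {ω | P.bobOutput ω = P.chosen ω}) (T : Finset (List Msg)) :
    ∑ f ∈ T, ∑ v, massEntropy (pickWeight (P.endWeight W f) v.1 v) ≤
      Real.log 2 + ε * (m * Real.log 2) := by
  classical
  set E : Set P.Sample := {ω | P.bobOutput ω = P.chosen ω} with hE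
  have hEm : NullMeasurableSet E (P.law W) := nullMeasurableSet_error hend
  have hEc : (P.law W).real Eᶜ ≤ ε := by
    rw [probReal_compl_eq_one_sub₀ hEm]; linarith
  set D : List Msg → (Bool × (Fin n → 𝒴)) → Set P.Sample := fun f v =>
    {ω | P.F ω = f ∧ P.Yn ω = List.ofFn v.2 ∧ P.K ω = v.1} with hD
  have hDm : ∀ f v, NullMeasurableSet (D f v) (P.law W) := fun f v =>
    nullMeasurableSet_end hend (fun g _ ys s => {_ω | g = f ∧ ys = List.ofFn v.2 ∧ s.2.2 = v.1})
      fun _ _ _ _ => MeasurableSet.const _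
  have hDs : ∀ f v, (P.law W).real (D f v) = ∑ a, P.endWeight W f a v := by
    rintro f ⟨k, y⟩
    have h := real_end_eq_sum hend f fun _ ys s => ys = List.ofFn y ∧ s.2.2 = k
    refine h.trans (Finset.sum_congr rfl fun a _ => ?_)
    rw [Finset.sum_eq_single (k, y)]
    · simp
    · rintro ⟨k', y'⟩ _ hne
      rw [if_neg]
      rintro ⟨h1, h2⟩
      exact hne (Prod.ext h2 (List.ofFn_injective h1))
    · simp
  have hlog : 0 ≤ (m : ℝ) * Real.log 2 := by positivity
  -- Fano's inequality for each of Bob's views; the failure probability of the best guess is at most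
  -- that of Bob's actual output.
  have hrow : ∀ f v, massEntropy (pickWeight (P.endWeight W f) v.1 v) ≤
      (∑ a, P.endWeight W f a v) * Real.log 2 +
        (P.law W).real (D f v ∩ Eᶜ) * (m * Real.log 2) := by
    intro f v
    obtain ⟨τ, hτ⟩ := exists_real_correct_le hend f v
    have h1 := massEntropy_le_of_guess (pickWeight_nonneg (endWeight_nonneg (P := P) (W := W) f) v.1 v) τ
    rw [sum_pickWeight, log_card_strings] at h1
    refine h1.trans ?_
    gcongr
    have h2 : (P.law W).real (D f v ∩ E) + (P.law W).real (D f v ∩ Eᶜ) =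
        (P.law W).real (D f v) := by
      rw [← sdiff_eq]; exact measureReal_inter_add_sdiff₀ hEm
    rw [hDs] at h2
    linarith
  have herr : ∀ f, ∑ v, (P.law W).real (D f v ∩ Eᶜ) ≤ (P.law W).real ({ω | P.F ω = f} ∩ Eᶜ) := by
    intro f
    rw [← measureReal_biUnion_finset₀]
    · exact measureReal_mono (iUnion₂_subset fun v _ => inter_subset_inter_left _ fun ω h => h.1)
    · rintro ⟨k, y⟩ _ ⟨k', y'⟩ _ hne
      refine (Set.disjoint_left.2 fun ω h h' => hne ?_).aedisjoint
      have hy := List.ofFn_injective (h.1.2.1.symm.trans h'.1.2.1)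
      have hk := h.1.2.2.symm.trans h'.1.2.2
      simp only at hy hk
      rw [hy, hk]
    · exact fun v _ => (hDm f v).inter hEm.compl
  calc ∑ f ∈ T, ∑ v, massEntropy (pickWeight (P.endWeight W f) v.1 v)
      ≤ ∑ f ∈ T, ((∑ a, ∑ v, P.endWeight W f a v) * Real.log 2 +
          (P.law W).real ({ω | P.F ω = f} ∩ Eᶜ) * (m * Real.log 2)) := by
        refine Finset.sum_le_sum fun f _ => (Finset.sum_le_sum fun v _ => hrow f v).trans ?_
        rw [Finset.sum_add_distrib, ← Finset.sum_mul, ← Finset.sum_mul, Finset.sum_comm]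
        gcongr
        exact herr f
    _ = (∑ f ∈ T, ∑ a, ∑ v, P.endWeight W f a v) * Real.log 2 +
          (∑ f ∈ T, (P.law W).real ({ω | P.F ω = f} ∩ Eᶜ)) * (m * Real.log 2) := by
        rw [Finset.sum_add_distrib, ← Finset.sum_mul, ← Finset.sum_mul]
    _ ≤ 1 * Real.log 2 + ε * (m * Real.log 2) := by
        gcongr
        · exact sum_mass_endWeight_le hend T
        · exact (sum_real_F_inter_le hend T hEm.compl).trans hEc
    _ = _ := by rw [one_mul]

end Ends

/-- The bound on the length of the strings in a secure protocol. -/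
theorem IsSecure.length_le [Nonempty 𝒳] {ε : ℝ} (hP : P.IsSecure W ε) {B : ℝ} (hB : 0 ≤ B)
    (hW : Node.ChannelTensionLE W B) {δ : ℝ} (hδ : 0 < δ) :
    (m - n * ε) * Real.log 2 - 2 * (Real.log 2 + ε * (m * Real.log 2)) -
      m * Real.log 2 * (ε * Real.log 2 / δ + δ) - Real.log 2 ≤ n * B := by
  have hend := hP.ends
  have hL : 0 < Real.log 2 := Real.log_pos one_lt_two
  obtain ⟨e1, s1⟩ := condEntropy_unchosen_F hend
  obtain ⟨e3, s3⟩ := condEntropy_K_F hend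
  have s0 := summable_mass_endWeight hend
  have t0 : ∑' f, ∑ a, ∑ b, P.endWeight W f a b ≤ 1 :=
    s0.tsum_le_of_sum_le (sum_mass_endWeight_le hend)
  have n2 : ∀ f, 0 ≤ ∑ v, massEntropy (pickWeight (P.endWeight W f) v.1 v) := fun f =>
    Finset.sum_nonneg fun v _ => massEntropy_nonneg (pickWeight_nonneg (endWeight_nonneg f) _ _)
  have s2 := summable_of_sum_le n2 (sum_massEntropy_chosen_le hend hP.correct)
  have t2 := s2.tsum_le_of_sum_le (sum_massEntropy_chosen_le hend hP.correct)
  -- `dist` is the dependence of `K` on Alice's view that enters `transferBound`; `gap` is the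
  -- missing entropy of `K`, which controls it through the linearised Pinsker inequality.
  set dist : List Msg → ℝ := fun f => ∑ a, |∑ y, P.endWeight W f a (false, y) -
    ∑ y, P.endWeight W f a (true, y)| with hdist
  set gap : List Msg → ℝ := fun f => (∑ a, ∑ b, P.endWeight W f a b) * Real.log 2 -
    ∑ a, massEntropy (fun k => ∑ y, P.endWeight W f a (k, y)) with hgap
  have sgap : Summable gap := (s0.mul_right _).sub s3
  have hle : ∀ f, dist f ≤ gap f / δ + δ * ∑ a, ∑ b, P.endWeight W f a b := by
    intro f
    simp only [hdist, hgap, Finset.sum_mul, ← Finset.sum_sub_distrib, Finset.sum_div,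
      Finset.mul_sum (f := fun a => ∑ b, P.endWeight W f a b), ← Finset.sum_add_distrib]
    refine Finset.sum_le_sum fun a _ => ?_
    have h := abs_sub_le_of_massEntropy
      (Finset.sum_nonneg fun y (_ : y ∈ Finset.univ) => endWeight_nonneg (P := P) (W := W) f a (false, y))
      (Finset.sum_nonneg fun y (_ : y ∈ Finset.univ) => endWeight_nonneg (P := P) (W := W) f a (true, y)) hδ
    have h1 : ∑ b, P.endWeight W f a b =
        ∑ y, P.endWeight W f a (false, y) + ∑ y, P.endWeight W f a (true, y) := by
      rw [Fintype.sum_prod_type, Fintype.sum_bool, add_comm]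
    have h2 : (fun k => ∑ y, P.endWeight W f a (k, y)) = fun b : Bool =>
        if b then ∑ y, P.endWeight W f a (true, y) else ∑ y, P.endWeight W f a (false, y) := by
      ext b; cases b <;> rfl
    rw [← Finset.sum_mul, h1, h2, Finset.sum_sub_distrib]
    exact h
  have sdom := (sgap.div_const δ).add (s0.mul_left δ)
  have sdist : Summable dist := Summable.of_nonneg_of_le
    (fun f => Finset.sum_nonneg fun a _ => abs_nonneg _) hle sdom
  -- Given the strings alone, `K` has exactly one bit of entropy, so privacy for Bob bounds the
  -- total deficit.
  have tgap : ∑' f, gap f ≤ ε * Real.log 2 := by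
    rw [hgap, (s0.mul_right _).tsum_sub s3, ← e3, tsum_mul_right]
    have h := hP.privacy_bob
    rw [condMutualInfo, condEntropy_K_strings] at h
    have h2 := mul_le_mul_of_nonneg_right h hL.le
    have h3 := mul_le_mul_of_nonneg_right t0 hL.le
    linarith
  have tdist : ∑' f, dist f ≤ ε * Real.log 2 / δ + δ := by
    refine (sdist.tsum_le_tsum hle sdom).trans ?_
    rw [(sgap.div_const δ).tsum_add (s0.mul_left δ), tsum_div_const, tsum_mul_left]
    have h1 : (∑' f, gap f) / δ ≤ ε * Real.log 2 / δ := by gcongr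
    have h2 := mul_le_mul_of_nonneg_left t0 hδ.le
    linarith
  have hsum : HasSum (fun f => transferBound (P.endWeight W f))
      (∑' f, ∑ v, massEntropy (pickWeight (P.endWeight W f) (!v.1) v) -
        2 * ∑' f, ∑ v, massEntropy (pickWeight (P.endWeight W f) v.1 v) -
        Real.log (Fintype.card (BitString m)) * ∑' f, dist f -
        (∑' f, ∑ a, ∑ b, P.endWeight W f a b) * Real.log 2) :=
    ((s1.hasSum.sub (s2.hasSum.mul_left 2)).sub (sdist.hasSum.mul_left _)).sub
      (s0.hasSum.mul_right _)
  have htot := hasSum_le_of_sum_le hsum (sum_transferBound_endWeight_le hend hB hW)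
  rw [← e1, log_card_strings] at htot
  -- The unchosen string has entropy `m` given `K`, so at least `m - n * ε` bits remain given Bob's
  -- view and the transcript.
  have h := hP.privacy_alice
  rw [condMutualInfo, condEntropy_unchosen_K] at h
  have h1 := mul_le_mul_of_nonneg_right h hL.le
  have h2 : (m : ℝ) * Real.log 2 * ∑' f, dist f ≤
      m * Real.log 2 * (ε * Real.log 2 / δ + δ) :=
    mul_le_mul_of_nonneg_left tdist (by positivity)
  have h3 := mul_le_mul_of_nonneg_right t0 hL.le
  linarith

end OTProtocol

/-! ### The single-letter expression as a function of a kernel -/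

section DiscreteLaw

theorem PMF.ext_toReal {α : Type*} {p q : PMF α} (h : ∀ a, (p a).toReal = (q a).toReal) : p = q :=
  PMF.ext fun a => (ENNReal.toReal_eq_toReal_iff' (p.apply_ne_top a) (q.apply_ne_top a)).1 (h a)

variable {α β γ : Type*} [Fintype α]

theorem discreteLaw_real (r : PMF α) (S : Set α) :
    @Measure.real α ⊤ (discreteLaw r) S = ∑ t, S.indicator (fun t => (r t).toReal) t := by
  classical
  let _ : MeasurableSpace α := ⊤
  change ((r.toMeasure S).toReal) = _
  rw [PMF.toMeasure_apply_fintype, ENNReal.toReal_sum]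
  · refine Finset.sum_congr rfl fun t _ => ?_
    by_cases h : t ∈ S <;> simp [h]
  · intro t _
    by_cases h : t ∈ S <;> simp [h, PMF.apply_ne_top]

theorem condEntropy_discreteLaw_mul_log [Fintype β] [Fintype γ] [DecidableEq β] [DecidableEq γ]
    (r : PMF α) (B : α → β) (A : α → γ) :
    @condEntropy α γ β ⊤ _ _ (discreteLaw r) B A * Real.log 2 =
      ∑ a, massEntropy fun b => ∑ t, if A t = a ∧ B t = b then (r t).toReal else 0 := by
  let _ : MeasurableSpace α := ⊤
  rw [condEntropy_mul_log, tsum_fintype]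
  · refine Finset.sum_congr rfl fun a _ => congrArg massEntropy (funext fun b => ?_)
    rw [discreteLaw_real]
    exact Finset.sum_congr rfl fun t _ => by simp [Set.indicator_apply]
  · intro a
    simp only [discreteLaw_real]
    rw [Finset.sum_comm]
    refine Finset.sum_congr rfl fun t _ => ?_
    by_cases h : A t = a <;> simp [Set.indicator_apply, h]

theorem PMF.toReal_map_apply [Fintype β] [DecidableEq β] (r : PMF α) (f : α → β) (b : β) :
    ((r.map f) b).toReal = ∑ a, if f a = b then (r a).toReal else 0 := by
  classical
  rw [PMF.map_apply, tsum_fintype, ENNReal.toReal_sum]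
  · refine Finset.sum_congr rfl fun a _ => ?_
    by_cases h : f a = b
    · simp [h]
    · simp [h, Ne.symm h]
  · intro a _
    split_ifs <;> simp [PMF.apply_ne_top]

/-- A point of the standard simplex is a law. -/
theorem exists_pmf_toReal {v : α → ℝ} (hv : v ∈ stdSimplex ℝ α) :
    ∃ p : PMF α, ∀ a, (p a).toReal = v a := by
  refine ⟨PMF.ofFintype (fun a => ENNReal.ofReal (v a)) ?_, fun a => ?_⟩
  · rw [← ENNReal.ofReal_sum_of_nonneg fun a _ => hv.1 a, hv.2, ENNReal.ofReal_one]
  · rw [PMF.ofFintype_apply, ENNReal.toReal_ofReal (hv.1 a)]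

theorem PMF.toReal_mem_stdSimplex (p : PMF α) : (fun a => (p a).toReal) ∈ stdSimplex ℝ α :=
  ⟨fun _ => ENNReal.toReal_nonneg, OTProtocol.Node.sum_toReal_pmf p⟩

/-- A continuous function of the law has a maximum. -/
theorem exists_isGreatest_range_pmf [Nonempty α] {f : (α → ℝ) → ℝ} (hf : Continuous f) :
    ∃ B, IsGreatest (Set.range fun p : PMF α => f fun a => (p a).toReal) B := by
  classical
  obtain ⟨v, hv, hmax⟩ := (isCompact_stdSimplex ℝ α).exists_isMaxOn
    ⟨_, ite_eq_mem_stdSimplex ℝ (Classical.arbitrary α)⟩ hf.continuousOn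
  obtain ⟨p, hp⟩ := exists_pmf_toReal hv
  refine ⟨f v, ⟨p, congrArg f (funext hp)⟩, ?_⟩
  rintro _ ⟨q, rfl⟩
  exact hmax q.toReal_mem_stdSimplex

end DiscreteLaw

/-! ### Values of the single-letter expression as tensions of kernels -/

section SingleLetterKernel

variable {𝒳 : Type u} {𝒴 : Type v} [Fintype 𝒳] [Fintype 𝒴] (W : 𝒳 → PMF 𝒴)

/-- The weights `v x * W(y|x)`. -/
noncomputable def channelWeight (v : 𝒳 → ℝ) (x : 𝒳) (y : 𝒴) : ℝ := v x * (W x y).toReal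

theorem sum_channelWeight {𝒳 : Type*} (W : 𝒳 → PMF 𝒴) (v : 𝒳 → ℝ) (x : 𝒳) : ∑ y, channelWeight W v x y = v x := by
  simp [channelWeight, ← Finset.mul_sum, OTProtocol.Node.sum_toReal_pmf]

theorem toReal_inputOutput (p : PMF 𝒳) (x : 𝒳) (y : 𝒴) :
    (inputOutput W p (x, y)).toReal = channelWeight W (fun x => (p x).toReal) x y := by
  classical
  rw [inputOutput, PMF.bind_apply, tsum_eq_single x, ENNReal.toReal_mul, PMF.toReal_map_apply]
  · simp [channelWeight]
  · intro x' hx'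
    rw [mul_eq_zero]; right
    rw [PMF.map_apply, ENNReal.tsum_eq_zero]
    intro y'
    simp [Ne.symm hx']

theorem tensionSum_mul_log {Q : Type*} [Fintype Q] {r : PMF (𝒳 × 𝒴 × Q)} {w : 𝒳 → 𝒴 → ℝ}
    {κ : 𝒳 → Q → ℝ} (hκ : ∀ x, κ x ∈ stdSimplex ℝ Q)
    (hr : ∀ x y q, (r (x, y, q)).toReal = w x y * κ x q) :
    tensionSum r * Real.log 2 = tension w κ := by
  classical
  have e1 : ∀ (y : 𝒴), (fun q => ∑ t : 𝒳 × 𝒴 × Q,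
      if t.2.1 = y ∧ t.2.2 = q then (r t).toReal else 0) = fun q => ∑ x, w x y * κ x q := by
    intro y; ext q
    simp [Fintype.sum_prod_type, ite_and, hr]
  have e2 : ∀ (z : 𝒳 × 𝒴), (fun q => ∑ t : 𝒳 × 𝒴 × Q,
      if (t.1, t.2.1) = z ∧ t.2.2 = q then (r t).toReal else 0) =
        fun q => w z.1 z.2 * κ z.1 q := by
    rintro ⟨x, y⟩; ext q
    simp [Fintype.sum_prod_type, ite_and, hr]
  have e3 : ∀ (q : Q), (fun y => ∑ t : 𝒳 × 𝒴 × Q,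
      if t.2.2 = q ∧ t.2.1 = y then (r t).toReal else 0) = fun y => ∑ x, w x y * κ x q := by
    intro q; ext y
    simp [Fintype.sum_prod_type, ite_and, hr]
  have e4 : ∀ (z : 𝒳 × Q), (fun y => ∑ t : 𝒳 × 𝒴 × Q,
      if (t.1, t.2.2) = z ∧ t.2.1 = y then (r t).toReal else 0) =
        fun y => w z.1 y * κ z.1 z.2 := by
    rintro ⟨x, q⟩; ext y
    simp [Fintype.sum_prod_type, ite_and, hr]
  unfold tensionSum condMutualInfo
  rw [add_mul, sub_mul, sub_mul]
  simp only [condEntropy_discreteLaw_mul_log, e1, e2, e3, e4, massEntropy_smul,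
    massEntropy_mul_right]
  simp only [Fintype.sum_prod_type, ← Finset.sum_mul, ← Finset.mul_sum, (hκ _).2, mul_one, tension]

/-- The kernel is the conditional law of `Q` given `X`; the Markov property says that it does not
depend on `Y`. -/
theorem exists_kernel_of_isMarkovQXY {Q : Type*} [Fintype Q] {p : PMF 𝒳}
    {r : PMF (𝒳 × 𝒴 × Q)} (hr : (r.map fun t => (t.1, t.2.1)) = inputOutput W p)
    (hM : IsMarkovQXY r) :
    ∃ κ : 𝒳 → Q → ℝ, (∀ x, κ x ∈ stdSimplex ℝ Q) ∧ ∀ x y q,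
      (r (x, y, q)).toReal = channelWeight W (fun x => (p x).toReal) x y * κ x q := by
  classical
  have hXY : ∀ x y, ∑ q, (r (x, y, q)).toReal = channelWeight W (fun x => (p x).toReal) x y := by
    intro x y
    rw [← toReal_inputOutput, ← hr, PMF.toReal_map_apply]
    simp only [Fintype.sum_prod_type]
    rw [Finset.sum_eq_single x, Finset.sum_eq_single y] <;> simp +contextual
  have hX : ∀ x, ∑ y, ∑ q, (r (x, y, q)).toReal = (p x).toReal := by
    intro x; simp only [hXY, sum_channelWeight]
  have hM' : ∀ x y q, (r (x, y, q)).toReal * (p x).toReal =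
      channelWeight W (fun x => (p x).toReal) x y * ∑ y, (r (x, y, q)).toReal := by
    intro x y q
    have h := congrArg ENNReal.toReal (hM x y q)
    rw [ENNReal.toReal_mul, ENNReal.toReal_mul, hr, toReal_inputOutput, PMF.toReal_map_apply,
      PMF.toReal_map_apply] at h
    have h3 : ∑ a : 𝒳 × 𝒴 × Q, (if a.1 = x then (r a).toReal else 0) = (p x).toReal := by
      rw [← hX x, Fintype.sum_prod_type, Finset.sum_eq_single x]
      · simp [Fintype.sum_prod_type]
      · simp +contextual
      · simp
    simpa [h3, Fintype.sum_prod_type, ite_and] using h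
  -- Some value of `Q` exists because a law has nonempty support; a point mass at it serves for
  -- inputs of probability zero.
  obtain ⟨⟨_, _, q₀⟩, -⟩ := r.support_nonempty
  refine ⟨fun x => if (p x).toReal = 0 then fun q => if q₀ = q then 1 else 0
    else fun q => (∑ y, (r (x, y, q)).toReal) / (p x).toReal, fun x => ?_, fun x y q => ?_⟩
  · dsimp only
    split_ifs with h
    · exact ite_eq_mem_stdSimplex ℝ q₀
    · refine ⟨fun q => by positivity, ?_⟩
      rw [← Finset.sum_div, Finset.sum_comm, hX, div_self h]
  · dsimp only
    split_ifs with h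
    · have h1 : ∑ q, (r (x, y, q)).toReal = 0 := by rw [hXY, channelWeight, h, zero_mul]
      rw [channelWeight, h, zero_mul, zero_mul]
      exact (Finset.sum_eq_zero_iff_of_nonneg fun _ _ => ENNReal.toReal_nonneg).1 h1 q
        (Finset.mem_univ q)
    · rw [← mul_div_assoc, ← hM', mul_div_cancel_right₀ _ h]

theorem exists_pmf_of_kernel {Q : Type*} [Fintype Q] (p : PMF 𝒳) {κ : 𝒳 → Q → ℝ}
    (hκ : ∀ x, κ x ∈ stdSimplex ℝ Q) :
    ∃ r : PMF (𝒳 × 𝒴 × Q), (r.map fun t => (t.1, t.2.1)) = inputOutput W p ∧ IsMarkovQXY r ∧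
      ∀ x y q, (r (x, y, q)).toReal = channelWeight W (fun x => (p x).toReal) x y * κ x q := by
  classical
  set w := channelWeight W fun x => (p x).toReal with hw
  obtain ⟨r, hr⟩ := exists_pmf_toReal (v := fun t : 𝒳 × 𝒴 × Q => w t.1 t.2.1 * κ t.1 t.2.2)
    ⟨fun t => mul_nonneg (mul_nonneg ENNReal.toReal_nonneg ENNReal.toReal_nonneg) ((hκ _).1 _), by
      simp only [Fintype.sum_prod_type, ← Finset.mul_sum, (hκ _).2, mul_one, hw,
        sum_channelWeight, OTProtocol.Node.sum_toReal_pmf]⟩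
  refine ⟨r, ?_, ?_, fun x y q => hr (x, y, q)⟩
  · refine PMF.ext_toReal fun z => ?_
    obtain ⟨x, y⟩ := z
    rw [toReal_inputOutput, PMF.toReal_map_apply]
    simp [Fintype.sum_prod_type, ite_and, hr, ← Finset.mul_sum, (hκ _).2, hw]
  · intro x y q
    rw [← ENNReal.toReal_eq_toReal_iff' (ENNReal.mul_ne_top (PMF.apply_ne_top _ _)
      (PMF.apply_ne_top _ _)) (ENNReal.mul_ne_top (PMF.apply_ne_top _ _) (PMF.apply_ne_top _ _)),
      ENNReal.toReal_mul, ENNReal.toReal_mul, PMF.toReal_map_apply, PMF.toReal_map_apply,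
      PMF.toReal_map_apply]
    simp only [Fintype.sum_prod_type, ite_and, hr, Prod.mk.injEq, Finset.sum_ite_eq',
      Finset.mem_univ, if_true, Finset.sum_ite_irrel, Finset.sum_const_zero, ← Finset.mul_sum,
      ← Finset.sum_mul, (hκ _).2, mul_one, hw, sum_channelWeight]
    ring

theorem mem_tensionValues_iff (p : PMF 𝒳) (t : ℝ) :
    t ∈ tensionValues W p ↔ ∃ k : ℕ, k ≤ Fintype.card 𝒳 * Fintype.card 𝒴 + 2 ∧
      ∃ κ : 𝒳 → Fin k → ℝ, (∀ x, κ x ∈ stdSimplex ℝ (Fin k)) ∧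
        t * Real.log 2 = tension (channelWeight W fun x => (p x).toReal) κ := by
  have h2 : Real.log 2 ≠ 0 := (Real.log_pos one_lt_two).ne'
  constructor
  · rintro ⟨k, hk, r, hr, hM, rfl⟩
    obtain ⟨κ, hκ, h⟩ := exists_kernel_of_isMarkovQXY W hr hM
    exact ⟨k, hk, κ, hκ, tensionSum_mul_log hκ h⟩
  · rintro ⟨k, hk, κ, hκ, ht⟩
    obtain ⟨r, hr, hM, h⟩ := exists_pmf_of_kernel W p hκ
    refine ⟨k, hk, r, hr, hM, mul_right_cancel₀ h2 ?_⟩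
    rw [ht, tensionSum_mul_log hκ h]

/-- A constant `Q`. -/
theorem inputOutputInfo_mul_log (p : PMF 𝒳) :
    inputOutputInfo W p * Real.log 2 =
      tension (channelWeight W fun x => (p x).toReal) fun _ (_ : Fin 1) => 1 := by
  classical
  unfold inputOutputInfo mutualInfo condMutualInfo
  rw [sub_mul]
  simp only [condEntropy_discreteLaw_mul_log, Fintype.sum_prod_type, tension, massEntropy_of_unique,
    toReal_inputOutput]
  simp [ite_and]

/-- `Q = X`. -/
theorem inputEquivocation_mul_log (p : PMF 𝒳) {Q : Type*} [Fintype Q] [DecidableEq Q]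
    (e : 𝒳 ≃ Q) :
    inputEquivocation W p * Real.log 2 =
      tension (channelWeight W fun x => (p x).toReal) fun x q => if e x = q then 1 else 0 := by
  classical
  have h0 : ∀ x, massEntropy (fun q => if e x = q then (1 : ℝ) else 0) = 0 := by
    intro x; simp [massEntropy, apply_ite]
  unfold inputEquivocation
  rw [condEntropy_discreteLaw_mul_log, tension]
  simp only [h0, mul_zero, Finset.sum_const_zero, sub_zero]
  have h1 : ∀ (q : Q) (y : 𝒴), (∑ x, channelWeight W (fun x => (p x).toReal) x y *
      if e x = q then 1 else 0) = channelWeight W (fun x => (p x).toReal) (e.symm q) y := by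
    intro q y
    simp [← Equiv.eq_symm_apply]
  simp only [h1]
  rw [Equiv.sum_comp e.symm fun x => massEntropy fun y =>
    channelWeight W (fun x => (p x).toReal) x y, sub_self, add_zero]
  refine Finset.sum_congr rfl fun y _ => ?_
  rw [← massEntropy_comp_equiv e.symm]
  simp [Fintype.sum_prod_type, ite_and, toReal_inputOutput]

theorem inputOutputInfo_mem_tensionValues (p : PMF 𝒳) :
    inputOutputInfo W p ∈ tensionValues W p :=
  (mem_tensionValues_iff W p _).2 ⟨1, by omega, _, fun _ => ⟨fun _ => zero_le_one, by simp⟩,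
    inputOutputInfo_mul_log W p⟩

theorem inputEquivocation_mem_tensionValues (p : PMF 𝒳) :
    inputEquivocation W p ∈ tensionValues W p := by
  obtain ⟨x, -⟩ := p.support_nonempty
  obtain ⟨y, -⟩ := (W x).support_nonempty
  -- A nonempty output alphabet gives `|𝒳| ≤ |𝒳| |𝒴|`, so `Q = X` is within the allowed number of
  -- values.
  have : 0 < Fintype.card 𝒴 := Fintype.card_pos_iff.2 ⟨y⟩
  refine (mem_tensionValues_iff W p _).2 ⟨Fintype.card 𝒳, by nlinarith, _,
    fun x => ite_eq_mem_stdSimplex ℝ _, inputEquivocation_mul_log W p (Fintype.equivFin 𝒳)⟩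

/-! ### The minimum and the maximum -/

theorem continuous_tension_channelWeight {Q : Type*} [Fintype Q] :
    Continuous fun z : (𝒳 → ℝ) × (𝒳 → Q → ℝ) => tension (channelWeight W z.1) z.2 := by
  unfold tension channelWeight
  refine .add (.sub ?_ ?_) (.sub ?_ ?_)
  · exact continuous_finsetSum _ fun v _ => continuous_massEntropy.comp (by fun_prop)
  · refine continuous_finsetSum _ fun x _ => .mul (by fun_prop) ?_
    exact continuous_massEntropy.comp (by fun_prop)
  · exact continuous_finsetSum _ fun v _ => continuous_massEntropy.comp (by fun_prop)
  · exact continuous_finsetSum _ fun v _ => continuous_massEntropy.comp (by fun_prop)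

theorem isCompact_setOf_kernel {α : Type*} (Q : Type*) [Fintype Q] :
    IsCompact {κ : α → Q → ℝ | ∀ x, κ x ∈ stdSimplex ℝ Q} :=
  isCompact_pi_infinite fun _ => isCompact_stdSimplex ℝ Q

/-- The minimum over the kernels with `k + 1` values, in nats. -/
noncomputable def minTensionFin (k : ℕ) (v : 𝒳 → ℝ) : ℝ :=
  sInf ((fun κ : 𝒳 → Fin (k + 1) → ℝ => tension (channelWeight W v) κ) ''
    {κ | ∀ x, κ x ∈ stdSimplex ℝ (Fin (k + 1))})

theorem isLeast_minTensionFin (k : ℕ) (v : 𝒳 → ℝ) :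
    IsLeast ((fun κ : 𝒳 → Fin (k + 1) → ℝ => tension (channelWeight W v) κ) ''
      {κ | ∀ x, κ x ∈ stdSimplex ℝ (Fin (k + 1))}) (minTensionFin W k v) := by
  have hc : Continuous fun κ : 𝒳 → Fin (k + 1) → ℝ => tension (channelWeight W v) κ :=
    Continuous.comp (g := fun z : (𝒳 → ℝ) × (𝒳 → Fin (k + 1) → ℝ) =>
      tension (channelWeight W z.1) z.2) (f := fun κ => (v, κ))
      (continuous_tension_channelWeight W) (by fun_prop)
  refine ((isCompact_setOf_kernel _).image hc).isLeast_sInf ?_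
  · exact Set.Nonempty.image _ ⟨_, fun _ => ite_eq_mem_stdSimplex ℝ 0⟩

/-- The minimum of a jointly continuous function over a compact set depends continuously on the
parameter. -/
theorem continuous_minTensionFin (k : ℕ) : Continuous (minTensionFin W k) :=
  (isCompact_setOf_kernel _).continuous_sInf
    (f := fun v (κ : 𝒳 → Fin (k + 1) → ℝ) => tension (channelWeight W v) κ)
    (continuous_tension_channelWeight W)

/-- The minimum over the kernels with at most `|𝒳| |𝒴| + 2` values, in nats. -/
noncomputable def minTension (v : 𝒳 → ℝ) : ℝ :=
  -- As `minTensionFin` uses `k + 1` values, the range covers the sizes from 1 to `|𝒳| |𝒴| + 2`.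
  -- Size 0 admits no kernel on a nonempty alphabet.
  (Finset.range (Fintype.card 𝒳 * Fintype.card 𝒴 + 2)).inf' ⟨0, by simp⟩
    fun k => minTensionFin W k v

theorem continuous_minTension : Continuous (minTension W) :=
  Continuous.finset_inf'_apply _ fun k _ => continuous_minTensionFin W k

theorem exists_tension_eq_minTension (v : 𝒳 → ℝ) :
    ∃ k : ℕ, k ≤ Fintype.card 𝒳 * Fintype.card 𝒴 + 2 ∧
      ∃ κ : 𝒳 → Fin k → ℝ, (∀ x, κ x ∈ stdSimplex ℝ (Fin k)) ∧
        minTension W v = tension (channelWeight W v) κ := by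
  obtain ⟨k, hk, h⟩ := Finset.exists_mem_eq_inf'
    (s := Finset.range (Fintype.card 𝒳 * Fintype.card 𝒴 + 2)) ⟨0, by simp⟩
    fun k => minTensionFin W k v
  obtain ⟨κ, hκ, h'⟩ := (isLeast_minTensionFin W k v).1
  exact ⟨k + 1, Finset.mem_range.1 hk, κ, hκ, h.trans h'.symm⟩

theorem minTension_le (v : 𝒳 → ℝ) [Nonempty 𝒳] {k : ℕ}
    (hk : k ≤ Fintype.card 𝒳 * Fintype.card 𝒴 + 2) {κ : 𝒳 → Fin k → ℝ}
    (hκ : ∀ x, κ x ∈ stdSimplex ℝ (Fin k)) : minTension W v ≤ tension (channelWeight W v) κ := by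
  obtain _ | k := k
  · have := (hκ (Classical.arbitrary 𝒳)).2
    simp at this
  · exact (Finset.inf'_le (fun k => minTensionFin W k v) (Finset.mem_range.2 hk)).trans
      ((isLeast_minTensionFin W k v).2 ⟨κ, hκ, rfl⟩)

theorem isLeast_tensionValues [Nonempty 𝒳] (p : PMF 𝒳) :
    IsLeast (tensionValues W p) (minTension W (fun x => (p x).toReal) / Real.log 2) := by
  have h2 : 0 < Real.log 2 := Real.log_pos one_lt_two
  constructor
  · rw [mem_tensionValues_iff, div_mul_cancel₀ _ h2.ne']
    exact exists_tension_eq_minTension W _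
  · intro t ht
    obtain ⟨k, hk, κ, hκ, h⟩ := (mem_tensionValues_iff W p t).1 ht
    rw [div_le_iff₀ h2, h]
    exact minTension_le W _ hk hκ

theorem minTension_nonneg {v : 𝒳 → ℝ} (hv : ∀ x, 0 ≤ v x) : 0 ≤ minTension W v := by
  obtain ⟨k, -, κ, hκ, h⟩ := exists_tension_eq_minTension W v
  rw [h]
  exact tension_nonneg (fun x y => mul_nonneg (hv x) ENNReal.toReal_nonneg)
    (fun x => (hκ x).1) fun x => (hκ x).2

/-- A bound for all laws on the input alphabet extends to all weights on it. -/
theorem OTProtocol.Node.channelTensionLE_of_minTension_le {B : ℝ}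
    (h : ∀ p : PMF 𝒳, minTension W (fun x => (p x).toReal) ≤ B) :
    OTProtocol.Node.ChannelTensionLE W B := by
  intro v hv
  rcases eq_or_ne (∑ x, v x) 0 with h0 | h0
  · obtain ⟨k, -, κ, hκ, -⟩ := exists_tension_eq_minTension W v
    refine ⟨k, κ, fun x => (hκ x).1, fun x => (hκ x).2, ?_⟩
    have hv0 : ∀ x, v x = 0 := fun x =>
      (Finset.sum_eq_zero_iff_of_nonneg fun x _ => hv x).1 h0 x (Finset.mem_univ x)
    simp [hv0, tension_zero]
  · have hpos : 0 ≤ ∑ x, v x := Finset.sum_nonneg fun x _ => hv x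
    obtain ⟨p, hp⟩ := exists_pmf_toReal (v := fun x => v x / ∑ x, v x)
      ⟨fun x => div_nonneg (hv x) hpos, by rw [← Finset.sum_div, div_self h0]⟩
    obtain ⟨k, -, κ, hκ, hk⟩ := exists_tension_eq_minTension W fun x => (p x).toReal
    refine ⟨k, κ, fun x => (hκ x).1, fun x => (hκ x).2, ?_⟩
    -- Tension is homogeneous in the weight, so normalising `v` loses nothing.
    have h1 : (fun x y => v x * (W x y).toReal) =
        fun x y => (∑ x, v x) * channelWeight W (fun x => (p x).toReal) x y := by
      ext x y
      simp only [channelWeight, hp]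
      field_simp
    rw [h1, tension_smul, ← hk]
    exact mul_le_mul_of_nonneg_left (h p) hpos

end SingleLetterKernel

/-! ### The capacity -/

section Capacity

variable {𝒳 : Type u} {𝒴 : Type v} [Fintype 𝒳] [Nonempty 𝒳] [Fintype 𝒴] {W : 𝒳 → PMF 𝒴}

/-- Divide `length_le` by `n` and let `n → ∞` with `δ` fixed: only the loss `R * δ` from Pinsker's
inequality survives, and then `δ → 0`. -/
theorem OTAchievable.le {R B : ℝ} (hR : OTAchievable.{u, v, w} W R) (hB : 0 ≤ B)
    (hW : OTProtocol.Node.ChannelTensionLE W (B * Real.log 2)) : R ≤ B := by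
  obtain ⟨hR0, ε, hε, hP⟩ := hR
  have h2 : 0 < Real.log 2 := Real.log_pos one_lt_two
  set L := Real.log 2 with hL
  have hinv : Tendsto (fun n : ℕ => (n : ℝ)⁻¹) atTop (𝓝 0) := tendsto_inv_atTop_nhds_zero_nat
  have hm : Tendsto (fun n : ℕ => (⌊(n : ℝ) * R⌋₊ : ℝ) / n) atTop (𝓝 R) := by
    have := (tendsto_nat_floor_mul_div_atTop hR0).comp (tendsto_natCast_atTop_atTop (R := ℝ))
    simpa only [Function.comp_def, mul_comm] using this
  have key : ∀ δ : ℝ, 0 < δ → R * L - R * L * δ ≤ B * L := by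
    intro δ hδ
    have hlim : Tendsto (fun n : ℕ => ((⌊(n : ℝ) * R⌋₊ : ℝ) / n - ε n) * L
        - 2 * (L * (n : ℝ)⁻¹ + ε n * ((⌊(n : ℝ) * R⌋₊ : ℝ) / n * L))
        - (⌊(n : ℝ) * R⌋₊ : ℝ) / n * L * (ε n * L / δ + δ) - L * (n : ℝ)⁻¹) atTop
        (𝓝 ((R - 0) * L - 2 * (L * 0 + 0 * (R * L)) - R * L * (0 * L / δ + δ) - L * 0)) :=
      ((((hm.sub hε).mul_const L).sub (((hinv.const_mul L).add
        (hε.mul (hm.mul_const L))).const_mul 2)).sub ((hm.mul_const L).mul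
          (((hε.mul_const L).div_const δ).add_const δ))).sub (hinv.const_mul L)
    have hle := le_of_tendsto hlim (b := B * L) (by
      filter_upwards [eventually_gt_atTop 0] with n hn
      obtain ⟨P, hPn⟩ := hP n
      have h := hPn.length_le (mul_nonneg hB h2.le) hW hδ
      have hn' : (0 : ℝ) < n := Nat.cast_pos.2 hn
      rw [← hL] at h
      refine le_of_mul_le_mul_left (le_of_eq_of_le ?_ h) hn'
      field_simp)
    simpa using hle
  have hRL : R * L ≤ B * L := by
    refine le_of_forall_pos_le_add fun η hη => ?_
    have hpos : 0 < R * L + 1 := by positivity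
    -- Adding 1 keeps the denominator positive when `R = 0`.
    have h := key (η / (R * L + 1)) (by positivity)
    have h' : R * L * (η / (R * L + 1)) ≤ η := by
      rw [← mul_div_assoc, div_le_iff₀ hpos]
      nlinarith
    linarith
  exact le_of_mul_le_mul_right hRL h2

theorem otCapacity_le {B : ℝ} (hB : 0 ≤ B)
    (hW : OTProtocol.Node.ChannelTensionLE W (B * Real.log 2)) :
    otCapacity.{u, v, w} W ≤ (B : EReal) := by
  refine sSup_le ?_
  rintro _ ⟨R, hR, rfl⟩
  exact EReal.coe_le_coe_iff.2 (OTAchievable.le hR hB hW)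

/-- The minimum of `I(X;Y)` and `H(X|Y)` attains its maximum. -/
theorem exists_isGreatest_min_info (W : 𝒳 → PMF 𝒴) : ∃ A : ℝ, IsGreatest
    (Set.range fun p => min (inputOutputInfo W p) (inputEquivocation W p)) A := by
  have hc : ∀ (k : ℕ) (κ : 𝒳 → Fin k → ℝ),
      Continuous fun v : 𝒳 → ℝ => tension (channelWeight W v) κ := fun k κ =>
    Continuous.comp (g := fun z : (𝒳 → ℝ) × (𝒳 → Fin k → ℝ) => tension (channelWeight W z.1) z.2)
      (f := fun v => (v, κ)) (continuous_tension_channelWeight W) (by fun_prop)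
  have h := exists_isGreatest_range_pmf (((hc 1 fun _ _ => 1).div_const (Real.log 2)).min
    ((hc _ fun x q => if Fintype.equivFin 𝒳 x = q then 1 else 0).div_const (Real.log 2)))
  have h2 : Real.log 2 ≠ 0 := (Real.log_pos one_lt_two).ne'
  simpa only [← inputOutputInfo_mul_log, ← inputEquivocation_mul_log, mul_div_cancel_right₀ _ h2]
    using h

end Capacity

theorem theorem1 {𝒳 : Type u} {𝒴 : Type v} [Fintype 𝒳] [Nonempty 𝒳] [Fintype 𝒴]
    (W : 𝒳 → PMF 𝒴) :
    ∃ (α : PMF 𝒳 → ℝ) (B : ℝ),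
      (∀ p, IsLeast (tensionValues W p) (α p)) ∧
      IsGreatest (Set.range α) B ∧
      otCapacity.{u, v, w} W ≤ (B : EReal) ∧
      (∀ p, inputOutputInfo W p ∈ tensionValues W p ∧
        inputEquivocation W p ∈ tensionValues W p) ∧
      ∃ A : ℝ, IsGreatest
        (Set.range fun p => min (inputOutputInfo W p) (inputEquivocation W p)) A ∧ B ≤ A := by
  have h2 : 0 < Real.log 2 := Real.log_pos one_lt_two
  obtain ⟨B, hB⟩ := exists_isGreatest_range_pmf
    ((continuous_minTension W).div_const (Real.log 2))
  obtain ⟨A, hA⟩ := exists_isGreatest_min_info W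
  refine ⟨_, B, isLeast_tensionValues W, hB, otCapacity_le ?_ ?_,
    fun p => ⟨inputOutputInfo_mem_tensionValues W p, inputEquivocation_mem_tensionValues W p⟩,
    A, hA, ?_⟩
  · obtain ⟨p, hp⟩ := hB.1
    rw [← hp]
    exact div_nonneg (minTension_nonneg W fun x => ENNReal.toReal_nonneg) h2.le
  · exact OTProtocol.Node.channelTensionLE_of_minTension_le W fun p =>
      (div_le_iff₀ h2).1 (hB.2 ⟨p, rfl⟩)
  -- At a maximising input law the minimum is at most both special values, hence at most their
  -- minimum there.
  · obtain ⟨p, hp⟩ := hB.1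
    rw [← hp]
    exact (le_min ((isLeast_tensionValues W p).2 (inputOutputInfo_mem_tensionValues W p))
      ((isLeast_tensionValues W p).2 (inputEquivocation_mem_tensionValues W p))).trans
        (hA.2 ⟨p, rfl⟩)
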